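/- **Setting.** Let $(\Omega,\mathcal F)$ be a measurable space and $\mathscr H$ a linear space of real measurable functions on $\Omega$ such that $\varphi(X_1,\dots,X_n)\in\mathscr H$ whenever $X_1,\dots,X_n\in\mathscr H$ and $\varphi\in C_{l,Lip}(\mathbb R^n)$, i.e. $|\varphi(x)-\varphi(y)|\le C(1+|x|^m+|y|^m)|x-y|$ for some $C>0$, $m\in\mathbb N$. Let $\widehat{\mathbb E}:\mathscr H\to[-\infty,\infty]$ be a sub-linear expectation: monotone, $\widehat{\mathbb E}[c]=c$ for constants, $\widehat{\mathbb E}[X+Y]\le\widehat{\mathbb E}[X]+\widehat{\mathbb E}[Y]$ whenever the right side is not of the form $\infty-\infty$, and $\widehat{\mathbb E}[\lambda X]=\lambda\widehat{\mathbb E}[X]$ for $\lambda\ge0$ (with $0\cdot\infty=0$). Put $\widehat{\mathcal E}[X]=-\widehat{\mathbb E}[-X]$. A random vector $Y$ in $\mathscr H^n$ is independent to a random vector $X$ in $\mathscr H^m$ if $\widehat{\mathbb E}[\varphi(X,Y)]=\widehat{\mathbb E}\big[\widehat{\mathbb E}[\varphi(x,Y)]|_{x=X}\big]$ for every $\varphi\in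 C_{l,Lip}(\mathbb R^m\times\mathbb R^n)$ with $\overline\varphi(x):=\widehat{\mathbb E}[|\varphi(x,Y)|]<\infty$ for all $x$ and $\widehat{\mathbb E}[\overline\varphi(X)]<\infty$ (where the functions $\overline\varphi(X)$ and $\widehat{\mathbb E}[\varphi(x,Y)]|_{x=X}$ of $\omega$ belong to $\mathscr H$). A sequence $\{X_n;n\ge1\}\subset\mathscr H$ is independent if $X_{i+1}$ is independent to $(X_1,\dots,X_i)$ for each $i\ge1$. An upper capacity is a monotone sub-additive $\mathbb V:\mathcal F\to[0,1]$ with $\mathbb V(\emptyset)=0$, $\mathbb V(\Omega)=1$ and $\widehat{\mathbb E}[f]\le\mathbb V(A)\le\widehat{\mathbb E}[g]$ whenever $f\le I_A\le g$, $f,g\in\mathscr H$, $A\in\mathcal F$. Put $\widehat{\mathbb V}(A)=\inf\{\widehat{\mathbb E}[\xi]: I_A\le\xi\in\mathscr H\}$, $$\widehat{\mathbb V}^*(A)=\inf\Big\{\sum_{n\ge1}\widehat{\mathbb V}(A_n):A\subset\bigcup_n A_n,\ A_n\in\mathcal F\Big\},\qquad \mathbb C^*(A)=\inf\Big\{\lim_{n\to\infty}\widehat{\mathbb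 E}\Big[\sum_{i=1}^n g_i\Big]: I_A\le\sum_{n\ge1}g_n,\ 0\le g_n\in\mathscr H\Big\}.$$ **Condition (CC).** There is a family $\mathscr P$ of probability measures on $(\Omega,\sigma(\mathscr H))$ such that $\widehat{\mathbb E}[X]=\sup_{P\in\mathscr P}P[X]$ for every bounded $X\in\mathscr H$, and such that for all bounded $Y_1,Y_2,\dots\in\mathscr H$ and every sequence $\{P_n\}\subset\mathscr P$ there are a subsequence $\{P_{n_k}\}$ and a $P\in\mathscr P$ with $\lim_k P_{n_k}[\varphi(Y_1,\dots,Y_d)]=P[\varphi(Y_1,\dots,Y_d)]$ for all $d\ge1$ and all bounded Lipschitz $\varphi:\mathbb R^d\to\mathbb R$. Put $\mathbb V^{\mathscr P}(A)=\sup_{P\in\mathscr P}P(A)$, $A\in\sigma(\mathscr H)$. **Theorem.** Let $(\Omega,\mathscr H,\widehat{\mathbb E})$ satisfy (CC) with the family $\mathscr P$, let $\mathbb V$ be an upper capacity, and let $\{X_n;n\ge1\}\subset\mathscr H$ be independent with $\widehat{\mathbb E}[X_n^2]<\infty$ for all $n$. Put $\log x=\ln\max(e,x)$, $S_n=\sum_{i\le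 n}X_i$, $s_n^2=\sum_{i\le n}\widehat{\mathbb E}[X_i^2]$, $t_n=\sqrt{2\log\log s_n^2}$, $a_n=s_nt_n$ and $$\Gamma_n(p,\alpha)=\widehat{\mathbb E}\big[\big((|X_n|-\alpha s_n/t_n)^+\big)^p\big],\qquad \Lambda_n(p,\alpha)=\sum_{j=1}^n\widehat{\mathbb E}\big[\big((|X_j|-\alpha s_n/t_n)^+\big)^p\big].$$ Suppose that (terms with $s_n=0$ being omitted from the second and third series) 1. $\sum_{n}\mathbb V(|X_n|\ge\epsilon a_n)<\infty$ for all $\epsilon>0$; 2. for every $\alpha>0$ there are $p\ge2$ and $d\ge0$ with $\sum_{n}\frac{\Gamma_n(p,\alpha)}{a_n^p}\Big(\frac{\Lambda_n(p,\alpha)}{a_n^p}\Big)^d<\infty$; 3. $\sum_{n}s_n^{-2}(\log s_n^2)^{\delta-1}\widehat{\mathbb E}[X_n^2]=\infty$ for all $\delta>0$; 4. $a_n^{-1}\Big(\sum_{j=1}^n|\widehat{\mathbb E}[X_j]|+\sum_{j=1}^n|\widehat{\mathcal E}[X_j]|\Big)\to0$. Then for each of $V=\mathbb V^{\mathscr P}$,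 $V=\mathbb C^*$ and $V=\widehat{\mathbb V}^*$, $$V\Big(\limsup_{n\to\infty}\frac{|S_n|}{a_n}>1\Big)=0\qquad\text{and}\qquad V\Big(\liminf_{n\to\infty}\frac{S_n}{a_n}=-1\ \text{ and }\ \limsup_{n\to\infty}\frac{S_n}{a_n}=1\Big)=1.$$ -/

import Mathlib

open MeasureTheory Filter Topology
open scoped ENNReal NNReal

/-- The class of locally Lipschitz functions of polynomial growth: for some `C > 0`, `m : ℕ`,
`|φ x - φ y| ≤ C (1 + |x|^m + |y|^m) |x - y|`. On `ℝ^n` (and on `ℝ^m × ℝ^n`) the class does not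
depend on which of the equivalent norms is used. -/
def CLLip {E : Type*} [SeminormedAddCommGroup E] (φ : E → ℝ) : Prop :=
  ∃ C : ℝ, 0 < C ∧ ∃ m : ℕ, ∀ x y : E,
    |φ x - φ y| ≤ C * (1 + ‖x‖ ^ m + ‖y‖ ^ m) * ‖x - y‖

/-- Bounded Lipschitz functions. -/
def CBLip {E : Type*} [SeminormedAddCommGroup E] (φ : E → ℝ) : Prop :=
  (∃ K : ℝ≥0, LipschitzWith K φ) ∧ ∃ M : ℝ, ∀ x, |φ x| ≤ M

/-- The truncated logarithm `log x = ln (max (e, x))`. -/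
noncomputable def pLog (x : ℝ) : ℝ := Real.log (max (Real.exp 1) x)

/-- A sub-linear expectation space `(Ω, H, E)` over a measurable space `Ω`. The expectation is a
map from `H` to `[-∞, ∞]`; it is written here as a function on all of `Ω → ℝ`, of which only the
values on `H` carry axioms and are ever used. -/
structure SublinearExpectationSpace (Ω : Type*) [MeasurableSpace Ω] where
  /-- the linear space of random variables -/
  H : Submodule ℝ (Ω → ℝ)
  measurable_of_mem : ∀ X ∈ H, Measurable X
  comp_mem : ∀ (n : ℕ) (X : Fin n → Ω → ℝ), (∀ i, X i ∈ H) →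
    ∀ φ : (Fin n → ℝ) → ℝ, CLLip φ → (fun ω => φ (fun i => X i ω)) ∈ H
  /-- the sub-linear expectation -/
  E : (Ω → ℝ) → EReal
  mono : ∀ X ∈ H, ∀ Y ∈ H, (∀ ω, Y ω ≤ X ω) → E Y ≤ E X
  const : ∀ c : ℝ, E (fun _ => c) = (c : EReal)
  subadd : ∀ X ∈ H, ∀ Y ∈ H, ¬ (E X = ⊤ ∧ E Y = ⊥) → ¬ (E X = ⊥ ∧ E Y = ⊤) →
    E (fun ω => X ω + Y ω) ≤ E X + E Y
  pos_homog : ∀ X ∈ H, ∀ c : ℝ, 0 ≤ c → E (fun ω => c * X ω) = (c : EReal) * E X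

namespace SublinearExpectationSpace

variable {Ω : Type*} [MeasurableSpace Ω]

/-- The conjugate expectation `-E[-X]`. -/
noncomputable def conj (S : SublinearExpectationSpace Ω) (X : Ω → ℝ) : EReal :=
  - S.E (fun ω => - X ω)

/-- The `σ`-field on `Ω` generated by the random variables in `H`. -/
abbrev sigmaH (S : SublinearExpectationSpace Ω) : MeasurableSpace Ω :=
  ⨆ X ∈ S.H, MeasurableSpace.comap X (borel ℝ)

/-- The bounded elements of `H`. -/
def Hb (S : SublinearExpectationSpace Ω) : Set (Ω → ℝ) :=
  {X | X ∈ S.H ∧ ∃ M : ℝ, ∀ ω, |X ω| ≤ M}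

/-- The random vector `Y` is independent to the random vector `X`:
`E[φ(X, Y)] = E[ E[φ(x, Y)] |_{x = X} ]` for every locally Lipschitz `φ` such that
`φ̄ x = E[|φ(x, Y)|] < ∞` for all `x` and `E[φ̄(X)] < ∞`. Since `E` is only defined on `H`, the
identity is required for those `φ` for which the functions `φ̄(X)` and `E[φ(x, Y)]|_{x = X}`, to
which the outer expectation is applied, belong to `H`. -/
def IndepTo (S : SublinearExpectationSpace Ω) {m n : ℕ}
    (Y : Fin n → Ω → ℝ) (X : Fin m → Ω → ℝ) : Prop :=
  ∀ φ : (Fin m → ℝ) × (Fin n → ℝ) → ℝ, CLLip φ →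
    (∀ x : Fin m → ℝ, S.E (fun ω => |φ (x, fun j => Y j ω)|) < ⊤) →
    (fun ω' => (S.E (fun ω => |φ (fun i => X i ω', fun j => Y j ω)|)).toReal) ∈ S.H →
    S.E (fun ω' => (S.E (fun ω => |φ (fun i => X i ω', fun j => Y j ω)|)).toReal) < ⊤ →
    (fun ω' => (S.E (fun ω => φ (fun i => X i ω', fun j => Y j ω))).toReal) ∈ S.H →
    S.E (fun ω => φ (fun i => X i ω, fun j => Y j ω)) =
      S.E (fun ω' => (S.E (fun ω => φ (fun i => X i ω', fun j => Y j ω))).toReal)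

/-- A sequence `X 0, X 1, …` is independent if `X (n+1)` is independent to `(X 0, …, X n)`
for every `n`. -/
def IndepSeq (S : SublinearExpectationSpace Ω) (X : ℕ → Ω → ℝ) : Prop :=
  ∀ n : ℕ, S.IndepTo (fun _ : Fin 1 => X (n + 1)) (fun i : Fin (n + 1) => X i)

/-- `V` is an upper capacity for `E`: a sub-additive capacity on the measurable sets with
`E[f] ≤ V(A) ≤ E[g]` whenever `f ≤ I_A ≤ g`, `f, g ∈ H`. (Monotonicity and the values at `∅` and
`Ω` give `0 ≤ V ≤ 1`.) -/
structure IsUpperCapacity (S : SublinearExpectationSpace Ω) (V : Set Ω → ℝ) : Prop where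
  empty : V ∅ = 0
  univ : V Set.univ = 1
  mono : ∀ A B, MeasurableSet A → MeasurableSet B → A ⊆ B → V A ≤ V B
  subadd : ∀ A B, MeasurableSet A → MeasurableSet B → V (A ∪ B) ≤ V A + V B
  lower : ∀ A, MeasurableSet A → ∀ f ∈ S.H, (∀ ω, f ω ≤ A.indicator 1 ω) → S.E f ≤ (V A : EReal)
  upper : ∀ A, MeasurableSet A → ∀ g ∈ S.H, (∀ ω, A.indicator 1 ω ≤ g ω) → (V A : EReal) ≤ S.E g

/-- The largest upper capacity, `inf {E[ξ] : I_A ≤ ξ ∈ H}` (here `ξ ≥ 0`, so `E[ξ] ≥ 0`). -/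
noncomputable def upCap (S : SublinearExpectationSpace Ω) (A : Set Ω) : ℝ≥0∞ :=
  ⨅ (ξ : Ω → ℝ) (_ : ξ ∈ S.H) (_ : ∀ ω, A.indicator 1 ω ≤ ξ ω), (S.E ξ).toENNReal

/-- The countably sub-additive extension of `upCap`:
`inf {∑ upCap(A n) : A ⊆ ⋃ A n, A n measurable}`. -/
noncomputable def outerCap (S : SublinearExpectationSpace Ω) (A : Set Ω) : ℝ≥0∞ :=
  ⨅ (B : ℕ → Set Ω) (_ : ∀ n, MeasurableSet (B n)) (_ : A ⊆ ⋃ n, B n), ∑' n, S.upCap (B n)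

/-- The capacity `inf {lim_n E[g 0 + … + g (n-1)] : I_A ≤ ∑ g n, 0 ≤ g n ∈ H}`; the limit of the
increasing sequence is written as a supremum, and the series `∑ g n` may be infinite. -/
noncomputable def cStar (S : SublinearExpectationSpace Ω) (A : Set Ω) : ℝ≥0∞ :=
  ⨅ (g : ℕ → Ω → ℝ) (_ : ∀ n, g n ∈ S.H) (_ : ∀ n ω, 0 ≤ g n ω)
    (_ : ∀ ω, A.indicator 1 ω ≤ ∑' n, ENNReal.ofReal (g n ω)),
    ⨆ n : ℕ, (S.E (fun ω => ∑ i ∈ Finset.range n, g i ω)).toENNReal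

/-- The capacity `sup_{P ∈ Ps} P(A)` of a family of measures on `(Ω, σ(H))`. -/
noncomputable def capOf (S : SublinearExpectationSpace Ω) (Ps : Set (@Measure Ω S.sigmaH))
    (A : Set Ω) : ℝ≥0∞ :=
  ⨆ P ∈ Ps, P A

/-- Condition (CC) with the family `Ps`: `Ps` is a family of probability measures on `(Ω, σ(H))`,
`E[X] = sup_{P ∈ Ps} P[X]` for all bounded `X ∈ H`, and `Ps` is countable-dimensionally weakly
compact. -/
structure ConditionCC (S : SublinearExpectationSpace Ω) (Ps : Set (@Measure Ω S.sigmaH)) :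
    Prop where
  prob : ∀ P ∈ Ps, IsProbabilityMeasure P
  repr : ∀ X ∈ S.Hb, S.E X = ⨆ P ∈ Ps, ((∫ ω, X ω ∂P : ℝ) : EReal)
  compact : ∀ Y : ℕ → Ω → ℝ, (∀ i, Y i ∈ S.Hb) →
    ∀ Q : ℕ → @Measure Ω S.sigmaH, (∀ n, Q n ∈ Ps) →
      ∃ k : ℕ → ℕ, StrictMono k ∧ ∃ P ∈ Ps,
        ∀ (d : ℕ) (φ : (Fin d → ℝ) → ℝ), CBLip φ →
          Tendsto (fun j => ∫ ω, φ (fun i : Fin d => Y i ω) ∂(Q (k j))) atTop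
            (𝓝 (∫ ω, φ (fun i : Fin d => Y i ω) ∂P))

/-- The sequence `X 0, X 1, …` is indexed from `0`, and so are all the quantities derived from it.
`sq X n = ∑_{k ≤ n} E[(X k)²]`, used only when these expectations are finite. -/
noncomputable def sq (S : SublinearExpectationSpace Ω) (X : ℕ → Ω → ℝ) (n : ℕ) : ℝ :=
  ∑ k ∈ Finset.range (n + 1), (S.E (fun ω => X k ω ^ 2)).toReal

/-- `s_n`, the square root of `sq X n`. -/
noncomputable def s (S : SublinearExpectationSpace Ω) (X : ℕ → Ω → ℝ) (n : ℕ) : ℝ :=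
  Real.sqrt (S.sq X n)

/-- `t_n = √(2 log log s_n²)`. -/
noncomputable def t (S : SublinearExpectationSpace Ω) (X : ℕ → Ω → ℝ) (n : ℕ) : ℝ :=
  Real.sqrt (2 * pLog (pLog (S.sq X n)))

/-- `a_n = s_n t_n`. -/
noncomputable def a (S : SublinearExpectationSpace Ω) (X : ℕ → Ω → ℝ) (n : ℕ) : ℝ :=
  S.s X n * S.t X n

/-- `E[((|Z| - c)⁺)^p]`, an element of `[0, ∞]`. -/
noncomputable def excess (S : SublinearExpectationSpace Ω) (Z : Ω → ℝ) (p c : ℝ) : ℝ≥0∞ :=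
  (S.E (fun ω => (max (|Z ω| - c) 0) ^ p)).toENNReal

/-- `Γ_n(p, α) = E[((|X_n| - α s_n / t_n)⁺)^p]`. -/
noncomputable def Gam (S : SublinearExpectationSpace Ω) (X : ℕ → Ω → ℝ) (p α : ℝ) (n : ℕ) :
    ℝ≥0∞ :=
  S.excess (X n) p (α * S.s X n / S.t X n)

/-- `Λ_n(p, α) = ∑_{j ≤ n} E[((|X_j| - α s_n / t_n)⁺)^p]`. -/
noncomputable def Lam (S : SublinearExpectationSpace Ω) (X : ℕ → Ω → ℝ) (p α : ℝ) (n : ℕ) :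
    ℝ≥0∞ :=
  ∑ j ∈ Finset.range (n + 1), S.excess (X j) p (α * S.s X n / S.t X n)

end SublinearExpectationSpace

/-- The partial sum of `X 0, …, X n`. -/
def partialSum {Ω : Type*} (X : ℕ → Ω → ℝ) (n : ℕ) (ω : Ω) : ℝ :=
  ∑ k ∈ Finset.range (n + 1), X k ω

/-! The three capacities are ordered: `capOf_le_cStar` and `cStar_le_outerCap`. So it is enough that
the exceptional set is null for the largest, `outerCap`, and that the cluster set has value one for
the smallest, `capOf`. The first is an upper exponential bound with Borel-Cantelli; the second
produces one single `P` in the family under which the law holds almost surely.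

Upper half. The variables are truncated at `δ * a N`, which changes nothing in the end since
condition 1 makes `|X n| > δ * a n` happen only finitely often off a null set (`tail_null`).
Independence turns the expectation of a past-future combination into an iterated one
(`e_add_mul_bl`), which gives the exponential maximal inequality `upCap_max_le`. The exponential
moments of truncated variables consist of the Gaussian term, a bias governed by condition 4, and a
term `exp (lam * c)` times the normalized moment `rho = Λ / a ^ p`. Choosing `lam` according to the
size of `rho` bounds the probability of a large maximum by a constant times `exp (-(1 + 2ε) loglog)
+ rho ^ (d + 1)` (`exists_upCap_max_clip_le`). Along blocks in which `sq` grows by a fixed factor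
the first part is summable, and condition 2 makes the second summable through a discrete form of `∫
l ^ d dl` (`summable_rho`).

Lower half. Upper and lower bounds for exponential moments at `lam` and `(1 ± β) * lam` show that
the exponential mass sits where the sum is close to `a N`; this replaces a change of measure and
gives a lower bound `exp (-(1 - 2β) loglog) / 2` for the upper expectation of a smoothed large
increment (`le_e_ramp_of_exp`, `eventually_le_e_ramp`). By condition 3 these bounds are not summable
along a geometric chain (`not_summable_exp_loglog`). Hence the lower expectation of "no large
increment", a product over independent blocks, can be made as small as desired
(`LILData.exists_range`).

Since no continuity of the capacities is available, the converse Borel-Cantelli step goes through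
(CC). Smoothed failure functions over successive disjoint ranges of indices, with lower expectations
at most `2 ^ (-q)`, have additive lower expectations; for each `M` some measure nearly attains the
lower expectation of the first `M` of them, and a limit point `P` bounds all partial sums at once
(`exists_integral_sum_le`). Under `P` failure occurs finitely often, for all precisions and both
signs simultaneously (`exists_prob_frequently`). -/

theorem CLLip.comp_coord {n : ℕ} {φ : ℝ → ℝ} (h : CLLip φ) (i : Fin n) :
    CLLip (fun x : Fin n → ℝ => φ (x i)) := by
  obtain ⟨C, hC, m, h⟩ := h
  refine ⟨C, hC, m, fun x y => (h _ _).trans ?_⟩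
  have h1 : ‖x i‖ ≤ ‖x‖ := norm_le_pi_norm x i
  have h2 : ‖y i‖ ≤ ‖y‖ := norm_le_pi_norm y i
  have h3 : ‖x i - y i‖ ≤ ‖x - y‖ := norm_le_pi_norm (x - y) i
  gcongr

theorem CLLip.of_lipschitz {E : Type*} [SeminormedAddCommGroup E] {φ : E → ℝ} {K : ℝ}
    (h : ∀ x y, |φ x - φ y| ≤ K * ‖x - y‖) : CLLip φ := by
  refine ⟨max K 1, by positivity, 0, fun x y => (h x y).trans ?_⟩
  have := norm_nonneg (x - y)
  have h1 : K ≤ max K 1 := le_max_left _ _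
  have h2 : (1 : ℝ) ≤ max K 1 := le_max_right _ _
  simp only [pow_zero]
  gcongr
  linarith

theorem cLLip_abs : CLLip (fun x : ℝ => |x|) :=
  CLLip.of_lipschitz (K := 1) fun x y => by
    rw [one_mul]; exact abs_abs_sub_abs_le_abs_sub x y

theorem cLLip_sq : CLLip (fun x : ℝ => x ^ 2) := by
  refine ⟨1, one_pos, 1, fun x y => ?_⟩
  have : x ^ 2 - y ^ 2 = (x + y) * (x - y) := by ring
  rw [this, abs_mul, Real.norm_eq_abs, Real.norm_eq_abs, Real.norm_eq_abs]
  gcongr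
  have := abs_add_le x y
  linarith

/-! ### Real-valued calculus of a sub-linear expectation. -/

namespace SublinearExpectationSpace

variable {Ω : Type*} [MeasurableSpace Ω] (S : SublinearExpectationSpace Ω)

theorem comp_mem_one {Z : Ω → ℝ} (hZ : Z ∈ S.H) {φ : ℝ → ℝ} (hφ : CLLip φ) :
    (fun ω => φ (Z ω)) ∈ S.H :=
  S.comp_mem 1 (fun _ => Z) (fun _ => hZ) _ (hφ.comp_coord 0)

theorem const_mem (c : ℝ) : (fun _ : Ω => c) ∈ S.H :=
  S.comp_mem 0 (fun _ _ => 0) (fun i => i.elim0) (fun _ => c)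
    (CLLip.of_lipschitz (K := 0) fun x y => by simp)

theorem add_mem' {Y Z : Ω → ℝ} (hY : Y ∈ S.H) (hZ : Z ∈ S.H) : (fun ω => Y ω + Z ω) ∈ S.H :=
  S.H.add_mem hY hZ

theorem smul_mem' {Z : Ω → ℝ} (hZ : Z ∈ S.H) (c : ℝ) : (fun ω => c * Z ω) ∈ S.H :=
  S.H.smul_mem c hZ

theorem neg_mem' {Z : Ω → ℝ} (hZ : Z ∈ S.H) : (fun ω => - Z ω) ∈ S.H :=
  S.H.neg_mem hZ

theorem abs_mem {Z : Ω → ℝ} (hZ : Z ∈ S.H) : (fun ω => |Z ω|) ∈ S.H :=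
  S.comp_mem_one hZ cLLip_abs

/-- The elements of `H` whose absolute value has finite expectation. -/
def L1 (Z : Ω → ℝ) : Prop := Z ∈ S.H ∧ S.E (fun ω => |Z ω|) < ⊤

/-- The real-valued expectation of the elements of `L1`. -/
noncomputable def e (Z : Ω → ℝ) : ℝ := (S.E Z).toReal

variable {S}

theorem L1.of_le {Y Z : Ω → ℝ} (hZ : S.L1 Z) (hY : Y ∈ S.H) (h : ∀ ω, |Y ω| ≤ |Z ω|) :
    S.L1 Y :=
  ⟨hY, (S.mono _ (S.abs_mem hZ.1) _ (S.abs_mem hY) h).trans_lt hZ.2⟩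

theorem L1.const (c : ℝ) : S.L1 (fun _ => c) :=
  ⟨S.const_mem c, by rw [S.const]; exact EReal.coe_lt_top _⟩

theorem L1.of_bound {Z : Ω → ℝ} (hZ : Z ∈ S.H) {M : ℝ} (h : ∀ ω, |Z ω| ≤ M) : S.L1 Z :=
  (L1.const M).of_le hZ fun ω => (h ω).trans (le_abs_self M)

theorem L1.abs {Z : Ω → ℝ} (hZ : S.L1 Z) : S.L1 (fun ω => |Z ω|) :=
  hZ.of_le (S.abs_mem hZ.1) fun ω => by simp

theorem L1.neg {Z : Ω → ℝ} (hZ : S.L1 Z) : S.L1 (fun ω => - Z ω) :=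
  hZ.of_le (S.neg_mem' hZ.1) fun ω => by simp

theorem L1.ne_top {Z : Ω → ℝ} (hZ : S.L1 Z) : S.E Z ≠ ⊤ :=
  ((S.mono _ (S.abs_mem hZ.1) _ hZ.1 fun _ => le_abs_self _).trans_lt hZ.2).ne

/-- Otherwise sub-additivity applied to `Z` and `-Z`, which is not of the form `∞ - ∞` because both
values are below `⊤`, would give `0 ≤ ⊥`. -/
theorem L1.ne_bot {Z : Ω → ℝ} (hZ : S.L1 Z) : S.E Z ≠ ⊥ := by
  intro hb
  have h1 := hZ.neg.ne_top
  have h2 := S.subadd _ hZ.1 _ hZ.neg.1 (fun h => hZ.ne_top h.1) (fun h => h1 h.2)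
  have h3 : S.E (fun ω => Z ω + - Z ω) = ((0 : ℝ) : EReal) := by
    rw [← S.const 0]; congr 1; ext ω; ring
  rw [h3, hb, EReal.bot_add] at h2
  simp at h2

theorem L1.coe_e {Z : Ω → ℝ} (hZ : S.L1 Z) : ((S.e Z : ℝ) : EReal) = S.E Z :=
  EReal.coe_toReal hZ.ne_top hZ.ne_bot

theorem L1.smul {Z : Ω → ℝ} (hZ : S.L1 Z) (c : ℝ) : S.L1 (fun ω => c * Z ω) := by
  refine ⟨S.smul_mem' hZ.1 c, ?_⟩
  have : (fun ω => |c * Z ω|) = fun ω => |c| * |Z ω| := by ext ω; rw [abs_mul]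
  rw [this, S.pos_homog _ (S.abs_mem hZ.1) _ (abs_nonneg c), ← hZ.abs.coe_e, ← EReal.coe_mul]
  exact EReal.coe_lt_top _

theorem L1.add {Y Z : Ω → ℝ} (hY : S.L1 Y) (hZ : S.L1 Z) : S.L1 (fun ω => Y ω + Z ω) := by
  refine ⟨S.add_mem' hY.1 hZ.1, ?_⟩
  refine (S.mono _ (S.add_mem' hY.abs.1 hZ.abs.1) _ (S.abs_mem (S.add_mem' hY.1 hZ.1))
    fun ω => abs_add_le _ _).trans_lt ?_
  refine (S.subadd _ hY.abs.1 _ hZ.abs.1 (fun h => hY.2.ne h.1) (fun h => hZ.2.ne h.2)).trans_lt ?_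
  rw [← hY.abs.coe_e, ← hZ.abs.coe_e, ← EReal.coe_add]
  exact EReal.coe_lt_top _

theorem L1.sub {Y Z : Ω → ℝ} (hY : S.L1 Y) (hZ : S.L1 Z) : S.L1 (fun ω => Y ω - Z ω) := by
  simpa [sub_eq_add_neg] using hY.add hZ.neg

theorem e_mono {Y Z : Ω → ℝ} (hY : S.L1 Y) (hZ : S.L1 Z) (h : ∀ ω, Y ω ≤ Z ω) :
    S.e Y ≤ S.e Z := by
  rw [← EReal.coe_le_coe_iff, hY.coe_e, hZ.coe_e]
  exact S.mono _ hZ.1 _ hY.1 h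

theorem e_add_le {Y Z : Ω → ℝ} (hY : S.L1 Y) (hZ : S.L1 Z) :
    S.e (fun ω => Y ω + Z ω) ≤ S.e Y + S.e Z := by
  rw [← EReal.coe_le_coe_iff, EReal.coe_add, hY.coe_e, hZ.coe_e, (hY.add hZ).coe_e]
  exact S.subadd _ hY.1 _ hZ.1 (fun h => hY.ne_top h.1) (fun h => hZ.ne_top h.2)

theorem e_const (c : ℝ) : S.e (fun _ => c) = c := by
  simp [e, S.const]

theorem e_smul {Z : Ω → ℝ} (hZ : S.L1 Z) {c : ℝ} (hc : 0 ≤ c) :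
    S.e (fun ω => c * Z ω) = c * S.e Z := by
  rw [← EReal.coe_eq_coe_iff, EReal.coe_mul, hZ.coe_e, (hZ.smul c).coe_e]
  exact S.pos_homog _ hZ.1 c hc

theorem e_nonneg {Z : Ω → ℝ} (hZ : S.L1 Z) (h : ∀ ω, 0 ≤ Z ω) : 0 ≤ S.e Z := by
  rw [← e_const (S := S) 0]; exact e_mono (L1.const 0) hZ h

/-- One inequality is sub-additivity; the other is sub-additivity again, after adding `-c`. -/
theorem e_const_add {Z : Ω → ℝ} (hZ : S.L1 Z) (c : ℝ) :
    S.e (fun ω => c + Z ω) = c + S.e Z := by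
  apply le_antisymm
  · simpa [e_const] using e_add_le (L1.const c) hZ
  · have := e_add_le (L1.const (-c)) ((L1.const c).add hZ)
    simp only [e_const, neg_add_cancel_left] at this
    linarith

theorem neg_e_neg_le {Z : Ω → ℝ} (hZ : S.L1 Z) : - S.e (fun ω => - Z ω) ≤ S.e Z := by
  have := e_add_le hZ hZ.neg
  simp only [add_neg_cancel, e_const] at this
  linarith

theorem e_sub_le_e_add {Y Z : Ω → ℝ} (hY : S.L1 Y) (hZ : S.L1 Z) :
    S.e Z - S.e (fun ω => - Y ω) ≤ S.e (fun ω => Y ω + Z ω) := by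
  have := e_add_le (hY.add hZ) hY.neg
  simp only [add_neg_cancel_comm] at this
  linarith

theorem abs_e_sub_le {Y Z : Ω → ℝ} (hY : S.L1 Y) (hZ : S.L1 Z) {c : ℝ}
    (h : ∀ ω, |Y ω - Z ω| ≤ c) : |S.e Y - S.e Z| ≤ c := by
  have h1 : S.e Y ≤ c + S.e Z := by
    rw [← e_const_add hZ]
    exact e_mono hY ((L1.const c).add hZ) fun ω => by linarith [le_abs_self (Y ω - Z ω), h ω]
  have h2 : S.e Z ≤ c + S.e Y := by
    rw [← e_const_add hY]
    exact e_mono hZ ((L1.const c).add hY) fun ω => by linarith [neg_abs_le (Y ω - Z ω), h ω]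
  rw [abs_le]; constructor <;> linarith

theorem L1.sum {ι : Type*} (s : Finset ι) {Z : ι → Ω → ℝ} (h : ∀ i ∈ s, S.L1 (Z i)) :
    S.L1 (fun ω => ∑ i ∈ s, Z i ω) := by
  classical
  induction s using Finset.induction_on with
  | empty => simpa using L1.const 0
  | insert i s hi ih =>
    simp only [Finset.sum_insert hi]
    exact (h i (by simp)).add (ih fun j hj => h j (by simp [hj]))

theorem E_lt_top_of_L1 {Z : Ω → ℝ} (hZ : S.L1 Z) : S.E Z < ⊤ := lt_top_iff_ne_top.2 hZ.ne_top

theorem L1.of_nonneg {Z : Ω → ℝ} (hZ : Z ∈ S.H) (h : ∀ ω, 0 ≤ Z ω) (hE : S.E Z < ⊤) :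
    S.L1 Z :=
  ⟨hZ, by simpa [abs_of_nonneg (h _)] using hE⟩

end SublinearExpectationSpace

/-! ### The algebra of bounded Lipschitz functions of a range of coordinates. -/

/-- Bounded functions of a sequence that are Lipschitz in the coordinates in `[m, n)` and do not
depend on the other ones. -/
def BL (m n : ℕ) (F : (ℕ → ℝ) → ℝ) : Prop :=
  (∃ K : ℝ, 0 ≤ K ∧ ∀ x y, |F x - F y| ≤ K * ∑ i ∈ Finset.Ico m n, |x i - y i|) ∧
    ∃ M : ℝ, 0 ≤ M ∧ ∀ x, |F x| ≤ M

namespace BL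

variable {m n m' n' : ℕ} {F G : (ℕ → ℝ) → ℝ}

theorem mono (h : BL m n F) (hm : m' ≤ m) (hn : n ≤ n') : BL m' n' F := by
  obtain ⟨⟨K, hK, h⟩, hM⟩ := h
  refine ⟨⟨K, hK, fun x y => (h x y).trans ?_⟩, hM⟩
  gcongr

theorem const (c : ℝ) : BL m n (fun _ => c) :=
  ⟨⟨0, le_rfl, fun x y => by simp⟩, |c|, abs_nonneg c, fun _ => le_rfl⟩

theorem congr (h : BL m n F) {x y : ℕ → ℝ} (hxy : ∀ i ∈ Finset.Ico m n, x i = y i) :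
    F x = F y := by
  obtain ⟨⟨K, hK, h⟩, -⟩ := h
  have h1 := h x y
  rw [Finset.sum_eq_zero fun i hi => by rw [hxy i hi, sub_self, abs_zero], mul_zero] at h1
  exact sub_eq_zero.1 (abs_nonpos_iff.1 h1)

/-- Because `F` is bounded, `g` need only be Lipschitz on bounded intervals. This is what admits the
exponential. -/
theorem comp (h : BL m n F) {g : ℝ → ℝ}
    (hg : ∀ M : ℝ, ∃ K : ℝ, ∀ a b, |a| ≤ M → |b| ≤ M → |g a - g b| ≤ K * |a - b|) :
    BL m n (fun x => g (F x)) := by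
  obtain ⟨⟨K, hK, h⟩, M, hM0, hM⟩ := h
  obtain ⟨L, hL⟩ := hg M
  refine ⟨⟨|L| * K, by positivity, fun x y => (hL _ _ (hM x) (hM y)).trans ?_⟩,
    |g 0| + |L| * M, by positivity, fun x => ?_⟩
  · calc L * |F x - F y| ≤ |L| * |F x - F y| := by gcongr; exact le_abs_self L
      _ ≤ |L| * (K * ∑ i ∈ Finset.Ico m n, |x i - y i|) := by gcongr; exact h x y
      _ = _ := by ring
  · have h1 := hL (F x) 0 (hM x) (by simpa using hM0)
    have h2 : L * |F x - 0| ≤ |L| * M := by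
      rw [sub_zero]
      exact mul_le_mul (le_abs_self L) (hM x) (abs_nonneg _) (abs_nonneg _)
    have h3 := abs_sub_abs_le_abs_sub (g (F x)) (g 0)
    linarith

theorem comp_lip (h : BL m n F) {g : ℝ → ℝ} {K : ℝ} (hg : ∀ a b, |g a - g b| ≤ K * |a - b|) :
    BL m n (fun x => g (F x)) :=
  h.comp fun _ => ⟨K, fun a b _ _ => hg a b⟩

theorem exp (h : BL m n F) : BL m n (fun x => Real.exp (F x)) := by
  refine h.comp fun M => ⟨Real.exp M, fun a b ha hb => ?_⟩
  wlog hab : b ≤ a generalizing a b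
  · rw [abs_sub_comm, abs_sub_comm a]; exact this b a hb ha (le_of_not_ge hab)
  have h1 : Real.exp b ≤ Real.exp a := Real.exp_le_exp.2 hab
  rw [abs_of_nonneg (sub_nonneg.2 h1), abs_of_nonneg (sub_nonneg.2 hab)]
  have h2 : Real.exp b = Real.exp a * Real.exp (b - a) := by rw [← Real.exp_add]; ring_nf
  have h3 := Real.add_one_le_exp (b - a)
  have h4 : Real.exp a ≤ Real.exp M := Real.exp_le_exp.2 ((le_abs_self a).trans ha)
  have h5 := Real.exp_pos a
  calc Real.exp a - Real.exp b = Real.exp a * (1 - Real.exp (b - a)) := by rw [h2]; ring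
    _ ≤ Real.exp a * (a - b) := mul_le_mul_of_nonneg_left (by linarith) h5.le
    _ ≤ _ := mul_le_mul_of_nonneg_right h4 (by linarith)

theorem add (hF : BL m n F) (hG : BL m n G) : BL m n (fun x => F x + G x) := by
  obtain ⟨⟨K, hK, hF⟩, M, hM0, hM⟩ := hF
  obtain ⟨⟨L, hL, hG⟩, N, hN0, hN⟩ := hG
  refine ⟨⟨K + L, by positivity, fun x y => ?_⟩, M + N, by positivity, fun x => ?_⟩
  · have : F x + G x - (F y + G y) = (F x - F y) + (G x - G y) := by ring
    rw [this, add_mul]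
    exact (abs_add_le _ _).trans (add_le_add (hF x y) (hG x y))
  · exact (abs_add_le _ _).trans (add_le_add (hM x) (hN x))

theorem mul (hF : BL m n F) (hG : BL m n G) : BL m n (fun x => F x * G x) := by
  obtain ⟨⟨K, hK, hF⟩, M, hM0, hM⟩ := hF
  obtain ⟨⟨L, hL, hG⟩, N, hN0, hN⟩ := hG
  refine ⟨⟨M * L + N * K, by positivity, fun x y => ?_⟩, M * N, by positivity, fun x => ?_⟩
  · have : F x * G x - (F y * G y) = F x * (G x - G y) + G y * (F x - F y) := by ring
    rw [this]
    refine (abs_add_le _ _).trans ?_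
    rw [abs_mul, abs_mul, add_mul, mul_assoc, mul_assoc]
    exact add_le_add (mul_le_mul (hM x) (hG x y) (abs_nonneg _) hM0)
      (mul_le_mul (hN y) (hF x y) (abs_nonneg _) hN0)
  · rw [abs_mul]; exact mul_le_mul (hM x) (hN x) (abs_nonneg _) hM0

theorem neg (hF : BL m n F) : BL m n (fun x => - F x) := by
  simpa using (const (-1)).mul hF

theorem abs (hF : BL m n F) : BL m n (fun x => |F x|) :=
  hF.comp_lip (K := 1) fun a b => by rw [one_mul]; exact abs_abs_sub_abs_le_abs_sub a b

theorem sum {ι : Type*} (s : Finset ι) {F : ι → (ℕ → ℝ) → ℝ} (h : ∀ i ∈ s, BL m n (F i)) :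
    BL m n (fun x => ∑ i ∈ s, F i x) := by
  classical
  induction s using Finset.induction_on with
  | empty => simpa using const 0
  | insert i s hi ih =>
    simp only [Finset.sum_insert hi]
    exact (h i (by simp)).add (ih fun j hj => h j (by simp [hj]))

theorem prod {ι : Type*} (s : Finset ι) {F : ι → (ℕ → ℝ) → ℝ} (h : ∀ i ∈ s, BL m n (F i)) :
    BL m n (fun x => ∏ i ∈ s, F i x) := by
  classical
  induction s using Finset.induction_on with
  | empty => simpa using const 1
  | insert i s hi ih =>
    simp only [Finset.prod_insert hi]
    exact (h i (by simp)).mul (ih fun j hj => h j (by simp [hj]))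

/-- A bounded Lipschitz function of one coordinate. -/
theorem coord {i : ℕ} (hi : i ∈ Finset.Ico m n) {ψ : ℝ → ℝ} {K M : ℝ}
    (hK : ∀ a b, |ψ a - ψ b| ≤ K * |a - b|) (hM : ∀ a, |ψ a| ≤ M) :
    BL m n (fun x => ψ (x i)) := by
  refine ⟨⟨|K|, abs_nonneg K, fun x y => (hK _ _).trans ?_⟩, |M|, abs_nonneg M,
    fun x => (hM _).trans (le_abs_self M)⟩
  refine mul_le_mul (le_abs_self K) ?_ (abs_nonneg _) (abs_nonneg _)
  exact Finset.single_le_sum (f := fun i => |x i - y i|) (fun _ _ => abs_nonneg _) hi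

end BL

/-! ### Independence as iterated integration. -/

namespace SublinearExpectationSpace

variable {Ω : Type*} [MeasurableSpace Ω] {S : SublinearExpectationSpace Ω}

/-- The extension of a finite vector to a sequence by a constant. -/
def extendSeq (n : ℕ) (x : Fin n → ℝ) (c : ℝ) : ℕ → ℝ :=
  fun i => if h : i < n then x ⟨i, h⟩ else c

theorem cLLip_of_bl {n : ℕ} {F : (ℕ → ℝ) → ℝ} (hF : BL 0 (n + 1) F) :
    CLLip (fun z : (Fin n → ℝ) × (Fin 1 → ℝ) => F (extendSeq n z.1 (z.2 0))) := by
  obtain ⟨⟨K, hK, h⟩, -⟩ := hF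
  refine CLLip.of_lipschitz (K := K * (n + 1)) fun z w => (h _ _).trans ?_
  rw [mul_assoc]
  gcongr
  have : ∀ i ∈ Finset.Ico 0 (n + 1),
      |extendSeq n z.1 (z.2 0) i - extendSeq n w.1 (w.2 0) i| ≤ ‖z - w‖ := by
    intro i _
    unfold extendSeq
    split_ifs with hi
    · exact (norm_le_pi_norm (z.1 - w.1) ⟨i, hi⟩).trans (norm_fst_le (z - w))
    · exact (norm_le_pi_norm (z.2 - w.2) 0).trans (norm_snd_le (z - w))
  refine (Finset.sum_le_sum this).trans ?_
  simp

theorem bl_mem {X : ℕ → Ω → ℝ} (hX : ∀ n, X n ∈ S.H) {m n : ℕ} {F : (ℕ → ℝ) → ℝ}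
    (hF : BL m n F) : (fun ω => F (fun i => X i ω)) ∈ S.H := by
  have hF : BL 0 n F := hF.mono (Nat.zero_le _) le_rfl
  have h1 : CLLip (fun z : Fin n → ℝ => F (extendSeq n z 0)) := by
    obtain ⟨⟨K, hK, h⟩, -⟩ := hF
    refine CLLip.of_lipschitz (K := K * n) fun z w => (h _ _).trans ?_
    rw [mul_assoc]
    gcongr
    have : ∀ i ∈ Finset.Ico 0 n, |extendSeq n z 0 i - extendSeq n w 0 i| ≤ ‖z - w‖ := by
      intro i hi
      have hi : i < n := by simpa using hi
      simp only [extendSeq, hi, dif_pos]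
      exact norm_le_pi_norm (z - w) ⟨i, hi⟩
    refine (Finset.sum_le_sum this).trans ?_
    simp
  have h2 := S.comp_mem n (fun i => X i) (fun i => hX i) _ h1
  convert h2 using 2 with ω
  refine hF.congr fun i hi => ?_
  have hi : i < n := by simpa using hi
  simp [extendSeq, hi]

theorem bl_L1 {X : ℕ → Ω → ℝ} (hX : ∀ n, X n ∈ S.H) {m n : ℕ} {F : (ℕ → ℝ) → ℝ}
    (hF : BL m n F) : S.L1 (fun ω => F (fun i => X i ω)) := by
  obtain ⟨M, -, hM⟩ := hF.2
  exact L1.of_bound (bl_mem hX hF) fun ω => hM _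

/-- Integrating out the coordinate `n`. -/
noncomputable def integrateOut (S : SublinearExpectationSpace Ω) (X : ℕ → Ω → ℝ) (n : ℕ)
    (F : (ℕ → ℝ) → ℝ) (x : ℕ → ℝ) : ℝ :=
  S.e (fun ω => F (Function.update x n (X n ω)))

theorem bl_update_L1 {X : ℕ → Ω → ℝ} (hX : ∀ n, X n ∈ S.H) {m n : ℕ} {F : (ℕ → ℝ) → ℝ}
    (hF : BL m (n + 1) F) (x : ℕ → ℝ) :
    S.L1 (fun ω => F (Function.update x n (X n ω))) := by
  have hF : BL 0 (n + 1) F := hF.mono (Nat.zero_le _) le_rfl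
  obtain ⟨⟨K, hK, h⟩, M, -, hM⟩ := hF
  refine L1.of_bound (M := M) (S.comp_mem_one (hX n) (φ := fun s => F (Function.update x n s))
    (CLLip.of_lipschitz (K := K) fun a b => (h _ _).trans ?_)) fun ω => hM _
  gcongr
  rw [Finset.sum_eq_single n]
  · simp
  · intro i _ hi; simp [hi]
  · simp

/-- `S.e` is 1-Lipschitz for uniform distance, so both the bound and the Lipschitz constant survive.
Staying inside `BL` supplies the membership in `H` that `IndepTo` asks of the inner expectation. -/
theorem integrateOut_bl {X : ℕ → Ω → ℝ} (hX : ∀ n, X n ∈ S.H) {m n : ℕ} {F : (ℕ → ℝ) → ℝ}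
    (hF : BL m (n + 1) F) : BL m n (S.integrateOut X n F) := by
  have h0 := bl_update_L1 hX hF
  obtain ⟨⟨K, hK, h⟩, M, hM0, hM⟩ := hF
  refine ⟨⟨K, hK, fun x y => ?_⟩, M, hM0, fun x => ?_⟩
  · refine abs_e_sub_le (h0 x) (h0 y) fun ω => (h _ _).trans ?_
    gcongr
    rcases le_or_gt m n with hmn | hmn
    · rw [Finset.sum_Ico_succ_top hmn]
      simp only [Function.update_self, sub_self, abs_zero, add_zero]
      refine Finset.sum_le_sum fun i hi => ?_
      have : i ≠ n := by simp at hi; omega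
      simp [this]
    · rw [Finset.Ico_eq_empty (by omega), Finset.sum_empty]
      exact Finset.sum_nonneg fun _ _ => abs_nonneg _
  · have := abs_e_sub_le (h0 x) (L1.const (S := S) 0) (c := M) fun ω => by simpa using hM _
    simpa [e_const, integrateOut] using this

theorem e_eq_integrateOut {X : ℕ → Ω → ℝ} (hX : ∀ n, X n ∈ S.H) (hind : S.IndepSeq X) {n : ℕ}
    {F : (ℕ → ℝ) → ℝ} (hF : BL 0 (n + 1) F) :
    S.e (fun ω => F (fun i => X i ω)) = S.e (fun ω => S.integrateOut X n F (fun i => X i ω)) := by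
  -- `IndepSeq` says nothing about `X 0` alone, but integrating out coordinate `0` leaves a
  -- constant, so nothing is needed there.
  rcases n with _ | n
  · have h1 : (fun ω => S.integrateOut X 0 F (fun i => X i ω)) =
        fun _ => S.integrateOut X 0 F (fun _ => 0) := by
      ext ω
      exact (integrateOut_bl hX hF).congr (by simp)
    rw [h1, e_const, integrateOut]
    congr 1
    ext ω
    refine hF.congr fun i hi => ?_
    have : i = 0 := by simpa using hi
    simp [this]
  · have key : ∀ (G : (ℕ → ℝ) → ℝ), BL 0 (n + 2) G → ∀ x : ℕ → ℝ, ∀ ω,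
        G (extendSeq (n + 1) (fun i => x i) (X (n + 1) ω)) =
          G (Function.update x (n + 1) (X (n + 1) ω)) := by
      intro G hG x ω
      refine hG.congr fun i hi => ?_
      have hi : i < n + 2 := by simpa using hi
      rcases Nat.lt_succ_iff_lt_or_eq.1 hi with h | h
      · simp [extendSeq, h, h.ne]
      · simp [extendSeq, h]
    have key2 : ∀ (G : (ℕ → ℝ) → ℝ), BL 0 (n + 2) G → ∀ ω,
        G (extendSeq (n + 1) (fun i => X i ω) (X (n + 1) ω)) = G (fun i => X i ω) := by
      intro G hG ω
      rw [key G hG (fun i => X i ω)]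
      congr 1
      ext i
      by_cases h : i = n + 1
      · subst h; simp
      · simp [h]
    have h := hind n (fun z => F (extendSeq (n + 1) z.1 (z.2 0))) (cLLip_of_bl hF)
    have e1 : ∀ (G : (ℕ → ℝ) → ℝ), BL 0 (n + 2) G →
        (fun ω' => (S.E (fun ω => G (extendSeq (n + 1) (fun i => X i ω') (X (n + 1) ω)))).toReal) =
          fun ω' => S.integrateOut X (n + 1) G (fun i => X i ω') := by
      intro G hG
      ext ω'
      simp only [integrateOut, e]
      congr 2
      ext ω
      exact key G hG (fun i => X i ω') ω
    rw [e1 F hF, e1 _ hF.abs] at h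
    have h' := h ?_ (bl_mem hX (integrateOut_bl hX hF.abs))
      (E_lt_top_of_L1 (bl_L1 hX (integrateOut_bl hX hF.abs)))
      (bl_mem hX (integrateOut_bl hX hF))
    · have e2 : (fun ω => F (extendSeq (n + 1) (fun i => X i ω) (X (n + 1) ω))) =
          fun ω => F (fun i => X i ω) := by
        ext ω; exact key2 F hF ω
      rw [e2] at h'
      rw [e, h', e]
    · intro x
      have := E_lt_top_of_L1 (bl_update_L1 hX hF.abs (extendSeq (n + 1) x 0))
      convert this using 3 with ω
      rw [← key _ hF]
      congr 1
      congr 1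
      ext i
      unfold extendSeq
      split_ifs with hi
      · simp [hi]
      · rfl

/-- The only form in which independence is used later. The coordinates of `G` are integrated out
from the last one down; `U` and `V` do not see them, so they pass through by translation invariance
and, as `V ≥ 0`, positive homogeneity. -/
theorem e_add_mul_bl {X : ℕ → Ω → ℝ} (hX : ∀ n, X n ∈ S.H) (hind : S.IndepSeq X) {m n : ℕ}
    (hmn : m ≤ n) {U V G : (ℕ → ℝ) → ℝ} (hU : BL 0 m U) (hV : BL 0 m V) (hV0 : ∀ x, 0 ≤ V x)
    (hG : BL m n G) :
    S.e (fun ω => U (fun i => X i ω) + V (fun i => X i ω) * G (fun i => X i ω)) =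
      S.e (fun ω => U (fun i => X i ω) + V (fun i => X i ω) * S.e (fun ω => G (fun i => X i ω))) := by
  induction n, hmn using Nat.le_induction generalizing G with
  | base =>
    have : (fun ω => G (fun i => X i ω)) = fun _ => G 0 := by
      ext ω; exact hG.congr (by simp)
    rw [this, e_const]
    congr 1
    ext ω
    rw [congrFun this ω]
  | succ n hmn ih =>
    have step : ∀ {U V : (ℕ → ℝ) → ℝ}, BL 0 m U → BL 0 m V → (∀ x, 0 ≤ V x) →
        S.e (fun ω => U (fun i => X i ω) + V (fun i => X i ω) * G (fun i => X i ω)) =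
        S.e (fun ω => U (fun i => X i ω) + V (fun i => X i ω) *
          S.integrateOut X n G (fun i => X i ω)) := by
      intro U V hU hV hV0
      have hF : BL 0 (n + 1) (fun x => U x + V x * G x) :=
        (hU.mono le_rfl (by omega)).add ((hV.mono le_rfl (by omega)).mul
          (hG.mono (Nat.zero_le _) le_rfl))
      rw [e_eq_integrateOut hX hind hF]
      congr 1
      ext ω
      set x : ℕ → ℝ := fun i => X i ω
      have hu : ∀ ω', U (Function.update x n (X n ω')) = U x := fun ω' =>
        hU.congr fun i hi => by
          have : i ≠ n := by simp at hi; omega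
          simp [this]
      have hv : ∀ ω', V (Function.update x n (X n ω')) = V x := fun ω' =>
        hV.congr fun i hi => by
          have : i ≠ n := by simp at hi; omega
          simp [this]
      simp only [integrateOut, hu, hv]
      rw [e_const_add ((bl_update_L1 hX hG x).smul _), e_smul (bl_update_L1 hX hG x) (hV0 x)]
    rw [step hU hV hV0, ih (integrateOut_bl hX hG)]
    -- The case `U = 0`, `V = 1` identifies the expectation of the integrated function with that of
    -- `G`.
    have h1 := step (BL.const 0) (BL.const 1) (by simp)
    simp only [zero_add, one_mul] at h1
    rw [h1]

/-- Over independent blocks the expectation is additive, not merely sub-additive. Applied to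
negatives, this makes the lower expectation additive as well. -/
theorem e_add_bl {X : ℕ → Ω → ℝ} (hX : ∀ n, X n ∈ S.H) (hind : S.IndepSeq X) {m n : ℕ}
    (hmn : m ≤ n) {U G : (ℕ → ℝ) → ℝ} (hU : BL 0 m U) (hG : BL m n G) :
    S.e (fun ω => U (fun i => X i ω) + G (fun i => X i ω)) =
      S.e (fun ω => U (fun i => X i ω)) + S.e (fun ω => G (fun i => X i ω)) := by
  have h := e_add_mul_bl hX hind hmn hU (BL.const 1) (by simp) hG
  simp only [one_mul] at h
  rw [h]
  have h1 := e_const_add (bl_L1 hX hU) (S.e (fun ω => G (fun i => X i ω)))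
  simp only [add_comm] at h1 ⊢
  exact h1

theorem e_mul_bl {X : ℕ → Ω → ℝ} (hX : ∀ n, X n ∈ S.H) (hind : S.IndepSeq X) {m n : ℕ}
    (hmn : m ≤ n) {V G : (ℕ → ℝ) → ℝ} (hV : BL 0 m V) (hV0 : ∀ x, 0 ≤ V x) (hG : BL m n G)
    (hG0 : ∀ x, 0 ≤ G x) :
    S.e (fun ω => V (fun i => X i ω) * G (fun i => X i ω)) =
      S.e (fun ω => V (fun i => X i ω)) * S.e (fun ω => G (fun i => X i ω)) := by
  have h := e_add_mul_bl hX hind hmn (BL.const 0) hV hV0 hG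
  simp only [zero_add] at h
  rw [h]
  have h1 := e_smul (bl_L1 hX hV) (e_nonneg (bl_L1 hX hG) fun ω => hG0 _)
  simp only [mul_comm] at h1 ⊢
  exact h1

/-- The conjugate expectation is multiplicative over independent nonnegative functions. -/
theorem conj_mul_bl {X : ℕ → Ω → ℝ} (hX : ∀ n, X n ∈ S.H) (hind : S.IndepSeq X) {m n : ℕ}
    (hmn : m ≤ n) {V G : (ℕ → ℝ) → ℝ} (hV : BL 0 m V) (hV0 : ∀ x, 0 ≤ V x) (hG : BL m n G)
    (hG0 : ∀ x, 0 ≤ G x) :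
    - S.e (fun ω => - (V (fun i => X i ω) * G (fun i => X i ω))) =
      (- S.e (fun ω => - V (fun i => X i ω))) * (- S.e (fun ω => - G (fun i => X i ω))) := by
  have h := e_add_mul_bl hX hind hmn (BL.const 0) hV hV0 hG.neg
  simp only [zero_add, mul_neg] at h
  rw [h]
  have hc : 0 ≤ - S.e (fun ω => - G (fun i => X i ω)) := by
    have := e_mono (bl_L1 hX hG.neg) (L1.const (S := S) 0) fun ω => by simpa using hG0 _
    rw [e_const] at this
    linarith
  have h2 := e_smul (bl_L1 hX hV.neg) hc
  have h3 : (fun ω => - S.e (fun ω => - G (fun i => X i ω)) * - V (fun i => X i ω)) =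
      fun ω => V (fun i => X i ω) * S.e (fun ω => - G (fun i => X i ω)) := by
    ext ω; ring
  rw [h3] at h2
  rw [h2]
  ring

theorem e_prod_bl {X : ℕ → Ω → ℝ} (hX : ∀ n, X n ∈ S.H) (hind : S.IndepSeq X) {m n : ℕ}
    (hmn : m ≤ n) {f : ℕ → ℝ → ℝ} (hf : ∀ j ∈ Finset.Ico m n, BL j (j + 1) (fun x => f j (x j)))
    (hf0 : ∀ j a, 0 ≤ f j a) :
    S.e (fun ω => ∏ j ∈ Finset.Ico m n, f j (X j ω)) =
      ∏ j ∈ Finset.Ico m n, S.e (fun ω => f j (X j ω)) := by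
  induction n, hmn using Nat.le_induction with
  | base => simp [e_const]
  | succ n hmn ih =>
    simp only [Finset.prod_Ico_succ_top hmn]
    rw [← ih fun j hj => hf j (by simp at hj ⊢; omega)]
    refine e_mul_bl (V := fun x => ∏ j ∈ Finset.Ico m n, f j (x j)) (G := fun x => f n (x n))
      hX hind (Nat.le_succ n) ?_ (fun x => Finset.prod_nonneg fun j _ => hf0 j _)
      (hf n (by simp [hmn])) (fun x => hf0 n _)
    refine BL.prod _ fun j hj => ?_
    have hj' := Finset.mem_Ico.1 hj
    exact (hf j (by simp; omega)).mono (Nat.zero_le _) (by omega)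

end SublinearExpectationSpace

/-! ### Smoothed indicators and an exponential maximal inequality. -/

/-- The piecewise linear function that is `0` up to `u - w` and `1` from `u` on. -/
noncomputable def ramp (u w s : ℝ) : ℝ := max 0 (min 1 ((s - (u - w)) / w))

theorem ramp_nonneg (u w s : ℝ) : 0 ≤ ramp u w s := le_max_left _ _

theorem ramp_le_one (u w s : ℝ) : ramp u w s ≤ 1 := max_le zero_le_one (min_le_left _ _)

theorem ramp_eq_one {u w s : ℝ} (hw : 0 < w) (h : u ≤ s) : ramp u w s = 1 := by
  have : 1 ≤ (s - (u - w)) / w := by rw [le_div_iff₀ hw]; linarith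
  simp [ramp, min_eq_left this]

theorem lt_of_ramp_pos {u w s : ℝ} (hw : 0 < w) (h : 0 < ramp u w s) : u - w < s := by
  by_contra! hs
  have : (s - (u - w)) / w ≤ 0 := div_nonpos_of_nonpos_of_nonneg (by linarith) hw.le
  have h2 : ramp u w s ≤ 0 := max_le le_rfl ((min_le_right _ _).trans this)
  linarith

theorem ramp_lip {u w : ℝ} (hw : 0 < w) (a b : ℝ) :
    |ramp u w a - ramp u w b| ≤ (1 / w) * |a - b| := by
  unfold ramp
  refine (abs_max_sub_max_le_max _ _ _ _).trans (max_le (by simp; positivity) ?_)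
  refine (abs_min_sub_min_le_max _ _ _ _).trans (max_le (by simp; positivity) ?_)
  rw [← sub_div, abs_div, abs_of_pos hw]
  simp only [sub_sub_sub_cancel_right]
  rw [div_eq_mul_inv, one_div, mul_comm]

theorem bl_partial_sum {m k n : ℕ} (hkn : k ≤ n) {ψ : ℕ → ℝ → ℝ}
    (hψ : ∀ j ∈ Finset.Ico m n, BL j (j + 1) (fun x => ψ j (x j))) :
    BL m k (fun x => ∑ j ∈ Finset.Ico m k, ψ j (x j)) := by
  refine BL.sum _ fun j hj => ?_
  have hj' := Finset.mem_Ico.1 hj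
  exact (hψ j (by simp; omega)).mono hj'.1 (by omega)

namespace SublinearExpectationSpace

variable {Ω : Type*} [MeasurableSpace Ω] {S : SublinearExpectationSpace Ω}

theorem upCap_le_e {A : Set Ω} {ξ : Ω → ℝ} (hξ : S.L1 ξ) (h : ∀ ω, A.indicator 1 ω ≤ ξ ω) :
    S.upCap A ≤ ENNReal.ofReal (S.e ξ) := by
  have h1 : S.upCap A ≤ (S.E ξ).toENNReal := by
    unfold upCap
    exact iInf_le_of_le ξ (iInf_le_of_le hξ.1 (iInf_le_of_le h le_rfl))
  refine h1.trans ?_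
  rw [← hξ.coe_e]
  simp

/-- An exponential maximal inequality for sums of independent random variables. -/
theorem upCap_max_le {X : ℕ → Ω → ℝ} (hX : ∀ n, X n ∈ S.H) (hind : S.IndepSeq X) {m n : ℕ}
    (hmn : m ≤ n) {ψ : ℕ → ℝ → ℝ} (hψ : ∀ j ∈ Finset.Ico m n, BL j (j + 1) (fun x => ψ j (x j)))
    {lam u w : ℝ} (hlam : 0 ≤ lam) (hw : 0 < w) {c : ℕ → ℝ} (hc0 : ∀ j ∈ Finset.Ico m n, 0 ≤ c j)
    (hc : ∀ j ∈ Finset.Ico m n, S.e (fun ω => Real.exp (lam * ψ j (X j ω))) ≤ Real.exp (c j)) :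
    S.upCap {ω | ∃ k ∈ Finset.Ioc m n, u ≤ ∑ j ∈ Finset.Ico m k, ψ j (X j ω)} ≤
      ENNReal.ofReal (Real.exp (-(lam * (u - w)) + ∑ j ∈ Finset.Ico m n, c j)) := by
  classical
  set T : ℕ → (ℕ → ℝ) → ℝ := fun k x => ∑ j ∈ Finset.Ico m k, ψ j (x j) with hT
  set χ : ℝ → ℝ := ramp u w with hχ
  set M : ℕ → (ℕ → ℝ) → ℝ := fun k x =>
    Real.exp (∑ j ∈ Finset.Ico m k, (lam * ψ j (x j) - c j)) with hM
  -- A smooth stopping time: `W k` is the mass not yet stopped at time `k`, and the mass `W i * χ (T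
  -- (i + 1))` stops at time `i + 1`. Below, `A` collects the value of the exponential
  -- supermartingale `M` at the stopping time, so `A + W * M` is the stopped process, built from
  -- Lipschitz functions only.
  set W : ℕ → (ℕ → ℝ) → ℝ := fun k x => ∏ i ∈ Finset.Ico m k, (1 - χ (T (i + 1) x)) with hW
  set A : ℕ → (ℕ → ℝ) → ℝ := fun k x =>
    ∑ i ∈ Finset.Ico m k, W i x * χ (T (i + 1) x) * M (i + 1) x with hA
  have hψ' : ∀ j ∈ Finset.Ico m n, BL j (j + 1) (fun x => lam * ψ j (x j) - c j) := fun j hj => by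
    have := ((BL.const lam).mul (hψ j hj)).add (BL.const (-c j))
    simpa [sub_eq_add_neg] using this
  have hTb : ∀ k ≤ n, BL 0 k (T k) := fun k hk =>
    (bl_partial_sum hk hψ).mono (Nat.zero_le _) le_rfl
  have hχb : ∀ k ≤ n, BL 0 k (fun x => χ (T k x)) := fun k hk =>
    (hTb k hk).comp_lip (ramp_lip hw)
  have hMb : ∀ k ≤ n, BL 0 k (M k) := fun k hk =>
    ((bl_partial_sum (ψ := fun j a => lam * ψ j a - c j) hk hψ').mono (Nat.zero_le _) le_rfl).exp
  have hWb : ∀ k ≤ n, BL 0 k (W k) := fun k hk => by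
    refine BL.prod _ fun i hi => ?_
    have hi' := Finset.mem_Ico.1 hi
    have := (BL.const 1).add (hχb (i + 1) (by omega)).neg
    exact (by simpa [sub_eq_add_neg] using this : BL 0 (i + 1) _).mono le_rfl (by omega)
  have hAb : ∀ k ≤ n, BL 0 k (A k) := fun k hk => by
    refine BL.sum _ fun i hi => ?_
    have hi' := Finset.mem_Ico.1 hi
    exact ((((hWb i (by omega)).mono le_rfl (Nat.le_succ i)).mul (hχb (i + 1) (by omega))).mul
      (hMb (i + 1) (by omega))).mono le_rfl (by omega)
  have hW01 : ∀ k x, 0 ≤ W k x := fun k x => Finset.prod_nonneg fun i _ => by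
    have := ramp_le_one u w (T (i + 1) x); simp only [hχ]; linarith
  have hM0 : ∀ k x, 0 < M k x := fun k x => Real.exp_pos _
  -- the martingale property
  have hmart : ∀ k, m ≤ k → k ≤ n →
      S.e (fun ω => A k (fun i => X i ω) + W k (fun i => X i ω) * M k (fun i => X i ω)) ≤ 1 := by
    intro k hk
    induction k, hk using Nat.le_induction with
    | base => intro _; simp [hA, hW, hM, e_const]
    | succ k hk ih =>
      intro hkn
      have hkI : k ∈ Finset.Ico m n := by simp; omega
      have h1 : (fun ω => A (k + 1) (fun i => X i ω) +
          W (k + 1) (fun i => X i ω) * M (k + 1) (fun i => X i ω)) =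
          fun ω => A k (fun i => X i ω) + (fun x => W k x * M k x) (fun i => X i ω) *
            (fun x => Real.exp (lam * ψ k (x k) - c k)) (fun i => X i ω) := by
        ext ω
        simp only [hA, hW, hM, Finset.sum_Ico_succ_top hk, Finset.prod_Ico_succ_top hk,
          Real.exp_add]
        ring
      have hG : BL k (k + 1) (fun x => Real.exp (lam * ψ k (x k) - c k)) := (hψ' k hkI).exp
      rw [h1, e_add_mul_bl hX hind (Nat.le_succ k) (hAb k (by omega))
        ((hWb k (by omega)).mul (hMb k (by omega)))
        (fun x => mul_nonneg (hW01 k x) (hM0 k x).le) hG]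
      refine le_trans ?_ (ih (by omega))
      have hG1 : S.e (fun ω => Real.exp (lam * ψ k (X k ω) - c k)) ≤ 1 := by
        have h2 : (fun ω => Real.exp (lam * ψ k (X k ω) - c k)) =
            fun ω => Real.exp (-c k) * Real.exp (lam * ψ k (X k ω)) := by
          ext ω; rw [← Real.exp_add]; ring_nf
        have hL : S.L1 (fun ω => Real.exp (lam * ψ k (X k ω))) :=
          bl_L1 (F := fun x => Real.exp (lam * ψ k (x k))) hX (((BL.const lam).mul (hψ k hkI)).exp)
        rw [h2, e_smul hL (Real.exp_pos _).le]
        calc Real.exp (-c k) * S.e (fun ω => Real.exp (lam * ψ k (X k ω)))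
            ≤ Real.exp (-c k) * Real.exp (c k) := by gcongr; exact hc k hkI
          _ = 1 := by rw [← Real.exp_add]; simp
      have hWM := (hWb k (by omega)).mul (hMb k (by omega))
      refine e_mono (bl_L1 (F := fun x => A k x + W k x * M k x *
        S.e (fun ω => Real.exp (lam * ψ k (X k ω) - c k))) hX
        ((hAb k (by omega)).add (hWM.mul (BL.const _))))
        (bl_L1 (F := fun x => A k x + W k x * M k x) hX ((hAb k (by omega)).add hWM)) fun ω => ?_
      have := mul_nonneg (hW01 k (fun i => X i ω)) (hM0 k (fun i => X i ω)).le
      dsimp only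
      nlinarith
  set q := Real.exp (lam * (u - w) - ∑ j ∈ Finset.Ico m n, c j) with hq
  -- Mass stops only where `χ > 0`, that is, where the sum exceeds `u - w`; there `M ≥ q`, since
  -- replacing the partial sum of the nonnegative `c j` by the full sum only lowers the exponent.
  have hpath : ∀ x k, m ≤ k → k ≤ n → (1 - W k x) * q ≤ A k x := by
    intro x k hk
    induction k, hk using Nat.le_induction with
    | base => intro _; simp [hA, hW]
    | succ k hk ih =>
      intro hkn
      have ih := ih (by omega)
      have h1 : W (k + 1) x = W k x * (1 - χ (T (k + 1) x)) := by
        simp only [hW, Finset.prod_Ico_succ_top hk]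
      have h2 : A (k + 1) x = A k x + W k x * χ (T (k + 1) x) * M (k + 1) x := by
        simp only [hA, Finset.sum_Ico_succ_top hk]
      have h3 : W k x * χ (T (k + 1) x) * q ≤ W k x * χ (T (k + 1) x) * M (k + 1) x := by
        rcases (ramp_nonneg u w (T (k + 1) x)).eq_or_lt with h0 | h0
        · simp only [hχ, ← h0]; simp
        · refine mul_le_mul_of_nonneg_left ?_ (mul_nonneg (hW01 k x) h0.le)
          refine Real.exp_le_exp.2 ?_
          rw [Finset.sum_sub_distrib, ← Finset.mul_sum]
          have h4 := (lt_of_ramp_pos hw h0).le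
          have h5 : ∑ j ∈ Finset.Ico m (k + 1), c j ≤ ∑ j ∈ Finset.Ico m n, c j :=
            Finset.sum_le_sum_of_subset_of_nonneg (Finset.Ico_subset_Ico_right hkn)
              fun j hj _ => hc0 j hj
          have h6 := mul_le_mul_of_nonneg_left h4 hlam
          linarith
      rw [h1, h2]
      linarith
  have hqpos : 0 < q := Real.exp_pos _
  have hlast : S.e (fun ω => 1 - W n (fun i => X i ω)) ≤ q⁻¹ := by
    have h1 : S.L1 (fun ω => A n (fun i => X i ω)) := bl_L1 hX (hAb n le_rfl)
    have h2 : S.L1 (fun ω => A n (fun i => X i ω) + W n (fun i => X i ω) * M n (fun i => X i ω)) :=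
      bl_L1 (F := fun x => A n x + W n x * M n x) hX
        ((hAb n le_rfl).add ((hWb n le_rfl).mul (hMb n le_rfl)))
    have h3 : S.L1 (fun ω => 1 - W n (fun i => X i ω)) := (L1.const 1).sub (bl_L1 hX (hWb n le_rfl))
    have h4 := e_mono (h3.smul q) h2 fun ω => by
      have := hpath (fun i => X i ω) n hmn le_rfl
      have h5 := mul_nonneg (hW01 n (fun i => X i ω)) (hM0 n (fun i => X i ω)).le
      linarith
    rw [e_smul h3 hqpos.le] at h4
    have h5 := h4.trans (hmart n hmn le_rfl)
    rw [inv_eq_one_div, le_div_iff₀ hqpos]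
    linarith
  have hL : S.L1 (fun ω => 1 - W n (fun i => X i ω)) := (L1.const 1).sub (bl_L1 hX (hWb n le_rfl))
  refine (upCap_le_e hL fun ω => ?_).trans (ENNReal.ofReal_le_ofReal (hlast.trans_eq ?_))
  · have hW1 : W n (fun i => X i ω) ≤ 1 := Finset.prod_le_one
      (fun i _ => by have := ramp_le_one u w (T (i + 1) fun i => X i ω); simp only [hχ]; linarith)
      (fun i _ => by have := ramp_nonneg u w (T (i + 1) fun i => X i ω); simp only [hχ]; linarith)
    by_cases hω : ω ∈ {ω | ∃ k ∈ Finset.Ioc m n, u ≤ ∑ j ∈ Finset.Ico m k, ψ j (X j ω)}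
    · rw [Set.indicator_of_mem hω]
      obtain ⟨k, hk, hu⟩ := hω
      have hk := Finset.mem_Ioc.1 hk
      have : W n (fun i => X i ω) = 0 := by
        -- The factor with index `i` tests the sum at time `i + 1`, so a passage at time `k` kills
        -- the factor `k - 1`.
        refine Finset.prod_eq_zero (i := k - 1) (by simp; omega) ?_
        have h1 : k - 1 + 1 = k := by omega
        rw [h1, hχ, ramp_eq_one hw hu, sub_self]
      simp [this]
    · rw [Set.indicator_of_notMem hω]
      linarith
  · rw [hq, ← Real.exp_neg]; ring_nf

end SublinearExpectationSpace

/-! ### Comparison of the capacities and Borel-Cantelli. -/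

theorem lintegral_ofReal_le_of_truncations {Ω : Type*} {m0 : MeasurableSpace Ω} (P : Measure Ω)
    [IsProbabilityMeasure P] {Z : Ω → ℝ} (hZ : Measurable Z) (h0 : ∀ ω, 0 ≤ Z ω) {b : ℝ≥0∞}
    (hb : ∀ N : ℕ, ENNReal.ofReal (∫ ω, min (Z ω) N ∂P) ≤ b) :
    ∫⁻ ω, ENNReal.ofReal (Z ω) ∂P ≤ b := by
  have h1 : ∀ ω, ENNReal.ofReal (Z ω) = ⨆ N : ℕ, ENNReal.ofReal (min (Z ω) N) := by
    intro ω
    obtain ⟨N, hN⟩ := exists_nat_ge (Z ω)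
    refine le_antisymm (le_iSup_of_le N (by rw [min_eq_left hN]))
      (iSup_le fun N => ENNReal.ofReal_le_ofReal (min_le_left _ _))
  have hm : ∀ N : ℕ, Measurable fun ω => min (Z ω) (N : ℝ) := fun N => hZ.min measurable_const
  simp_rw [h1]
  rw [lintegral_iSup (fun N => (hm N).ennreal_ofReal)]
  · refine iSup_le fun N => ?_
    have hn : ∀ ω, 0 ≤ min (Z ω) (N : ℝ) := fun ω => le_min (h0 ω) (Nat.cast_nonneg N)
    rw [← ofReal_integral_eq_lintegral_ofReal _ (Eventually.of_forall hn)]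
    · exact hb N
    · refine Integrable.of_bound (hm N).aestronglyMeasurable N (Eventually.of_forall fun ω => ?_)
      rw [Real.norm_eq_abs, abs_of_nonneg (hn ω)]
      exact min_le_right _ _
  · intro a b hab ω
    have : (a : ℝ) ≤ b := Nat.cast_le.2 hab
    dsimp only
    gcongr

/-- Markov's inequality at level one for the sum of the series, then monotone convergence. -/
theorem measure_le_iSup_lintegral_sum {Ω : Type*} {m0 : MeasurableSpace Ω} (P : Measure Ω)
    {g : ℕ → Ω → ℝ} (hg : ∀ n, Measurable (g n)) (h0 : ∀ n ω, 0 ≤ g n ω) {A : Set Ω}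
    (hA : ∀ ω ∈ A, 1 ≤ ∑' n, ENNReal.ofReal (g n ω)) :
    P A ≤ ⨆ n : ℕ, ∫⁻ ω, ENNReal.ofReal (∑ i ∈ Finset.range n, g i ω) ∂P := by
  have hmeas : ∀ n, Measurable fun ω => ENNReal.ofReal (g n ω) := fun n => (hg n).ennreal_ofReal
  calc P A ≤ P {ω | 1 ≤ ∑' n, ENNReal.ofReal (g n ω)} := measure_mono hA
    _ ≤ ∫⁻ ω, ∑' n, ENNReal.ofReal (g n ω) ∂P := by
        simpa using mul_meas_ge_le_lintegral₀ (μ := P) (Measurable.tsum hmeas).aemeasurable 1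
    _ = ∑' n, ∫⁻ ω, ENNReal.ofReal (g n ω) ∂P := lintegral_tsum fun n => (hmeas n).aemeasurable
    _ = ⨆ n : ℕ, ∑ i ∈ Finset.range n, ∫⁻ ω, ENNReal.ofReal (g i ω) ∂P :=
        ENNReal.tsum_eq_iSup_nat
    _ = _ := by
        refine iSup_congr fun n => ?_
        rw [← lintegral_finsetSum _ fun i _ => hmeas i]
        simp_rw [← ENNReal.ofReal_sum_of_nonneg fun i (_ : i ∈ Finset.range n) => h0 i _]

namespace SublinearExpectationSpace

variable {Ω : Type*} [MeasurableSpace Ω] {S : SublinearExpectationSpace Ω}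

theorem e_sum_le {ι : Type*} (s : Finset ι) {Z : ι → Ω → ℝ} (h : ∀ i ∈ s, S.L1 (Z i)) :
    S.e (fun ω => ∑ i ∈ s, Z i ω) ≤ ∑ i ∈ s, S.e (Z i) := by
  classical
  induction s using Finset.induction_on with
  | empty => simp [e_const]
  | insert i s hi ih =>
    simp only [Finset.sum_insert hi]
    have h1 : ∀ j ∈ s, S.L1 (Z j) := fun j hj => h j (by simp [hj])
    refine (e_add_le (h i (by simp)) (L1.sum s h1)).trans ?_
    gcongr
    exact ih h1

theorem upCap_empty : S.upCap ∅ = 0 := by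
  have := upCap_le_e (S := S) (A := ∅) (L1.const 0) (by simp)
  simpa [e_const] using this

theorem upCap_le_one (A : Set Ω) : S.upCap A ≤ 1 := by
  have := upCap_le_e (S := S) (A := A) (L1.const 1) fun ω =>
    Set.indicator_le_self' (f := (1 : Ω → ℝ)) (fun _ _ => zero_le_one) ω
  simpa [e_const] using this

/-- `outerCap` as an outer measure. -/
noncomputable def outerCapMeasure (S : SublinearExpectationSpace Ω) : OuterMeasure Ω :=
  OuterMeasure.ofFunction (fun B => ⨅ _ : MeasurableSet B, S.upCap B)
    (by simp [upCap_empty])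

/-- Countable sub-additivity and monotonicity then come from the theory of outer measures. Giving
non-measurable sets the value `⊤` discards exactly the covers that `outerCap` does not allow. -/
theorem outerCap_eq (A : Set Ω) : S.outerCap A = S.outerCapMeasure A := by
  rw [outerCapMeasure, OuterMeasure.ofFunction_apply, outerCap]
  apply le_antisymm
  · refine le_iInf₂ fun t ht => ?_
    by_cases hm : ∀ n, MeasurableSet (t n)
    · refine iInf_le_of_le t (iInf_le_of_le hm (iInf_le_of_le ht ?_))
      exact ENNReal.tsum_le_tsum fun n => by simp [hm n]
    · push Not at hm
      obtain ⟨n, hn⟩ := hm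
      have : (⊤ : ℝ≥0∞) ≤ ∑' n, ⨅ _ : MeasurableSet (t n), S.upCap (t n) := by
        refine le_trans ?_ (ENNReal.le_tsum n)
        simp [hn]
      exact le_top.trans this
  · refine le_iInf fun t => le_iInf fun hm => le_iInf fun ht => ?_
    refine iInf₂_le_of_le t ht (ENNReal.tsum_le_tsum fun n => by simp [hm n])

theorem outerCap_mono {A B : Set Ω} (h : A ⊆ B) : S.outerCap A ≤ S.outerCap B := by
  rw [outerCap_eq, outerCap_eq]; exact measure_mono h

theorem outerCap_le_upCap {A : Set Ω} (hA : MeasurableSet A) : S.outerCap A ≤ S.upCap A := by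
  rw [outerCap_eq, outerCapMeasure]
  refine (OuterMeasure.ofFunction_le A).trans (by simp [hA])

theorem outerCap_le_one (A : Set Ω) : S.outerCap A ≤ 1 :=
  (outerCap_mono (Set.subset_univ A)).trans
    ((outerCap_le_upCap MeasurableSet.univ).trans (upCap_le_one _))

theorem outerCap_iUnion_null {ι : Type*} [Countable ι] {A : ι → Set Ω}
    (h : ∀ i, S.outerCap (A i) = 0) : S.outerCap (⋃ i, A i) = 0 := by
  rw [outerCap_eq]
  exact measure_iUnion_null fun i => by rw [← outerCap_eq]; exact h i

theorem outerCap_union_null {A B : Set Ω} (hA : S.outerCap A = 0) (hB : S.outerCap B = 0) :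
    S.outerCap (A ∪ B) = 0 := by
  rw [outerCap_eq] at *
  exact measure_union_null hA hB

/-- Borel-Cantelli for `outerCap`. -/
theorem outerCap_frequently_null {B : ℕ → Set Ω} (hB : ∀ n, MeasurableSet (B n))
    {f : ℕ → ℝ} (hf : Summable f) (h : ∀ᶠ n in atTop, S.upCap (B n) ≤ ENNReal.ofReal (f n)) :
    S.outerCap {ω | ∃ᶠ n in atTop, ω ∈ B n} = 0 := by
  obtain ⟨N, hN⟩ := eventually_atTop.1 h
  have h1 : S.outerCapMeasure {ω | ∃ᶠ n in atTop, ω ∈ B (n + N)} = 0 := by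
    refine measure_setOfPred_frequently_eq_zero ?_
    have : ∑' n, S.outerCapMeasure (B (n + N)) ≤ ∑' n, ENNReal.ofReal (|f (n + N)|) :=
      ENNReal.tsum_le_tsum fun n => by
        rw [← outerCap_eq]
        exact (outerCap_le_upCap (hB _)).trans ((hN _ (by omega)).trans
          (ENNReal.ofReal_le_ofReal (le_abs_self _)))
    refine (this.trans_lt ?_).ne
    have h2 : Summable fun n => |f (n + N)| := ((summable_nat_add_iff N).2 hf).abs
    exact h2.tsum_ofReal_lt_top
  rw [outerCap_eq]
  convert h1 using 2
  ext ω
  simp only [Set.mem_ofPred_eq]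
  constructor
  · intro hω
    rw [frequently_atTop] at hω ⊢
    intro a
    obtain ⟨b, hb, hb'⟩ := hω (a + N)
    exact ⟨b - N, by omega, by rwa [Nat.sub_add_cancel (by omega)]⟩
  · intro hω
    rw [frequently_atTop] at hω ⊢
    intro a
    obtain ⟨b, hb, hb'⟩ := hω a
    exact ⟨b + N, by omega, hb'⟩

/-- Nearly optimal dominating functions of the covering sets, with errors that sum to at most `ε`,
form an admissible series for `cStar`. -/
theorem cStar_le_outerCap (A : Set Ω) : S.cStar A ≤ S.outerCap A := by
  refine le_iInf fun B => le_iInf fun hB => le_iInf fun hAB => ?_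
  refine ENNReal.le_of_forall_pos_le_add fun ε hε hfin => ?_
  obtain ⟨ε', hε', hεs⟩ := ENNReal.exists_pos_sum_of_countable (ε := (ε : ℝ≥0∞))
    (by simpa using hε.ne') ℕ
  have hne : ∀ n, S.upCap (B n) ≠ ⊤ := fun n => ((upCap_le_one _).trans_lt ENNReal.one_lt_top).ne
  have hex : ∀ n, ∃ ξ ∈ S.H, (∀ ω, (B n).indicator 1 ω ≤ ξ ω) ∧
      (S.E ξ).toENNReal < S.upCap (B n) + ε' n := by
    intro n
    have h1 : S.upCap (B n) < S.upCap (B n) + ε' n :=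
      ENNReal.lt_add_right (hne n) (by simpa using (hε' n).ne')
    conv_lhs at h1 => rw [upCap]
    simp only [iInf_lt_iff] at h1
    obtain ⟨ξ, h2, h3, h4⟩ := h1
    exact ⟨ξ, h2, h3, h4⟩
  choose ξ hξH hξ hξlt using hex
  have h0 : ∀ n ω, 0 ≤ ξ n ω := fun n ω =>
    (Set.indicator_nonneg (f := (1 : Ω → ℝ)) (fun _ _ => zero_le_one) ω).trans (hξ n ω)
  have hL : ∀ n, S.L1 (ξ n) := fun n => L1.of_nonneg (hξH n) (h0 n) <| by
    have h1 : (S.E (ξ n)).toENNReal < ⊤ := (hξlt n).trans_le le_top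
    rw [lt_top_iff_ne_top, Ne, EReal.toENNReal_eq_top_iff] at h1
    exact lt_top_iff_ne_top.2 h1
  have hcov : ∀ ω, A.indicator 1 ω ≤ ∑' n, ENNReal.ofReal (ξ n ω) := by
    intro ω
    by_cases hω : ω ∈ A
    · obtain ⟨k, hk⟩ := Set.mem_iUnion.1 (hAB hω)
      rw [Set.indicator_of_mem hω]
      refine le_trans ?_ (ENNReal.le_tsum k)
      have := hξ k ω
      rw [Set.indicator_of_mem hk] at this
      simpa using this
    · rw [Set.indicator_of_notMem hω]; exact zero_le
  have hc : S.cStar A ≤ ⨆ n : ℕ, (S.E (fun ω => ∑ i ∈ Finset.range n, ξ i ω)).toENNReal := by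
    unfold cStar
    exact iInf_le_of_le ξ (iInf_le_of_le hξH (iInf_le_of_le h0 (iInf_le_of_le hcov le_rfl)))
  refine hc.trans (iSup_le fun n => ?_)
  have h1 : (S.E (fun ω => ∑ i ∈ Finset.range n, ξ i ω)).toENNReal ≤
      ∑ i ∈ Finset.range n, (S.E (ξ i)).toENNReal := by
    rw [← (L1.sum (Finset.range n) fun i _ => hL i).coe_e, EReal.real_coe_toENNReal]
    refine (ENNReal.ofReal_le_ofReal (e_sum_le _ fun i _ => hL i)).trans ?_
    rw [ENNReal.ofReal_sum_of_nonneg fun i _ => e_nonneg (hL i) (h0 i)]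
    refine (Finset.sum_congr rfl fun i _ => ?_).le
    rw [← (hL i).coe_e, EReal.real_coe_toENNReal]
  calc _ ≤ ∑ i ∈ Finset.range n, (S.E (ξ i)).toENNReal := h1
    _ ≤ ∑' i, (S.E (ξ i)).toENNReal := ENNReal.sum_le_tsum _
    _ ≤ ∑' i, (S.upCap (B i) + ε' i) := ENNReal.tsum_le_tsum fun i => (hξlt i).le
    _ = ∑' i, S.upCap (B i) + ∑' i, (ε' i : ℝ≥0∞) := ENNReal.tsum_add
    _ ≤ _ := by gcongr

theorem measurable_sigmaH {Z : Ω → ℝ} (hZ : Z ∈ S.H) : Measurable[S.sigmaH] Z := by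
  rw [measurable_iff_comap_le, BorelSpace.measurable_eq (α := ℝ)]
  exact le_iSup₂ (f := fun X (_ : X ∈ S.H) => MeasurableSpace.comap X (borel ℝ)) Z hZ

/-- (CC) represents the expectation on bounded elements only, hence the passage through the
truncations `min Z N`. -/
theorem lintegral_le_E {Ps : Set (@Measure Ω S.sigmaH)} (hCC : S.ConditionCC Ps)
    {P : @Measure Ω S.sigmaH} (hP : P ∈ Ps) {Z : Ω → ℝ} (hZ : Z ∈ S.H) (h0 : ∀ ω, 0 ≤ Z ω) :
    ∫⁻ ω, ENNReal.ofReal (Z ω) ∂P ≤ (S.E Z).toENNReal := by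
  have := hCC.prob P hP
  refine lintegral_ofReal_le_of_truncations P (measurable_sigmaH hZ) h0 fun N => ?_
  have hm : (fun ω => min (Z ω) (N : ℝ)) ∈ S.H := by
    refine S.comp_mem_one hZ (φ := fun s => min s (N : ℝ)) (CLLip.of_lipschitz (K := 1) fun a b => ?_)
    rw [one_mul]
    have := abs_min_sub_min_le_max a N b N
    simpa using this
  have hb : (fun ω => min (Z ω) (N : ℝ)) ∈ S.Hb := ⟨hm, N, fun ω => by
    rw [abs_of_nonneg (le_min (h0 ω) (Nat.cast_nonneg N))]; exact min_le_right _ _⟩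
  have h1 : ((∫ ω, min (Z ω) (N : ℝ) ∂P : ℝ) : EReal) ≤ S.E (fun ω => min (Z ω) (N : ℝ)) := by
    rw [hCC.repr _ hb]
    exact le_iSup₂ (f := fun P (_ : P ∈ Ps) => ((∫ ω, min (Z ω) (N : ℝ) ∂P : ℝ) : EReal)) P hP
  rw [← EReal.real_coe_toENNReal]
  exact EReal.toENNReal_le_toENNReal (h1.trans (S.mono _ hZ _ hm fun ω => min_le_left _ _))

theorem capOf_le_cStar {Ps : Set (@Measure Ω S.sigmaH)} (hCC : S.ConditionCC Ps) (A : Set Ω) :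
    S.capOf Ps A ≤ S.cStar A := by
  refine iSup₂_le fun P hP => ?_
  refine le_iInf fun g => le_iInf fun hg => le_iInf fun h0 => le_iInf fun hA => ?_
  have hA' : ∀ ω ∈ A, 1 ≤ ∑' n, ENNReal.ofReal (g n ω) := fun ω hω => by
    have := hA ω
    rw [Set.indicator_of_mem hω] at this
    exact this
  refine (measure_le_iSup_lintegral_sum P (fun n => measurable_sigmaH (hg n)) h0 hA').trans ?_
  refine iSup_mono fun n => ?_
  refine lintegral_le_E hCC hP ?_ fun ω => Finset.sum_nonneg fun i _ => h0 i ω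
  have := S.H.sum_mem fun i (_ : i ∈ Finset.range n) => hg i
  convert this using 1
  ext ω
  simp

end SublinearExpectationSpace

/-! ### Iterated logarithms, geometric chains of indices, and summation lemmas. -/

theorem one_le_pLog (x : ℝ) : 1 ≤ pLog x := by
  rw [pLog, Real.le_log_iff_exp_le (lt_max_of_lt_left (Real.exp_pos 1))]
  exact le_max_left _ _

theorem pLog_pos (x : ℝ) : 0 < pLog x := zero_lt_one.trans_le (one_le_pLog x)

theorem pLog_mono : Monotone pLog := fun _ _ h =>
  Real.log_le_log (lt_max_of_lt_left (Real.exp_pos 1)) (max_le_max le_rfl h)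

theorem pLog_mul_le {θ : ℝ} (hθ : 1 ≤ θ) (x : ℝ) : pLog (θ * x) ≤ Real.log θ + pLog x := by
  have h1 : 0 < max (Real.exp 1) x := lt_max_of_lt_left (Real.exp_pos 1)
  rw [pLog, pLog, ← Real.log_mul (by linarith) h1.ne']
  refine Real.log_le_log (lt_max_of_lt_left (Real.exp_pos 1)) (max_le ?_ ?_)
  · calc Real.exp 1 ≤ max (Real.exp 1) x := le_max_left _ _
      _ ≤ _ := le_mul_of_one_le_left h1.le hθ
  · exact mul_le_mul_of_nonneg_left (le_max_right _ _) (by linarith)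

theorem le_exp_pLog (x : ℝ) : x ≤ Real.exp (pLog x) := by
  rw [pLog, Real.exp_log (lt_max_of_lt_left (Real.exp_pos 1))]
  exact le_max_right _ _

theorem exp_pLog_of_le {x : ℝ} (h : Real.exp 1 ≤ x) : Real.exp (pLog x) = x := by
  rw [pLog, Real.exp_log (lt_max_of_lt_left (Real.exp_pos 1)), max_eq_right h]

theorem tendsto_pLog : Tendsto pLog atTop atTop := by
  refine tendsto_atTop_mono' _ ?_ Real.tendsto_log_atTop
  filter_upwards [eventually_gt_atTop 0] with x hx
  exact Real.log_le_log hx (le_max_right _ _)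

theorem pLog_pLog_mul_le {θ : ℝ} (hθ : 1 ≤ θ) (x : ℝ) :
    pLog (pLog (θ * x)) ≤ θ * pLog (pLog x) := by
  have hlog : Real.log θ ≤ θ - 1 := Real.log_le_sub_one_of_pos (by linarith)
  have hlog0 : 0 ≤ Real.log θ := Real.log_nonneg hθ
  have h1 : pLog (θ * x) ≤ θ * pLog x := by
    have := pLog_mul_le hθ x
    nlinarith [one_le_pLog x]
  have h2 := (pLog_mono h1).trans (pLog_mul_le hθ _)
  nlinarith [one_le_pLog (pLog x)]

/-- An increasing sequence of indices along which `q` grows at least geometrically, and between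
which it grows at most by the same factor. -/
structure GeomChain (q : ℕ → ℝ) (θ : ℝ) (m : ℕ → ℕ) : Prop where
  strictMono : StrictMono m
  pos : ∀ i, 0 < q (m i)
  growth : ∀ i, θ * q (m i) ≤ q (m (i + 1))
  block : ∀ i n, m i ≤ n → n < m (i + 1) → q n ≤ θ * q (m i)

/-- The next index is the first later one at which `q` has grown by the factor `θ`; minimality gives
the bound inside the block. At `m (i + 1)` itself `q` may jump by any amount, so the block bound
stops just before it. -/
theorem exists_geomChain {q : ℕ → ℝ} (hq : Tendsto q atTop atTop) {θ : ℝ} (hθ : 1 < θ) {K : ℕ}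
    (hK : 0 < q K) : ∃ m : ℕ → ℕ, m 0 = K ∧ GeomChain q θ m := by
  classical
  have hex : ∀ n : ℕ, ∃ k, n < k ∧ θ * q n ≤ q k := fun n =>
    ((eventually_gt_atTop n).and (hq.eventually_ge_atTop (θ * q n))).exists
  set m : ℕ → ℕ := fun i => Nat.rec K (fun _ n => Nat.find (hex n)) i with hm
  have hsucc : ∀ i, m (i + 1) = Nat.find (hex (m i)) := fun i => rfl
  have hspec : ∀ i, m i < m (i + 1) ∧ θ * q (m i) ≤ q (m (i + 1)) := fun i => by
    rw [hsucc]; exact Nat.find_spec (hex (m i))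
  have hpos : ∀ i, 0 < q (m i) := fun i => by
    induction i with
    | zero => exact hK
    | succ i ih => exact lt_of_lt_of_le (by nlinarith) (hspec i).2
  refine ⟨m, rfl, strictMono_nat_of_lt_succ fun i => (hspec i).1, hpos, fun i => (hspec i).2, ?_⟩
  intro i n h1 h2
  rw [hsucc] at h2
  have := Nat.find_min (hex (m i)) h2
  push Not at this
  rcases h1.eq_or_lt with h | h
  · rw [← h]; exact le_mul_of_one_le_left (hpos i).le hθ.le
  · exact (this h).le

theorem GeomChain.pow_le {q : ℕ → ℝ} {θ : ℝ} {m : ℕ → ℕ} (h : GeomChain q θ m) (hθ : 0 ≤ θ)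
    (i : ℕ) : θ ^ i * q (m 0) ≤ q (m i) := by
  induction i with
  | zero => simp
  | succ i ih =>
    refine le_trans ?_ (h.growth i)
    rw [pow_succ, mul_comm _ θ, mul_assoc]
    exact mul_le_mul_of_nonneg_left ih hθ

/-- Summing the recursion gives `(1 - r) ∑ y ≤ y 0 + ∑ z`; the induction carries this bound on
partial sums. -/
theorem summable_of_recursion {y z : ℕ → ℝ} (hy : ∀ i, 0 ≤ y i) (hz : ∀ i, 0 ≤ z i)
    (hzs : Summable z) {r : ℝ} (hr0 : 0 ≤ r) (hr : r < 1) (h : ∀ i, y (i + 1) ≤ r * y i + z i) :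
    Summable y := by
  have hr' : 0 < 1 - r := by linarith
  set B := (y 0 + ∑' i, z i) / (1 - r) with hB
  have hB1 : y 0 + ∑' i, z i + r * B = B := by rw [hB]; field_simp; ring
  have hB0 : 0 ≤ B := div_nonneg (add_nonneg (hy 0) (tsum_nonneg hz)) hr'.le
  refine summable_of_sum_range_le (c := B) hy fun n => ?_
  induction n with
  | zero => simpa using hB0
  | succ n ih =>
    rw [Finset.sum_range_succ']
    have h1 : ∑ i ∈ Finset.range n, y (i + 1) ≤ ∑ i ∈ Finset.range n, (r * y i + z i) :=
      Finset.sum_le_sum fun i _ => h i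
    rw [Finset.sum_add_distrib, ← Finset.mul_sum] at h1
    have h2 := hzs.sum_le_tsum (Finset.range n) fun i _ => hz i
    have h3 := mul_le_mul_of_nonneg_left ih hr0
    linarith

/-- Passing from block `i` to `i + 1`, the old terms shrink by `r` and the new ones are at most `C`
times the matching part of the convergent series, so `summable_of_recursion` applies. -/
theorem summable_weighted_blocks {K w : ℕ → ℝ} (hK : ∀ j, 0 ≤ K j) (hw : ∀ j, 0 ≤ w j)
    (hs : Summable fun j => K j * w j) {n : ℕ → ℕ} (hn : Monotone n) {c : ℕ → ℝ}
    (hc : ∀ i, 0 ≤ c i) {r C : ℝ} (hr0 : 0 ≤ r) (hr : r < 1) (hC : 0 ≤ C)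
    (hcr : ∀ i, c (i + 1) ≤ r * c i)
    (hcw : ∀ i j, n i < j → j ≤ n (i + 1) → c (i + 1) ≤ C * w j) :
    Summable fun i => c i * ∑ j ∈ Finset.range (n i + 1), K j := by
  have hKw : ∀ j, 0 ≤ K j * w j := fun j => mul_nonneg (hK j) (hw j)
  refine summable_of_recursion (z := fun i => C * ∑ j ∈ Finset.Ioc (n i) (n (i + 1)), K j * w j)
    (fun i => mul_nonneg (hc i) (Finset.sum_nonneg fun j _ => hK j))
    (fun i => mul_nonneg hC (Finset.sum_nonneg fun j _ => hKw j)) ?_ hr0 hr fun i => ?_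
  · refine Summable.mul_left _ (summable_of_sum_range_le (c := ∑' j, K j * w j)
      (fun i => Finset.sum_nonneg fun j _ => hKw j) fun I => ?_)
    have : ∑ i ∈ Finset.range I, ∑ j ∈ Finset.Ioc (n i) (n (i + 1)), K j * w j =
        ∑ j ∈ Finset.Ioc (n 0) (n I), K j * w j := by
      induction I with
      | zero => simp
      | succ I ih =>
        rw [Finset.sum_range_succ, ih,
          Finset.sum_Ioc_consecutive _ (hn (Nat.zero_le I)) (hn (Nat.le_succ I))]
    rw [this]
    exact hs.sum_le_tsum _ fun j _ => hKw j
  · have h1 : ∑ j ∈ Finset.range (n (i + 1) + 1), K j =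
        ∑ j ∈ Finset.range (n i + 1), K j + ∑ j ∈ Finset.Ioc (n i) (n (i + 1)), K j := by
      rw [Finset.range_eq_Ico, Finset.range_eq_Ico,
        ← Finset.sum_Ico_consecutive K (Nat.zero_le _)
          (Nat.succ_le_succ (hn (Nat.le_succ i)))]
      congr 1
      refine Finset.sum_congr ?_ fun _ _ => rfl
      ext j
      simp only [Finset.mem_Ico, Finset.mem_Ioc, Nat.succ_eq_add_one]
      omega
    rw [h1, mul_add, Finset.mul_sum _ _ C, Finset.mul_sum (Finset.Ioc _ _), ← mul_assoc]
    refine add_le_add ?_ (Finset.sum_le_sum fun j hj => ?_)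
    · exact mul_le_mul_of_nonneg_right (hcr i) (Finset.sum_nonneg fun j _ => hK j)
    · have hj := Finset.mem_Ioc.1 hj
      have := mul_le_mul_of_nonneg_right (hcw i j hj.1 hj.2) (hK j)
      linarith

/-- A discrete `l ^ (d + 1) = (d + 1) ∫ l ^ d dl`: by convexity, each increment of the power of the
partial sum is at most its derivative at the right endpoint times the step. It brings the series of
condition 2 into play. -/
theorem rpow_add_one_sum_le {g : ℕ → ℝ} (hg : ∀ j, 0 ≤ g j) {d : ℝ} (hd : 0 ≤ d) (m n : ℕ) :
    (∑ j ∈ Finset.Ico m n, g j) ^ (d + 1) ≤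
      (d + 1) * ∑ j ∈ Finset.Ico m n, g j * (∑ i ∈ Finset.Ico m (j + 1), g i) ^ d := by
  rcases le_or_gt n m with h | hmn
  · rw [Finset.Ico_eq_empty (by omega)]
    simp [Real.zero_rpow (by linarith : d + 1 ≠ 0)]
  induction n, hmn.le using Nat.le_induction with
  | base => omega
  | succ n hmn' ih =>
    rw [Finset.sum_Ico_succ_top hmn', Finset.sum_Ico_succ_top hmn', Finset.sum_Ico_succ_top hmn']
    set l := ∑ j ∈ Finset.Ico m n, g j
    have hl : 0 ≤ l := Finset.sum_nonneg fun j _ => hg j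
    have ih' : l ^ (d + 1) ≤
        (d + 1) * ∑ j ∈ Finset.Ico m n, g j * (∑ i ∈ Finset.Ico m (j + 1), g i) ^ d := by
      rcases hmn'.eq_or_lt with h | h
      · subst h; simp [l, Real.zero_rpow (by linarith : d + 1 ≠ 0)]
      · exact ih h
    have key : (l + g n) ^ (d + 1) ≤ l ^ (d + 1) + (d + 1) * (g n * (l + g n) ^ d) := by
      rcases (add_nonneg hl (hg n)).eq_or_lt with h0 | h0
      · rw [← h0, Real.zero_rpow (by linarith : d + 1 ≠ 0)]
        have := hg n
        positivity
      -- Bernoulli's inequality for the ratio of consecutive partial sums, which is the tangent-line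
      -- bound at the larger one.
      · have hB := one_add_mul_self_le_rpow_one_add (s := -(g n / (l + g n))) (p := d + 1)
          (by rw [neg_le_neg_iff, div_le_one h0]; linarith) (by linarith)
        have h1 : 1 + -(g n / (l + g n)) = l / (l + g n) := by field_simp; ring
        rw [h1, Real.div_rpow hl h0.le] at hB
        have h2 : 0 < (l + g n) ^ (d + 1) := Real.rpow_pos_of_pos h0 _
        have h3 := mul_le_mul_of_nonneg_right hB h2.le
        rw [div_mul_cancel₀ _ h2.ne'] at h3
        have h4 : (l + g n) ^ (d + 1) = (l + g n) ^ d * (l + g n) := Real.rpow_add_one h0.ne' d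
        have h5 : (d + 1) * -(g n / (l + g n)) * (l + g n) ^ (d + 1) =
            -((d + 1) * (g n * (l + g n) ^ d)) := by
          rw [h4]; field_simp
        linarith
    linarith

/-! ### Elementary exponential inequalities and truncation. -/

theorem exp_le_quadratic {u c : ℝ} (hu : |u| ≤ c) (hc : c ≤ 1) :
    Real.exp u ≤ 1 + u + u ^ 2 / 2 * (1 + c) := by
  have h := Real.exp_bound (x := u) (hu.trans hc) (n := 3) (by norm_num)
  have h1 := (abs_le.1 h).2
  norm_num [Finset.sum_range_succ, Nat.factorial] at h1
  have h2 : |u| ^ 3 ≤ c * u ^ 2 := by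
    have : |u| ^ 3 = |u| * u ^ 2 := by rw [← sq_abs u]; ring
    rw [this]; exact mul_le_mul_of_nonneg_right hu (sq_nonneg u)
  have h3 : 0 ≤ c * u ^ 2 := mul_nonneg ((abs_nonneg u).trans hu) (sq_nonneg u)
  linarith

theorem quadratic_le_exp {u c : ℝ} (hu : |u| ≤ c) (hc : c ≤ 1) :
    1 + u + u ^ 2 / 2 * (1 - c) ≤ Real.exp u := by
  have h := Real.exp_bound (x := u) (hu.trans hc) (n := 3) (by norm_num)
  have h1 := (abs_le.1 h).1
  norm_num [Finset.sum_range_succ, Nat.factorial] at h1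
  have h2 : |u| ^ 3 ≤ c * u ^ 2 := by
    have : |u| ^ 3 = |u| * u ^ 2 := by rw [← sq_abs u]; ring
    rw [this]; exact mul_le_mul_of_nonneg_right hu (sq_nonneg u)
  have h3 : 0 ≤ c * u ^ 2 := mul_nonneg ((abs_nonneg u).trans hu) (sq_nonneg u)
  linarith

/-- Within `[-c, c]` this is Taylor's formula. To the right the full quadratic bound is stronger; to
the left of `-c` the tangent of `exp` at `-c` has slope at most one and hence lies above the line of
slope one through the same point. -/
theorem truncated_quadratic_le_exp {c : ℝ} (hc0 : 0 ≤ c) (hc : c ≤ 1) (u : ℝ) :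
    1 + u + (min |u| c) ^ 2 / 2 * (1 - c) ≤ Real.exp u := by
  rcases le_or_gt |u| c with hu | hu
  · rw [min_eq_left hu, sq_abs]; exact quadratic_le_exp hu hc
  · rw [min_eq_right hu.le]
    rcases le_or_gt 0 u with h0 | h0
    · rw [abs_of_nonneg h0] at hu
      have h1 := Real.quadratic_le_exp_of_nonneg h0
      have h2 : c ^ 2 ≤ u ^ 2 := by gcongr
      nlinarith [sq_nonneg c]
    · rw [abs_of_neg h0] at hu
      have h1 := quadratic_le_exp (u := -c) (c := c) (by rw [abs_neg, abs_of_nonneg hc0]) hc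
      have h2 : Real.exp u = Real.exp (-c) * Real.exp (u + c) := by rw [← Real.exp_add]; ring_nf
      have h3 := Real.add_one_le_exp (u + c)
      have h4 : Real.exp (-c) ≤ 1 := Real.exp_le_one_iff.2 (by linarith)
      have h5 := Real.exp_pos (-c)
      nlinarith [mul_le_mul_of_nonneg_left h3 h5.le]

/-- For `|y| ≤ 2b` the quadratic bound applies. Beyond that the excess of `|x|` over `b` is at least
`b`, so the moment term alone is at least `exp (lam * c)`, which dominates the whole remainder. -/
theorem exp_le_of_truncation {lam b c p x y : ℝ} (hlam : 0 < lam) (hb : 0 < b)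
    (hlb : 2 * lam * b ≤ 1) (hp : 0 ≤ p) (hyx : |y| ≤ |x|) (hyc : |y| ≤ c) :
    Real.exp (lam * y) ≤ 1 + lam * y + (lam ^ 2 / 2 * (1 + 2 * lam * b) * x ^ 2 +
      Real.exp (lam * c) / b ^ p * (max (|x| - b) 0) ^ p) := by
  have hb' : 0 < b ^ p := Real.rpow_pos_of_pos hb p
  have hlb0 : 0 < 2 * lam * b := by positivity
  have h0 : 0 ≤ Real.exp (lam * c) / b ^ p * (max (|x| - b) 0) ^ p :=
    mul_nonneg (by positivity) (Real.rpow_nonneg (le_max_right _ _) _)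
  rcases le_or_gt |y| (2 * b) with h | h
  · have h1 := exp_le_quadratic (u := lam * y) (c := 2 * lam * b)
      (by rw [abs_mul, abs_of_pos hlam]; nlinarith) hlb
    have h2 : y ^ 2 ≤ x ^ 2 := sq_le_sq.2 hyx
    have h3 : (lam * y) ^ 2 / 2 * (1 + 2 * lam * b) ≤ lam ^ 2 / 2 * (1 + 2 * lam * b) * x ^ 2 := by
      have : (lam * y) ^ 2 / 2 * (1 + 2 * lam * b) = lam ^ 2 / 2 * (1 + 2 * lam * b) * y ^ 2 := by
        ring
      rw [this]; gcongr
    linarith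
  · have h1 : b ≤ max (|x| - b) 0 := le_max_of_le_left (by linarith)
    have h2 : Real.exp (lam * c) ≤ Real.exp (lam * c) / b ^ p * (max (|x| - b) 0) ^ p := by
      rw [div_mul_eq_mul_div, le_div_iff₀ hb']
      gcongr
    have h3 : 0 ≤ lam ^ 2 / 2 * (1 + 2 * lam * b) * x ^ 2 := by positivity
    have h4 : Real.exp (lam * y) - 1 - lam * y ≤ Real.exp (lam * c) := by
      have hyc' : lam * |y| ≤ lam * c := by gcongr
      rcases le_or_gt 0 y with hy | hy
      · rw [abs_of_nonneg hy] at hyc'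
        have := Real.exp_le_exp.2 hyc'
        have : 0 ≤ lam * y := by positivity
        linarith
      · rw [abs_of_neg hy] at hyc'
        have h5 : Real.exp (lam * y) ≤ 1 := Real.exp_le_one_iff.2 (by nlinarith)
        have := Real.add_one_le_exp (lam * c)
        linarith
    linarith

/-- If `|x| > 2b`, then the excess `z = |x| - b` satisfies `z ≥ b` and `|x| ≤ 2z`, and `p ≥ 2` lets
`(z / b) ^ 2` be raised to `(z / b) ^ p`. -/
theorem sq_le_truncation {b p x : ℝ} (hb : 0 < b) (hp : 2 ≤ p) :
    x ^ 2 ≤ (min |x| (2 * b)) ^ 2 + 4 * b ^ 2 / b ^ p * (max (|x| - b) 0) ^ p := by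
  have hb' : 0 < b ^ p := Real.rpow_pos_of_pos hb p
  have h0 : 0 ≤ 4 * b ^ 2 / b ^ p * (max (|x| - b) 0) ^ p :=
    mul_nonneg (by positivity) (Real.rpow_nonneg (le_max_right _ _) _)
  rcases le_or_gt |x| (2 * b) with h | h
  · rw [min_eq_left h, sq_abs]; linarith
  · rw [max_eq_left (by linarith)]
    set z := |x| - b with hz
    have hzb : b ≤ z := by linarith
    have h1 : 4 * b ^ 2 / b ^ p * z ^ p = 4 * b ^ 2 * (z / b) ^ p := by
      rw [Real.div_rpow (by linarith) hb.le]; ring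
    have h2 : (z / b) ^ (2 : ℝ) ≤ (z / b) ^ p :=
      Real.rpow_le_rpow_of_exponent_le (by rwa [one_le_div hb]) hp
    rw [Real.rpow_two] at h2
    have h3 : 4 * z ^ 2 ≤ 4 * b ^ 2 * (z / b) ^ p := by
      calc 4 * z ^ 2 = 4 * b ^ 2 * (z / b) ^ 2 := by field_simp
        _ ≤ _ := by gcongr
    have h4 : x ^ 2 ≤ 4 * z ^ 2 := by
      rw [← sq_abs x]; nlinarith
    rw [h1]
    nlinarith [sq_nonneg (min |x| (2 * b))]

/-- It turns additive lower bounds into an exponential one, so that they can be multiplied. When `s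
< v` it rests on `log (1 + y) ≥ y / (1 + y) ≥ y - y ^ 2`; otherwise the second bound already
suffices. -/
theorem exp_le_of_two_bounds {e v s : ℝ} (hv : 0 ≤ v) (hs : 0 ≤ s)
    (h1 : 1 + v - s ≤ e) (h2 : Real.exp (-s) ≤ e) : Real.exp (v - v ^ 2 - 2 * s) ≤ e := by
  rcases le_or_gt v s with h | h
  · refine (Real.exp_le_exp.2 ?_).trans h2
    nlinarith
  · refine le_trans ?_ h1
    set y := v - s with hy
    have hy0 : 0 < y := by linarith
    have h3 : Real.exp (y - y ^ 2) ≤ 1 + y := by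
      rw [← Real.le_log_iff_exp_le (by linarith)]
      have := Real.one_sub_inv_le_log_of_pos (x := 1 + y) (by linarith)
      refine le_trans ?_ this
      have : 1 - (1 + y)⁻¹ = y / (1 + y) := by field_simp; ring
      rw [this, le_div_iff₀ (by linarith)]
      nlinarith [pow_pos hy0 3]
    have h4 : Real.exp (v - v ^ 2 - 2 * s) ≤ Real.exp (y - y ^ 2) :=
      Real.exp_le_exp.2 (by nlinarith)
    linarith

theorem rpow_le_mul_exp {p D : ℝ} (hp : 0 < p) (hD : 0 ≤ D) : D ^ p ≤ p ^ p * Real.exp D := by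
  have h1 : D / p ≤ Real.exp (D / p) := by linarith [Real.add_one_le_exp (D / p)]
  have h2 : (D / p) ^ p ≤ Real.exp (D / p) ^ p :=
    Real.rpow_le_rpow (by positivity) h1 hp.le
  rw [Real.div_rpow hD hp.le, ← Real.exp_mul, div_mul_cancel₀ _ hp.ne',
    div_le_iff₀ (Real.rpow_pos_of_pos hp p)] at h2
  linarith

/-- Truncation to `[-c, c]`. -/
noncomputable def clip (c x : ℝ) : ℝ := max (-c) (min x c)

theorem abs_clip {c : ℝ} (hc : 0 ≤ c) (x : ℝ) : |clip c x| = min |x| c := by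
  unfold clip
  rcases le_total x c with h | h
  · rw [min_eq_left h]
    rcases le_total (-c) x with h' | h'
    · rw [max_eq_right h', min_eq_left (abs_le.2 ⟨h', h⟩)]
    · rw [max_eq_left h', abs_neg, abs_of_nonneg hc, min_eq_right]
      rw [abs_of_nonpos (by linarith)]; linarith
  · rw [min_eq_right h, max_eq_right (by linarith), abs_of_nonneg hc, min_eq_right]
    rw [abs_of_nonneg (by linarith)]; linarith

theorem clip_eq_self {c x : ℝ} (h : |x| ≤ c) : clip c x = x := by
  rw [abs_le] at h
  rw [clip, min_eq_left h.2, max_eq_right h.1]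

theorem clip_lip (c a b : ℝ) : |clip c a - clip c b| ≤ 1 * |a - b| := by
  rw [one_mul]
  unfold clip
  refine (abs_max_sub_max_le_max _ _ _ _).trans (max_le (by simp) ?_)
  exact (abs_min_sub_min_le_max _ _ _ _).trans (max_le le_rfl (by simp))

/-- From `(z - 2c) ^ 2 ≥ 0`. The truncation bias is thereby controlled by the second moment alone.
-/
theorem abs_clip_sub_le {c : ℝ} (hc : 0 < c) (x : ℝ) : |clip c x - x| ≤ 1 / (4 * c) * x ^ 2 := by
  have key : ∀ z : ℝ, z - c ≤ 1 / (4 * c) * z ^ 2 := fun z => by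
    rw [div_mul_eq_mul_div, one_mul, le_div_iff₀ (by positivity)]
    nlinarith [sq_nonneg (z - 2 * c)]
  have h0 : 0 ≤ 1 / (4 * c) * x ^ 2 := by positivity
  have h1 := key x
  have h2 := key (-x)
  rw [neg_sq] at h2
  unfold clip
  rcases le_total x c with h | h
  · rw [min_eq_left h]
    rcases le_total (-c) x with h' | h'
    · rw [max_eq_right h']; simpa using h0
    · rw [max_eq_left h', abs_of_nonneg (by linarith)]; linarith
  · rw [min_eq_right h, max_eq_right (by linarith), abs_of_nonpos (by linarith)]; linarith

/-- Needed because `H` is closed only under such functions. The increment of a `p`-th power is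
bounded by its tangent slope, again via Bernoulli's inequality, and the slope by a natural power. -/
theorem cLLip_excess {p c : ℝ} (hp : 1 ≤ p) (hc : 0 ≤ c) :
    CLLip (fun x : ℝ => (max (|x| - c) 0) ^ p) := by
  have key : ∀ u v : ℝ, 0 ≤ v → v ≤ u → u ^ p - v ^ p ≤ p * u ^ (p - 1) * (u - v) := by
    intro u v hv huv
    rcases (hv.trans huv).eq_or_lt with h0 | h0
    · have : v = 0 := by linarith
      subst this; rw [← h0]; simp
    · have hB := one_add_mul_self_le_rpow_one_add (s := v / u - 1) (p := p)
        (by have := div_nonneg hv h0.le; linarith) hp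
      have h1 : 1 + (v / u - 1) = v / u := by ring
      rw [h1, Real.div_rpow hv h0.le, le_div_iff₀ (Real.rpow_pos_of_pos h0 p)] at hB
      have h4 : u ^ p = u ^ (p - 1) * u := by
        rw [← Real.rpow_add_one h0.ne']; ring_nf
      have h5 : (1 + p * (v / u - 1)) * u ^ p = u ^ p - p * u ^ (p - 1) * (u - v) := by
        rw [h4]; field_simp; ring
      linarith
  set m := ⌈p⌉₊
  have hm : p - 1 ≤ (m : ℝ) := by have := Nat.le_ceil p; linarith
  refine ⟨p, by linarith, m, fun x y => ?_⟩
  wlog h : max (|y| - c) 0 ≤ max (|x| - c) 0 generalizing x y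
  · have := this y x (le_of_not_ge h)
    rw [abs_sub_comm, norm_sub_rev, add_right_comm]; exact this
  set u := max (|x| - c) 0 with hu
  set v := max (|y| - c) 0 with hv
  have hv0 : 0 ≤ v := le_max_right _ _
  have hu0 : 0 ≤ u := le_max_right _ _
  rw [abs_of_nonneg (sub_nonneg.2 (Real.rpow_le_rpow hv0 h (by linarith)))]
  refine (key u v hv0 h).trans ?_
  have hux : u ≤ ‖x‖ := max_le (by rw [Real.norm_eq_abs]; linarith) (norm_nonneg x)
  have h1 : u ^ (p - 1) ≤ 1 + ‖x‖ ^ m + ‖y‖ ^ m := by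
    have h2 : 0 ≤ ‖y‖ ^ m := by positivity
    have h3 : 0 ≤ ‖x‖ ^ m := by positivity
    rcases le_or_gt u 1 with h' | h'
    · have := Real.rpow_le_one hu0 h' (by linarith : 0 ≤ p - 1)
      linarith
    · have h4 : u ^ (p - 1) ≤ u ^ (m : ℝ) := Real.rpow_le_rpow_of_exponent_le h'.le hm
      rw [Real.rpow_natCast] at h4
      have h5 : u ^ m ≤ ‖x‖ ^ m := by gcongr
      linarith
  have h2 : u - v ≤ ‖x - y‖ := by
    refine (le_abs_self _).trans ((abs_max_sub_max_le_max _ _ _ _).trans (max_le ?_ (by simp)))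
    rw [sub_sub_sub_cancel_right]
    exact abs_abs_sub_abs_le_abs_sub x y
  have h3 : 0 ≤ u - v := by linarith
  gcongr

theorem abs_sign_mul {σ : ℝ} (hσ : σ = 1 ∨ σ = -1) (x : ℝ) : |σ * x| = |x| := by
  rcases hσ with rfl | rfl <;> simp

theorem bl_sign_clip (σ : ℝ) {c : ℝ} (hc : 0 ≤ c) (j : ℕ) :
    BL j (j + 1) (fun x => σ * clip c (x j)) := by
  refine (BL.const σ).mul (BL.coord (ψ := clip c) (by simp) (clip_lip c) (M := c) fun a => ?_)
  rw [abs_clip hc]; exact min_le_right _ _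

/-! ### Exponential moments of a truncated variable. -/

namespace SublinearExpectationSpace

variable {Ω : Type*} [MeasurableSpace Ω] {S : SublinearExpectationSpace Ω}

theorem excess_mem {Z : Ω → ℝ} (hZ : Z ∈ S.H) {p c : ℝ} (hp : 1 ≤ p) (hc : 0 ≤ c) :
    (fun ω => (max (|Z ω| - c) 0) ^ p) ∈ S.H :=
  S.comp_mem_one hZ (cLLip_excess hp hc)

theorem excess_L1 {Z : Ω → ℝ} (hZ : Z ∈ S.H) {p c : ℝ} (hp : 1 ≤ p) (hc : 0 ≤ c)
    (hfin : S.excess Z p c ≠ ⊤) : S.L1 (fun ω => (max (|Z ω| - c) 0) ^ p) := by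
  refine L1.of_nonneg (excess_mem hZ hp hc) (fun ω => Real.rpow_nonneg (le_max_right _ _) _) ?_
  rw [excess, Ne, EReal.toENNReal_eq_top_iff] at hfin
  exact lt_top_iff_ne_top.2 hfin

theorem e_excess {Z : Ω → ℝ} (hZ : Z ∈ S.H) {p c : ℝ} (hp : 1 ≤ p) (hc : 0 ≤ c)
    (hfin : S.excess Z p c ≠ ⊤) :
    S.e (fun ω => (max (|Z ω| - c) 0) ^ p) = (S.excess Z p c).toReal := by
  have hL := excess_L1 hZ hp hc hfin
  rw [excess, ← hL.coe_e, EReal.real_coe_toENNReal, ENNReal.toReal_ofReal]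
  exact e_nonneg hL fun ω => Real.rpow_nonneg (le_max_right _ _) _

theorem excess_anti {Z : Ω → ℝ} (hZ : Z ∈ S.H) {p c c' : ℝ} (hp : 1 ≤ p) (hc : 0 ≤ c)
    (hcc : c ≤ c') : S.excess Z p c' ≤ S.excess Z p c := by
  refine EReal.toENNReal_le_toENNReal (S.mono _ (excess_mem hZ hp hc) _
    (excess_mem hZ hp (hc.trans hcc)) fun ω => ?_)
  refine Real.rpow_le_rpow (le_max_right _ _) ?_ (by linarith)
  exact max_le_max (by linarith) le_rfl

theorem L1_of_sq {Z : Ω → ℝ} (hZ : Z ∈ S.H) (hZ2 : S.L1 (fun ω => Z ω ^ 2)) : S.L1 Z := by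
  refine ((L1.const 1).add hZ2).of_le hZ fun ω => ?_
  rw [abs_of_nonneg (by positivity : (0 : ℝ) ≤ 1 + Z ω ^ 2), ← sq_abs]
  nlinarith [sq_nonneg (|Z ω| - 1), sq_nonneg (|Z ω|)]

/-- The size of the upper and lower means of `Z`. -/
noncomputable def meanAbs (S : SublinearExpectationSpace Ω) (Z : Ω → ℝ) : ℝ :=
  |S.e Z| + |S.e (fun ω => - Z ω)|

theorem meanAbs_nonneg (Z : Ω → ℝ) : 0 ≤ S.meanAbs Z := add_nonneg (abs_nonneg _) (abs_nonneg _)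

theorem clip_L1 {Z : Ω → ℝ} (hZ : Z ∈ S.H) {c : ℝ} (hc : 0 ≤ c) (σ : ℝ) :
    S.L1 (fun ω => σ * clip c (Z ω)) := by
  refine L1.smul ?_ σ
  refine L1.of_bound (M := c) (S.comp_mem_one hZ (φ := clip c)
    (CLLip.of_lipschitz (clip_lip c))) fun ω => ?_
  rw [abs_clip hc]; exact min_le_right _ _

theorem exp_clip_L1 {Z : Ω → ℝ} (hZ : Z ∈ S.H) {c : ℝ} (hc : 0 ≤ c) (σ : ℝ)
    (lam : ℝ) : S.L1 (fun ω => Real.exp (lam * (σ * clip c (Z ω)))) :=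
  bl_L1 (X := fun _ => Z) (F := fun x => Real.exp (lam * (σ * clip c (x 0)))) (fun _ => hZ)
    ((BL.const lam).mul (bl_sign_clip σ hc 0)).exp

/-- `meanAbs` contains both the upper and the lower mean, which is why one bound serves both signs.
-/
theorem e_clip_le {Z : Ω → ℝ} (hZ : Z ∈ S.H) (hZ2 : S.L1 (fun ω => Z ω ^ 2)) {c : ℝ}
    (hc : 0 < c) {σ : ℝ} (hσ : σ = 1 ∨ σ = -1) :
    S.e (fun ω => σ * clip c (Z ω)) ≤ S.meanAbs Z + 1 / (4 * c) * S.e (fun ω => Z ω ^ 2) := by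
  have hL := L1_of_sq hZ hZ2
  have h1 : S.e (fun ω => σ * clip c (Z ω)) ≤
      S.e (fun ω => σ * Z ω + 1 / (4 * c) * Z ω ^ 2) := by
    refine e_mono (clip_L1 hZ hc.le σ) ((hL.smul σ).add (hZ2.smul _)) fun ω => ?_
    have h2 := abs_clip_sub_le hc (Z ω)
    have h3 := le_abs_self (σ * (clip c (Z ω) - Z ω))
    rw [abs_sign_mul hσ] at h3
    linarith
  refine h1.trans ((e_add_le (hL.smul σ) (hZ2.smul _)).trans ?_)
  rw [e_smul hZ2 (by positivity)]
  gcongr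
  unfold meanAbs
  rcases hσ with rfl | rfl
  · simp only [one_mul]
    have := le_abs_self (S.e Z); have := abs_nonneg (S.e (fun ω => - Z ω)); linarith
  · simp only [neg_one_mul]
    have := le_abs_self (S.e (fun ω => - Z ω)); have := abs_nonneg (S.e Z); linarith

/-- Upper bound for the exponential moments of a truncated variable. -/
theorem e_exp_clip_le {Z : Ω → ℝ} (hZ : Z ∈ S.H) (hZ2 : S.L1 (fun ω => Z ω ^ 2)) {c : ℝ}
    (hc : 0 < c) {σ : ℝ} (hσ : σ = 1 ∨ σ = -1) {lam b p : ℝ} (hlam : 0 < lam) (hb : 0 < b)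
    (hlb : 2 * lam * b ≤ 1) (hp : 2 ≤ p) (hfin : S.excess Z p b ≠ ⊤) :
    S.e (fun ω => Real.exp (lam * (σ * clip c (Z ω)))) ≤
      Real.exp (lam * (S.meanAbs Z + 1 / (4 * c) * S.e (fun ω => Z ω ^ 2)) +
        (lam ^ 2 / 2 * (1 + 2 * lam * b) * S.e (fun ω => Z ω ^ 2) +
          Real.exp (lam * c) / b ^ p * (S.excess Z p b).toReal)) := by
  have hL := excess_L1 hZ (by linarith) hb.le hfin
  have hclip := clip_L1 hZ hc.le σ
  set A := lam ^ 2 / 2 * (1 + 2 * lam * b) with hA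
  set B := Real.exp (lam * c) / b ^ p with hB
  have hA0 : 0 ≤ A := by positivity
  have hB0 : 0 ≤ B := by positivity
  have h1 : S.e (fun ω => Real.exp (lam * (σ * clip c (Z ω)))) ≤
      S.e (fun ω => (1 + lam * (σ * clip c (Z ω))) +
        (A * Z ω ^ 2 + B * (max (|Z ω| - b) 0) ^ p)) := by
    refine e_mono (exp_clip_L1 hZ hc.le σ lam) (((L1.const 1).add (hclip.smul lam)).add
      ((hZ2.smul A).add (hL.smul B))) fun ω => ?_
    refine exp_le_of_truncation (x := Z ω) hlam hb hlb (by linarith) ?_ ?_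
    · rw [abs_sign_mul hσ, abs_clip hc.le]; exact min_le_left _ _
    · rw [abs_sign_mul hσ, abs_clip hc.le]; exact min_le_right _ _
  have h2 := e_add_le ((L1.const 1).add (hclip.smul lam)) ((hZ2.smul A).add (hL.smul B))
  have h3 := e_add_le (hZ2.smul A) (hL.smul B)
  rw [e_smul hZ2 hA0, e_smul hL hB0, e_excess hZ (by linarith) hb.le hfin] at h3
  rw [e_const_add (hclip.smul lam), e_smul hclip hlam.le] at h2
  have h4 := mul_le_mul_of_nonneg_left (e_clip_le hZ hZ2 hc hσ) hlam.le
  refine le_trans ?_ (Real.add_one_le_exp _)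
  linarith

/-- Lower bound for the exponential moments of a truncated variable. -/
theorem le_e_exp_clip {Z : Ω → ℝ} (hZ : Z ∈ S.H) (hZ2 : S.L1 (fun ω => Z ω ^ 2)) {c : ℝ}
    (hc : 0 < c) {σ : ℝ} (hσ : σ = 1 ∨ σ = -1) {lam b : ℝ} (hlam : 0 < lam) (hb : 0 < b)
    (hlb : 2 * lam * b ≤ 1) (hbc : 2 * b ≤ c) {w : ℝ}
    (hw : w = lam ^ 2 / 2 * (1 - 2 * lam * b) * S.e (fun ω => (min |Z ω| (2 * b)) ^ 2)) :
    Real.exp (w - w ^ 2 - 2 * (lam * (S.meanAbs Z + 1 / (4 * c) * S.e (fun ω => Z ω ^ 2)))) ≤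
      S.e (fun ω => Real.exp (lam * (σ * clip c (Z ω)))) := by
  have hclip := clip_L1 hZ hc.le σ
  have hexp := exp_clip_L1 hZ hc.le σ lam
  have hmin : S.L1 (fun ω => (min |Z ω| (2 * b)) ^ 2) := by
    refine hZ2.of_le ?_ fun ω => ?_
    · refine S.comp_mem_one (S.comp_mem_one hZ (φ := fun x => min |x| (2 * b))
        (CLLip.of_lipschitz (K := 1) fun x y => ?_)) cLLip_sq
      rw [one_mul]
      refine (abs_min_sub_min_le_max _ _ _ _).trans (max_le (abs_abs_sub_abs_le_abs_sub x y) ?_)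
      simp
    · have h0 : 0 ≤ min |Z ω| (2 * b) := le_min (abs_nonneg _) (by linarith)
      rw [abs_of_nonneg (sq_nonneg (min |Z ω| (2 * b))), abs_of_nonneg (sq_nonneg (Z ω)),
        ← sq_abs (Z ω)]
      exact pow_le_pow_left₀ h0 (min_le_left _ _) 2
  set A := lam ^ 2 / 2 * (1 - 2 * lam * b) with hA
  have hA0 : 0 ≤ A := mul_nonneg (by positivity) (by linarith)
  set μ := S.meanAbs Z + 1 / (4 * c) * S.e (fun ω => Z ω ^ 2) with hμ
  have hv0 : 0 ≤ S.e (fun ω => Z ω ^ 2) := e_nonneg hZ2 fun ω => sq_nonneg _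
  have hμ0 : 0 ≤ μ := add_nonneg (meanAbs_nonneg Z) (by positivity)
  have hneg : S.e (fun ω => - (σ * clip c (Z ω))) ≤ μ := by
    have := e_clip_le hZ hZ2 hc (σ := -σ) (by rcases hσ with rfl | rfl <;> simp)
    simpa only [neg_mul] using this
  -- Two bounds are combined: a second-order one, sharp when the bias is small, and a first-order
  -- one of Jensen type, valid whatever its size.
  refine exp_le_of_two_bounds ?_ (by positivity) ?_ ?_
  · rw [hw]; exact mul_nonneg hA0 (e_nonneg hmin fun ω => sq_nonneg _)
  · have h1 : S.e (fun ω => lam * (σ * clip c (Z ω)) + (1 + A * (min |Z ω| (2 * b)) ^ 2)) ≤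
        S.e (fun ω => Real.exp (lam * (σ * clip c (Z ω)))) := by
      refine e_mono ((hclip.smul lam).add ((L1.const 1).add (hmin.smul A))) hexp fun ω => ?_
      have h2 := truncated_quadratic_le_exp (c := 2 * lam * b) (by positivity) hlb
        (lam * (σ * clip c (Z ω)))
      have h3 : min |lam * (σ * clip c (Z ω))| (2 * lam * b) = lam * min |Z ω| (2 * b) := by
        rw [abs_mul, abs_of_pos hlam, abs_sign_mul hσ, abs_clip hc.le,
          show 2 * lam * b = lam * (2 * b) by ring, ← mul_min_of_nonneg _ _ hlam.le, min_assoc,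
          min_eq_right hbc]
      rw [h3] at h2
      refine le_trans (le_of_eq ?_) h2
      rw [hA]; ring
    have h2 := e_sub_le_e_add (hclip.smul lam) ((L1.const 1).add (hmin.smul A))
    rw [e_const_add (hmin.smul A), e_smul hmin hA0] at h2
    have h3 : S.e (fun ω => - (lam * (σ * clip c (Z ω)))) =
        lam * S.e (fun ω => - (σ * clip c (Z ω))) := by
      rw [← e_smul hclip.neg hlam.le]
      congr 1; ext ω; ring
    rw [h3] at h2
    have h4 := mul_le_mul_of_nonneg_left hneg hlam.le
    rw [hw]
    linarith
  · set q := lam * μ with hq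
    -- The tangent of `exp` at `-q` lies below the graph. The upper expectation of its linear part
    -- is at least `-q`, since the conjugate expectation does not exceed the expectation, so the
    -- factor left beside `exp (-q)` is at least one.
    have h1 : S.e (fun ω => Real.exp (-q) * ((1 + q) + lam * (σ * clip c (Z ω)))) ≤
        S.e (fun ω => Real.exp (lam * (σ * clip c (Z ω)))) := by
      refine e_mono (((L1.const (1 + q)).add (hclip.smul lam)).smul _) hexp fun ω => ?_
      have h2 := Real.add_one_le_exp (lam * (σ * clip c (Z ω)) + q)
      have h3 : Real.exp (lam * (σ * clip c (Z ω))) =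
          Real.exp (-q) * Real.exp (lam * (σ * clip c (Z ω)) + q) := by
        rw [← Real.exp_add]; ring_nf
      rw [h3]
      gcongr
      linarith
    rw [e_smul ((L1.const (1 + q)).add (hclip.smul lam)) (Real.exp_pos _).le,
      e_const_add (hclip.smul lam), e_smul hclip hlam.le] at h1
    refine le_trans ?_ h1
    refine le_mul_of_one_le_right (Real.exp_pos _).le ?_
    have h2 := neg_e_neg_le hclip
    have h3 : -(lam * μ) ≤ lam * S.e (fun ω => σ * clip c (Z ω)) := by nlinarith
    linarith

theorem e_sq_le_truncation {Z : Ω → ℝ} (hZ : Z ∈ S.H) (hZ2 : S.L1 (fun ω => Z ω ^ 2)) {b p : ℝ}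
    (hb : 0 < b) (hp : 2 ≤ p) (hfin : S.excess Z p b ≠ ⊤) :
    S.e (fun ω => Z ω ^ 2) ≤ S.e (fun ω => (min |Z ω| (2 * b)) ^ 2) +
      4 * b ^ 2 / b ^ p * (S.excess Z p b).toReal := by
  have hL := excess_L1 hZ (by linarith) hb.le hfin
  have hmin : S.L1 (fun ω => (min |Z ω| (2 * b)) ^ 2) := by
    refine L1.of_bound (M := (2 * b) ^ 2) ?_ fun ω => ?_
    · refine S.comp_mem_one (S.comp_mem_one hZ (φ := fun x => min |x| (2 * b))
        (CLLip.of_lipschitz (K := 1) fun x y => ?_)) cLLip_sq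
      rw [one_mul]
      refine (abs_min_sub_min_le_max _ _ _ _).trans (max_le (abs_abs_sub_abs_le_abs_sub x y) ?_)
      simp
    · have h0 : 0 ≤ min |Z ω| (2 * b) := le_min (abs_nonneg _) (by linarith)
      rw [abs_of_nonneg (by positivity)]
      gcongr
      exact min_le_right _ _
  rw [← e_excess hZ (by linarith) hb.le hfin, ← e_smul hL (by positivity)]
  refine le_trans ?_ (e_add_le hmin (hL.smul _))
  exact e_mono hZ2 (hmin.add (hL.smul _)) fun ω => sq_le_truncation hb hp

end SublinearExpectationSpace

/-! ### The norming sequences and the moment condition along blocks. -/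

namespace SublinearExpectationSpace

variable {Ω : Type*} [MeasurableSpace Ω] {S : SublinearExpectationSpace Ω} {X : ℕ → Ω → ℝ}

/-- The iterated logarithm `log log s_n²`. -/
noncomputable def loglog (S : SublinearExpectationSpace Ω) (X : ℕ → Ω → ℝ) (n : ℕ) : ℝ :=
  pLog (pLog (S.sq X n))

theorem one_le_loglog (n : ℕ) : 1 ≤ S.loglog X n := one_le_pLog _

theorem t_sq (n : ℕ) : S.t X n ^ 2 = 2 * S.loglog X n := by
  rw [t, Real.sq_sqrt]; · rfl
  exact mul_nonneg zero_le_two (pLog_pos _).le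

theorem one_le_t (n : ℕ) : 1 ≤ S.t X n := by
  rw [t, Real.one_le_sqrt]
  have := one_le_pLog (pLog (S.sq X n))
  linarith

theorem t_pos (n : ℕ) : 0 < S.t X n := zero_lt_one.trans_le (one_le_t n)

theorem sqMoment_nonneg (h2 : ∀ n, S.L1 (fun ω => X n ω ^ 2)) (n : ℕ) :
    0 ≤ S.e (fun ω => X n ω ^ 2) :=
  e_nonneg (h2 n) fun _ => sq_nonneg _

theorem sq_mono' (h2 : ∀ n, S.L1 (fun ω => X n ω ^ 2)) : Monotone (S.sq X) :=
  monotone_nat_of_le_succ fun n => by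
    rw [sq, sq, Finset.sum_range_succ _ (n + 1)]
    have := sqMoment_nonneg h2 (n + 1)
    rw [e] at this
    linarith

theorem sq_nonneg' (h2 : ∀ n, S.L1 (fun ω => X n ω ^ 2)) (n : ℕ) : 0 ≤ S.sq X n :=
  Finset.sum_nonneg fun k _ => sqMoment_nonneg h2 k

theorem s_sq (h2 : ∀ n, S.L1 (fun ω => X n ω ^ 2)) (n : ℕ) : S.s X n ^ 2 = S.sq X n :=
  Real.sq_sqrt (sq_nonneg' h2 n)

theorem s_nonneg (n : ℕ) : 0 ≤ S.s X n := Real.sqrt_nonneg _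

theorem s_mono (h2 : ∀ n, S.L1 (fun ω => X n ω ^ 2)) : Monotone (S.s X) :=
  fun _ _ h => Real.sqrt_le_sqrt (sq_mono' h2 h)

theorem s_pos {n : ℕ} (h : 0 < S.sq X n) : 0 < S.s X n := Real.sqrt_pos.2 h

theorem loglog_mono (h2 : ∀ n, S.L1 (fun ω => X n ω ^ 2)) : Monotone (S.loglog X) :=
  fun _ _ h => pLog_mono (pLog_mono (sq_mono' h2 h))

theorem t_mono (h2 : ∀ n, S.L1 (fun ω => X n ω ^ 2)) : Monotone (S.t X) :=
  fun _ _ h => Real.sqrt_le_sqrt (mul_le_mul_of_nonneg_left (loglog_mono h2 h) zero_le_two)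

theorem a_pos {n : ℕ} (h : 0 < S.sq X n) : 0 < S.a X n := mul_pos (s_pos h) (t_pos n)

theorem a_nonneg (n : ℕ) : 0 ≤ S.a X n := mul_nonneg (s_nonneg n) (t_pos n).le

theorem a_mono (h2 : ∀ n, S.L1 (fun ω => X n ω ^ 2)) : Monotone (S.a X) :=
  fun n _ h => mul_le_mul (s_mono h2 h) (t_mono h2 h) (t_pos n).le (s_nonneg _)

theorem a_sq (h2 : ∀ n, S.L1 (fun ω => X n ω ^ 2)) (n : ℕ) :
    S.a X n ^ 2 = S.sq X n * (2 * S.loglog X n) := by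
  rw [a, mul_pow, s_sq h2, t_sq]

theorem loglog_le_mul {θ : ℝ} (hθ : 1 ≤ θ) {n N : ℕ} (h : S.sq X N ≤ θ * S.sq X n) :
    S.loglog X N ≤ θ * S.loglog X n :=
  (pLog_mono (pLog_mono h)).trans (pLog_pLog_mul_le hθ _)

theorem a_le_mul (h2 : ∀ n, S.L1 (fun ω => X n ω ^ 2)) {θ : ℝ} (hθ : 1 ≤ θ) {n N : ℕ}
    (h : S.sq X N ≤ θ * S.sq X n) : S.a X N ≤ θ * S.a X n := by
  refine le_of_sq_le_sq ?_ (mul_nonneg (by linarith) (a_nonneg n))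
  rw [mul_pow, a_sq h2, a_sq h2]
  have h1 := mul_le_mul h (loglog_le_mul hθ h) (zero_le_one.trans (one_le_loglog N))
    (mul_nonneg (by linarith) (sq_nonneg' h2 n))
  linarith

/-- Multiplying `s²` by a factor at least one multiplies the iterated logarithm by at most that
factor. So the truncation levels `α s / t` increase, and the excess moments of a fixed variable
decrease, with the index. -/
theorem s_div_t_le (h2 : ∀ n, S.L1 (fun ω => X n ω ^ 2)) {n N : ℕ} (hn : 0 < S.sq X n)
    (h : n ≤ N) : S.s X n / S.t X n ≤ S.s X N / S.t X N := by
  have hN : 0 < S.sq X N := hn.trans_le (sq_mono' h2 h)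
  have hθ : 1 ≤ S.sq X N / S.sq X n := by rw [one_le_div hn]; exact sq_mono' h2 h
  have h1 : S.loglog X N ≤ S.sq X N / S.sq X n * S.loglog X n :=
    loglog_le_mul hθ (by rw [div_mul_cancel₀ _ hn.ne'])
  refine le_of_sq_le_sq ?_ (div_nonneg (s_nonneg N) (t_pos N).le)
  rw [div_pow, div_pow, s_sq h2, s_sq h2, t_sq, t_sq]
  have hl := one_le_loglog (S := S) (X := X) n
  have hL := one_le_loglog (S := S) (X := X) N
  rw [div_le_div_iff₀ (by linarith) (by linarith)]
  rw [div_mul_eq_mul_div, le_div_iff₀ hn] at h1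
  linarith

theorem pLog_le_exp_loglog (n : ℕ) : pLog (S.sq X n) ≤ Real.exp (S.loglog X n) := le_exp_pLog _

theorem exp_loglog {n : ℕ} (h : Real.exp (Real.exp 1) ≤ S.sq X n) :
    Real.exp (S.loglog X n) = pLog (S.sq X n) := by
  refine exp_pLog_of_le ?_
  rw [pLog, Real.le_log_iff_exp_le (lt_max_of_lt_left (Real.exp_pos 1))]
  exact h.trans (le_max_right _ _)

theorem tendsto_sq (h2 : ∀ n, S.L1 (fun ω => X n ω ^ 2))
    (hdiv : ∀ δ : ℝ, 0 < δ →
      ¬ Summable (fun n => (S.sq X n)⁻¹ * pLog (S.sq X n) ^ (δ - 1) *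
        (S.E (fun ω => X n ω ^ 2)).toReal)) : Tendsto (S.sq X) atTop atTop := by
  refine (tendsto_atTop_of_monotone (sq_mono' h2)).resolve_right fun ⟨l, hl⟩ => ?_
  have hv := sqMoment_nonneg h2
  have hle : ∀ n, S.sq X n ≤ l := fun n => (sq_mono' h2).ge_of_tendsto hl n
  have hs : Summable fun n => S.e (fun ω => X n ω ^ 2) := by
    refine summable_of_sum_range_le (c := l) hv fun n => ?_
    refine le_trans ?_ (hle n)
    rw [sq, Finset.sum_range_succ]
    exact le_add_of_nonneg_right (hv n)
  -- With exponent `δ - 1 = 0` and bounded `sq`, the series of condition 3 would reduce to a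
  -- constant multiple of a convergent series of variances.
  refine hdiv 1 one_pos ?_
  simp only [sub_self, Real.rpow_zero, mul_one]
  by_cases h0 : ∃ n0, 0 < S.sq X n0
  · obtain ⟨n0, hn0⟩ := h0
    rw [← summable_nat_add_iff n0]
    refine Summable.of_nonneg_of_le (fun n => mul_nonneg (inv_nonneg.2 (sq_nonneg' h2 _)) (hv _))
      (fun n => ?_) (((summable_nat_add_iff n0).2 hs).mul_left (S.sq X n0)⁻¹)
    refine mul_le_mul_of_nonneg_right ?_ (hv _)
    exact inv_anti₀ hn0 (sq_mono' h2 (by omega))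
  · push Not at h0
    have : ∀ n, S.sq X n = 0 := fun n => le_antisymm (h0 n) (sq_nonneg' h2 n)
    simp [this, summable_zero]

theorem tendsto_t (hq : Tendsto (S.sq X) atTop atTop) : Tendsto (S.t X) atTop atTop :=
  Real.tendsto_sqrt_atTop.comp
    ((tendsto_pLog.comp (tendsto_pLog.comp hq)).const_mul_atTop two_pos)

theorem tendsto_a (hq : Tendsto (S.sq X) atTop atTop) : Tendsto (S.a X) atTop atTop :=
  (Real.tendsto_sqrt_atTop.comp hq).atTop_mul_atTop₀ (tendsto_t hq)

/-- The real-valued version of `Lam`, for the indices from `j0` on. -/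
noncomputable def lamFrom (S : SublinearExpectationSpace Ω) (X : ℕ → Ω → ℝ) (p α : ℝ)
    (j0 N : ℕ) : ℝ :=
  ∑ j ∈ Finset.Ico j0 (N + 1), (S.excess (X j) p (α * S.s X N / S.t X N)).toReal

/-- The normalized moments `Λ_N / a_N^p`, for the indices from `j0` on. -/
noncomputable def rho (S : SublinearExpectationSpace Ω) (X : ℕ → Ω → ℝ) (p α : ℝ)
    (j0 N : ℕ) : ℝ :=
  S.lamFrom X p α j0 N / S.a X N ^ p

theorem lamFrom_nonneg (p α : ℝ) (j0 N : ℕ) : 0 ≤ S.lamFrom X p α j0 N :=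
  Finset.sum_nonneg fun _ _ => ENNReal.toReal_nonneg

theorem rho_nonneg (p α : ℝ) (j0 N : ℕ) : 0 ≤ S.rho X p α j0 N :=
  div_nonneg (lamFrom_nonneg p α j0 N) (Real.rpow_nonneg (a_nonneg N) p)

/-- As `Γ ≤ Λ`, an infinite `Γ` makes both factors of the term infinite (or the second one equal to
one if `d = 0`), so no `⊤ * 0` can hide it. -/
theorem gam_ne_top {p α d : ℝ} (hd : 0 ≤ d)
    (hsum : ∑' n : {n : ℕ // 0 < S.a X n},
        S.Gam X p α n / ENNReal.ofReal (S.a X n ^ p) *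
          (S.Lam X p α n / ENNReal.ofReal (S.a X n ^ p)) ^ d < ⊤) {n : ℕ} (hn : 0 < S.a X n) :
    S.Gam X p α n ≠ ⊤ := by
  intro htop
  have h1 := (ENNReal.ne_top_of_tsum_ne_top hsum.ne ⟨n, hn⟩)
  have hL : S.Lam X p α n = ⊤ := by
    refine top_le_iff.1 ?_
    rw [← htop]
    exact Finset.single_le_sum (f := fun j => S.excess (X j) p (α * S.s X n / S.t X n))
      (fun _ _ => zero_le) (Finset.self_mem_range_succ n)
  apply h1
  simp only [htop, hL, ENNReal.top_div_of_ne_top ENNReal.ofReal_ne_top]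
  rcases hd.eq_or_lt with h | h
  · simp [← h]
  · simp [ENNReal.top_rpow_of_pos h]

theorem excess_ne_top (hX : ∀ n, X n ∈ S.H) (h2 : ∀ n, S.L1 (fun ω => X n ω ^ 2)) {p α d : ℝ}
    (hp : 1 ≤ p) (hα : 0 ≤ α) (hd : 0 ≤ d)
    (hsum : ∑' n : {n : ℕ // 0 < S.a X n},
        S.Gam X p α n / ENNReal.ofReal (S.a X n ^ p) *
          (S.Lam X p α n / ENNReal.ofReal (S.a X n ^ p)) ^ d < ⊤) {j0 j N : ℕ}
    (hj0 : 0 < S.sq X j0) (hj : j0 ≤ j) (hN : j ≤ N) :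
    S.excess (X j) p (α * S.s X N / S.t X N) ≠ ⊤ := by
  have hjpos : 0 < S.sq X j := hj0.trans_le (sq_mono' h2 hj)
  have h1 := gam_ne_top hd hsum (a_pos hjpos)
  refine ne_top_of_le_ne_top h1 (excess_anti (hX j) hp ?_ ?_)
  · exact div_nonneg (mul_nonneg hα (s_nonneg j)) (t_pos j).le
  · rw [mul_div_assoc, mul_div_assoc]
    exact mul_le_mul_of_nonneg_left (s_div_t_le h2 hjpos hN) hα

theorem summable_gam (h2 : ∀ n, S.L1 (fun ω => X n ω ^ 2)) {p α d : ℝ} (hd : 0 ≤ d)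
    (hsum : ∑' n : {n : ℕ // 0 < S.a X n},
        S.Gam X p α n / ENNReal.ofReal (S.a X n ^ p) *
          (S.Lam X p α n / ENNReal.ofReal (S.a X n ^ p)) ^ d < ⊤) {j0 : ℕ}
    (hj0 : 0 < S.sq X j0) :
    Summable fun n => if j0 ≤ n then (S.Gam X p α n).toReal / S.a X n ^ p *
      (S.rho X p α j0 n) ^ d else 0 := by
  set F : ℕ → ℝ≥0∞ := fun n => S.Gam X p α n / ENNReal.ofReal (S.a X n ^ p) *
          (S.Lam X p α n / ENNReal.ofReal (S.a X n ^ p)) ^ d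
  set f : ℕ → ℝ := fun n => if j0 ≤ n then (S.Gam X p α n).toReal / S.a X n ^ p *
      (S.rho X p α j0 n) ^ d else 0
  have hf0 : ∀ n, 0 ≤ f n := fun n => by
    simp only [f]
    split_ifs
    · exact mul_nonneg (div_nonneg ENNReal.toReal_nonneg (Real.rpow_nonneg (a_nonneg n) p))
        (Real.rpow_nonneg (rho_nonneg p α j0 n) d)
    · exact le_rfl
  have hle : ∀ n, ENNReal.ofReal (f n) ≤ {n | 0 < S.a X n}.indicator F n := by
    intro n
    simp only [f]
    split_ifs with h
    · have ha : 0 < S.a X n := a_pos (hj0.trans_le (sq_mono' h2 h))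
      have hap : 0 < S.a X n ^ p := Real.rpow_pos_of_pos ha p
      rw [Set.indicator_of_mem (show n ∈ {n | 0 < S.a X n} from ha),
        ENNReal.ofReal_mul (div_nonneg ENNReal.toReal_nonneg hap.le),
        ← ENNReal.ofReal_rpow_of_nonneg (rho_nonneg p α j0 n) hd, rho,
        ENNReal.ofReal_div_of_pos hap, ENNReal.ofReal_div_of_pos hap]
      have h3 : ENNReal.ofReal (S.lamFrom X p α j0 n) ≤ S.Lam X p α n := by
        rw [lamFrom, ENNReal.ofReal_sum_of_nonneg fun _ _ => ENNReal.toReal_nonneg]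
        refine (Finset.sum_le_sum fun j _ => ENNReal.ofReal_toReal_le).trans ?_
        rw [Lam, Finset.range_eq_Ico]
        exact Finset.sum_le_sum_of_subset (Finset.Ico_subset_Ico_left (Nat.zero_le _))
      simp only [F]
      gcongr
      exact ENNReal.ofReal_toReal_le
    · simp
  have hfin : ∑' n, ENNReal.ofReal (f n) ≠ ⊤ := by
    refine ((ENNReal.tsum_le_tsum hle).trans_lt ?_).ne
    rw [← tsum_subtype]
    exact hsum
  have := ENNReal.summable_toReal hfin
  simpa only [ENNReal.toReal_ofReal (hf0 _)] using this

/-- The level at the final index exceeds the level at each earlier `j`, so `rpow_add_one_sum_le`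
bounds `lamFrom ^ (d + 1)` by `(d + 1) ∑ Γ j * lamFrom j ^ d`. Weighted by `a ^ (-p (d + 1))` this
is the series of condition 2, summed over blocks. The auxiliary `b` is a proxy for `a` that grows
geometrically at every step. -/
theorem summable_rho (hX : ∀ n, X n ∈ S.H) (h2 : ∀ n, S.L1 (fun ω => X n ω ^ 2)) {p α d : ℝ}
    (hp : 1 ≤ p) (hα : 0 ≤ α) (hd : 0 ≤ d)
    (hsum : ∑' n : {n : ℕ // 0 < S.a X n},
        S.Gam X p α n / ENNReal.ofReal (S.a X n ^ p) *
          (S.Lam X p α n / ENNReal.ofReal (S.a X n ^ p)) ^ d < ⊤) {j0 : ℕ}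
    (hj0 : 0 < S.sq X j0) {n : ℕ → ℕ} (hn : Monotone n) (hnj : ∀ i, j0 ≤ n i) {b : ℕ → ℝ}
    (hb0 : ∀ i, 0 < b i) {r C : ℝ} (hr : 1 < r) (hC : 0 ≤ C) (hrb : ∀ i, r * b i ≤ b (i + 1))
    (hba : ∀ i, b i ≤ S.a X (n i))
    (hab : ∀ i j, n i < j → j ≤ n (i + 1) → S.a X j ≤ C * b (i + 1)) :
    Summable fun i => S.rho X p α j0 (n i) ^ (d + 1) := by
  have hpos : ∀ j, j0 ≤ j → 0 < S.a X j := fun j hj => a_pos (hj0.trans_le (sq_mono' h2 hj))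
  have hsg := summable_gam h2 hd hsum hj0
  set K : ℕ → ℝ := fun j =>
    if j0 ≤ j then (S.Gam X p α j).toReal * S.lamFrom X p α j0 j ^ d else 0 with hK
  set q := p * (d + 1) with hq
  have hq0 : 0 < q := by positivity
  set w : ℕ → ℝ := fun j => (S.a X j ^ q)⁻¹ with hw
  have hK0 : ∀ j, 0 ≤ K j := fun j => by
    simp only [hK]; split_ifs
    · exact mul_nonneg ENNReal.toReal_nonneg (Real.rpow_nonneg (lamFrom_nonneg p α j0 j) d)
    · exact le_rfl
  have hw0 : ∀ j, 0 ≤ w j := fun j => inv_nonneg.2 (Real.rpow_nonneg (a_nonneg j) q)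
  have hKw : Summable fun j => K j * w j := by
    convert hsg using 2 with j
    simp only [hK, hw]
    split_ifs with h
    · have ha := hpos j h
      rw [rho, Real.div_rpow (lamFrom_nonneg p α j0 j) (Real.rpow_nonneg ha.le p), hq, mul_add,
        mul_one, Real.rpow_add ha, Real.rpow_mul ha.le]
      ring
    · simp
  have hmain := summable_weighted_blocks hK0 hw0 hKw hn (c := fun i => (b i ^ q)⁻¹)
    (fun i => inv_nonneg.2 (Real.rpow_nonneg (hb0 i).le q)) (r := (r ^ q)⁻¹) (C := C ^ q)
    (inv_nonneg.2 (Real.rpow_nonneg (by linarith) q))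
    (inv_lt_one_of_one_lt₀ (Real.one_lt_rpow hr hq0)) (Real.rpow_nonneg hC q)
    (fun i => by
      rw [← mul_inv, ← Real.mul_rpow (by linarith) (hb0 i).le]
      have h1 : 0 < r * b i := mul_pos (by linarith) (hb0 i)
      exact inv_anti₀ (Real.rpow_pos_of_pos h1 q) (Real.rpow_le_rpow h1.le (hrb i) hq0.le))
    (fun i j h h' => by
      have ha := hpos j ((hnj i).trans h.le)
      simp only [hw]
      rw [← div_eq_mul_inv, le_div_iff₀ (Real.rpow_pos_of_pos ha q), inv_mul_le_iff₀
        (Real.rpow_pos_of_pos (hb0 _) q), mul_comm, ← Real.mul_rpow hC (hb0 _).le]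
      exact Real.rpow_le_rpow ha.le (hab i j h h') hq0.le)
  refine Summable.of_nonneg_of_le (fun i => Real.rpow_nonneg (rho_nonneg p α j0 _) _) (fun i => ?_)
    (hmain.mul_left (d + 1))
  have ha := hpos (n i) (hnj i)
  have haq : 0 < S.a X (n i) ^ q := Real.rpow_pos_of_pos ha q
  rw [rho, Real.div_rpow (lamFrom_nonneg p α j0 _) (Real.rpow_nonneg ha.le p), ← Real.rpow_mul ha.le,
    ← hq]
  have h1 : S.lamFrom X p α j0 (n i) ^ (d + 1) ≤
      (d + 1) * ∑ j ∈ Finset.range (n i + 1), K j := by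
    have h3 := rpow_add_one_sum_le
      (g := fun j => (S.excess (X j) p (α * S.s X (n i) / S.t X (n i))).toReal)
      (fun j => ENNReal.toReal_nonneg) hd j0 (n i + 1)
    rw [lamFrom]
    refine h3.trans (mul_le_mul_of_nonneg_left ?_ (by linarith))
    rw [Finset.range_eq_Ico]
    refine le_trans ?_ (Finset.sum_le_sum_of_subset_of_nonneg
      (Finset.Ico_subset_Ico_left (Nat.zero_le j0)) fun j _ _ => hK0 j)
    refine Finset.sum_le_sum fun j hj => ?_
    have hj := Finset.mem_Ico.1 hj
    have hanti : ∀ l, j0 ≤ l → l ≤ j →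
        (S.excess (X l) p (α * S.s X (n i) / S.t X (n i))).toReal ≤
          (S.excess (X l) p (α * S.s X j / S.t X j)).toReal := fun l hl hlj => by
      have hjp : 0 < S.sq X j := hj0.trans_le (sq_mono' h2 hj.1)
      refine ENNReal.toReal_mono (excess_ne_top hX h2 hp hα hd hsum hj0 hl hlj)
        (excess_anti (hX l) hp (div_nonneg (mul_nonneg hα (s_nonneg j)) (t_pos j).le) ?_)
      rw [mul_div_assoc, mul_div_assoc]
      exact mul_le_mul_of_nonneg_left (s_div_t_le h2 hjp (by omega)) hα
    simp only [hK, if_pos hj.1]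
    have h4 : ∑ l ∈ Finset.Ico j0 (j + 1),
        (S.excess (X l) p (α * S.s X (n i) / S.t X (n i))).toReal ≤ S.lamFrom X p α j0 j :=
      Finset.sum_le_sum fun l hl => by
        have hl := Finset.mem_Ico.1 hl
        exact hanti l hl.1 (by omega)
    refine mul_le_mul (hanti j hj.1 le_rfl) ?_ (Real.rpow_nonneg
      (Finset.sum_nonneg fun _ _ => ENNReal.toReal_nonneg) d) ENNReal.toReal_nonneg
    exact Real.rpow_le_rpow (Finset.sum_nonneg fun _ _ => ENNReal.toReal_nonneg) h4 hd
  have h5 : (S.a X (n i) ^ q)⁻¹ ≤ (b i ^ q)⁻¹ :=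
    inv_anti₀ (Real.rpow_pos_of_pos (hb0 i) q) (Real.rpow_le_rpow (hb0 i).le (hba i) hq0.le)
  have hS0 : 0 ≤ ∑ j ∈ Finset.range (n i + 1), K j := Finset.sum_nonneg fun j _ => hK0 j
  calc S.lamFrom X p α j0 (n i) ^ (d + 1) / S.a X (n i) ^ q
      ≤ (d + 1) * (∑ j ∈ Finset.range (n i + 1), K j) * (S.a X (n i) ^ q)⁻¹ := by
        rw [div_eq_mul_inv]; gcongr
    _ ≤ (d + 1) * (∑ j ∈ Finset.range (n i + 1), K j) * (b i ^ q)⁻¹ := by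
        gcongr
    _ = _ := by ring

end SublinearExpectationSpace

namespace SublinearExpectationSpace

variable {Ω : Type*} [MeasurableSpace Ω] {S : SublinearExpectationSpace Ω} {X : ℕ → Ω → ℝ}

theorem sqrt_mul_s_le (h2 : ∀ n, S.L1 (fun ω => X n ω ^ 2)) {θ : ℝ} (hθ : 0 ≤ θ) {n N : ℕ}
    (h : θ * S.sq X n ≤ S.sq X N) : √θ * S.s X n ≤ S.s X N := by
  refine le_of_sq_le_sq ?_ (s_nonneg N)
  rwa [mul_pow, Real.sq_sqrt hθ, s_sq h2, s_sq h2]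

theorem s_le_sqrt_mul (h2 : ∀ n, S.L1 (fun ω => X n ω ^ 2)) {θ : ℝ} (hθ : 0 ≤ θ) {n N : ℕ}
    (h : S.sq X N ≤ θ * S.sq X n) : S.s X N ≤ √θ * S.s X n := by
  refine le_of_sq_le_sq ?_ (mul_nonneg (Real.sqrt_nonneg θ) (s_nonneg n))
  rwa [mul_pow, Real.sq_sqrt hθ, s_sq h2, s_sq h2]

theorem summable_rho_chain (hX : ∀ n, X n ∈ S.H) (h2 : ∀ n, S.L1 (fun ω => X n ω ^ 2))
    {p α d : ℝ} (hp : 1 ≤ p) (hα : 0 ≤ α) (hd : 0 ≤ d)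
    (hsum : ∑' n : {n : ℕ // 0 < S.a X n},
        S.Gam X p α n / ENNReal.ofReal (S.a X n ^ p) *
          (S.Lam X p α n / ENNReal.ofReal (S.a X n ^ p)) ^ d < ⊤) {j0 : ℕ}
    (hj0 : 0 < S.sq X j0) {θ : ℝ} (hθ : 1 < θ) {m : ℕ → ℕ} (hm : GeomChain (S.sq X) θ m)
    (hm0 : j0 ≤ m 0) : Summable fun i => S.rho X p α j0 (m i) ^ (d + 1) := by
  refine summable_rho hX h2 hp hα hd hsum hj0 hm.strictMono.monotone
    (fun i => hm0.trans (hm.strictMono.monotone (Nat.zero_le i))) (b := fun i => S.a X (m i))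
    (fun i => a_pos (hm.pos i)) (r := √θ) (C := 1) (Real.lt_sqrt_of_sq_lt (by linarith)) zero_le_one
    (fun i => ?_) (fun i => le_rfl) (fun i j _ h => ?_)
  · rw [a, a, ← mul_assoc]
    exact mul_le_mul (sqrt_mul_s_le h2 (by linarith) (hm.growth i))
      (t_mono h2 (hm.strictMono.monotone (Nat.le_succ i))) (t_pos _).le (s_nonneg _)
  · rw [one_mul]; exact a_mono h2 h

/-- At the block ends `m (i + 1) - 1` the numbers `a` need not grow by a fixed factor, since one end
may barely exceed the last. The proxy `s (m i) * t (m (i + 1) - 1)` does, and the bound inside a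
block compares it with `a`. -/
theorem summable_rho_pred (hX : ∀ n, X n ∈ S.H) (h2 : ∀ n, S.L1 (fun ω => X n ω ^ 2))
    {p α d : ℝ} (hp : 1 ≤ p) (hα : 0 ≤ α) (hd : 0 ≤ d)
    (hsum : ∑' n : {n : ℕ // 0 < S.a X n},
        S.Gam X p α n / ENNReal.ofReal (S.a X n ^ p) *
          (S.Lam X p α n / ENNReal.ofReal (S.a X n ^ p)) ^ d < ⊤) {j0 : ℕ}
    (hj0 : 0 < S.sq X j0) {θ : ℝ} (hθ : 1 < θ) {m : ℕ → ℕ} (hm : GeomChain (S.sq X) θ m)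
    (hm0 : j0 ≤ m 0) : Summable fun i => S.rho X p α j0 (m (i + 1) - 1) ^ (d + 1) := by
  have hlt : ∀ i, m i < m (i + 1) := fun i => hm.strictMono (Nat.lt_succ_self i)
  have hmono : Monotone fun i => m (i + 1) - 1 := fun i k h =>
    Nat.sub_le_sub_right (hm.strictMono.monotone (by omega)) 1
  refine summable_rho hX h2 hp hα hd hsum hj0 hmono
    (fun i => hm0.trans ((hm.strictMono.monotone (Nat.zero_le i)).trans (by have := hlt i; omega)))
    (b := fun i => S.s X (m i) * S.t X (m (i + 1) - 1))
    (fun i => mul_pos (s_pos (hm.pos i)) (t_pos _)) (r := √θ) (C := √θ)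
    (Real.lt_sqrt_of_sq_lt (by linarith)) (Real.sqrt_nonneg θ)
    (fun i => ?_) (fun i => ?_) (fun i j hj h => ?_)
  · rw [← mul_assoc]
    exact mul_le_mul (sqrt_mul_s_le h2 (by linarith) (hm.growth i))
      (t_mono h2 (hmono (Nat.le_succ i))) (t_pos _).le (s_nonneg _)
  · rw [a]
    exact mul_le_mul_of_nonneg_right (s_mono h2 (by have := hlt i; omega)) (t_pos _).le
  · rw [a, ← mul_assoc]
    have := hlt i
    have := hlt (i + 1)
    exact mul_le_mul (s_le_sqrt_mul h2 (by linarith) (hm.block (i + 1) j (by omega) (by omega)))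
      (t_mono h2 h) (t_pos _).le (mul_nonneg (Real.sqrt_nonneg θ) (s_nonneg _))

/-- Along the chain `log s²` is at least linear in `i`, so the terms are dominated by `i ^ (-(1 +
ε))`. -/
theorem summable_exp_loglog (h2 : ∀ n, S.L1 (fun ω => X n ω ^ 2)) {θ : ℝ} (hθ : 1 < θ)
    {m : ℕ → ℕ} (hm : GeomChain (S.sq X) θ m) (hm1 : 1 ≤ S.sq X (m 0)) {n : ℕ → ℕ}
    (hn : ∀ i, m i ≤ n i) {ε : ℝ} (hε : 0 < ε) :
    Summable fun i => Real.exp (-(1 + ε) * S.loglog X (n i)) := by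
  have hlog : 0 < Real.log θ := Real.log_pos hθ
  -- The comparison series is singular at `i = 0`.
  rw [← summable_nat_add_iff 1]
  have hs : Summable fun i : ℕ => (Real.log θ) ^ (-(1 + ε)) * ((i + 1 : ℕ) : ℝ) ^ (-(1 + ε)) :=
    ((summable_nat_add_iff 1).2 (Real.summable_nat_rpow.2 (by linarith))).mul_left _
  refine Summable.of_nonneg_of_le (fun i => (Real.exp_pos _).le) (fun i => ?_) hs
  rw [← Real.mul_rpow hlog.le (Nat.cast_nonneg _), mul_comm (-(1 + ε)), Real.exp_mul]
  refine Real.rpow_le_rpow_of_nonpos (by positivity) ?_ (by linarith)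
  refine le_trans ?_ (pLog_le_exp_loglog _)
  have h1 : θ ^ (i + 1) ≤ S.sq X (n (i + 1)) := by
    calc θ ^ (i + 1) ≤ θ ^ (i + 1) * S.sq X (m 0) := le_mul_of_one_le_right (by positivity) hm1
      _ ≤ S.sq X (m (i + 1)) := hm.pow_le (by linarith) _
      _ ≤ _ := sq_mono' h2 (hn _)
  rw [mul_comm, ← Real.log_pow]
  exact Real.log_le_log (by positivity) (h1.trans (le_max_right _ _))

/-- Condensation: the variances of `[m i, m (i + 1))` add up to at most `θ * sq (m i)`, so a whole
block contributes at most `θ * (log s²) ^ (δ - 1)` taken at its start. Starting above `exp (exp 1)`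
makes the truncated logarithms genuine ones. -/
theorem not_summable_exp_loglog (h2 : ∀ n, S.L1 (fun ω => X n ω ^ 2)) {δ : ℝ} (hδ1 : δ ≤ 1)
    (hdiv : ¬ Summable (fun n => (S.sq X n)⁻¹ * pLog (S.sq X n) ^ (δ - 1) *
        (S.E (fun ω => X n ω ^ 2)).toReal)) {θ : ℝ} (hθ : 1 < θ)
    {m : ℕ → ℕ} (hm : GeomChain (S.sq X) θ m) (hm1 : Real.exp (Real.exp 1) ≤ S.sq X (m 0)) :
    ¬ Summable fun i => Real.exp (-(1 - δ) * S.loglog X (m i)) := by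
  intro hs
  apply hdiv
  have hlt : ∀ i, m i < m (i + 1) := fun i => hm.strictMono (Nat.lt_succ_self i)
  have hge : ∀ i, i + m 0 ≤ m i := fun i => by
    induction i with
    | zero => simp
    | succ i ih => have := hlt i; omega
  set f : ℕ → ℝ := fun n => (S.sq X n)⁻¹ * pLog (S.sq X n) ^ (δ - 1) *
        (S.E (fun ω => X n ω ^ 2)).toReal with hf
  have hf0 : ∀ n, 0 ≤ f n := fun n => mul_nonneg (mul_nonneg (inv_nonneg.2 (sq_nonneg' h2 n))
    (Real.rpow_nonneg (pLog_pos _).le _)) (sqMoment_nonneg h2 n)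
  have hblock : ∀ i, ∑ n ∈ Finset.Ico (m i) (m (i + 1)), f n ≤
      θ * Real.exp (-(1 - δ) * S.loglog X (m i)) := by
    intro i
    have hpos := hm.pos i
    have hbig : Real.exp (Real.exp 1) ≤ S.sq X (m i) :=
      hm1.trans (sq_mono' h2 (hm.strictMono.monotone (Nat.zero_le i)))
    have h1 : ∀ n ∈ Finset.Ico (m i) (m (i + 1)), f n ≤
        (S.sq X (m i))⁻¹ * pLog (S.sq X (m i)) ^ (δ - 1) * (S.E (fun ω => X n ω ^ 2)).toReal := by
      intro n hn
      have hn := Finset.mem_Ico.1 hn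
      have hle := sq_mono' h2 hn.1
      refine mul_le_mul_of_nonneg_right ?_ (sqMoment_nonneg h2 n)
      refine mul_le_mul (inv_anti₀ hpos hle) ?_ (Real.rpow_nonneg (pLog_pos _).le _)
        (inv_nonneg.2 hpos.le)
      exact Real.rpow_le_rpow_of_nonpos (pLog_pos _) (pLog_mono hle) (by linarith)
    have h3 : ∑ n ∈ Finset.Ico (m i) (m (i + 1)), (S.E (fun ω => X n ω ^ 2)).toReal ≤
        θ * S.sq X (m i) := by
      refine le_trans ?_ (hm.block i (m (i + 1) - 1) (by have := hlt i; omega)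
        (by have := hlt i; omega))
      rw [sq, Nat.sub_add_cancel (by have := hlt i; omega), Finset.range_eq_Ico]
      exact Finset.sum_le_sum_of_subset_of_nonneg (Finset.Ico_subset_Ico_left (Nat.zero_le _))
        fun n _ _ => sqMoment_nonneg h2 n
    have h4 : Real.exp (-(1 - δ) * S.loglog X (m i)) = pLog (S.sq X (m i)) ^ (δ - 1) := by
      rw [mul_comm, Real.exp_mul, exp_loglog hbig]; ring_nf
    calc _ ≤ ∑ n ∈ Finset.Ico (m i) (m (i + 1)), (S.sq X (m i))⁻¹ *
          pLog (S.sq X (m i)) ^ (δ - 1) * (S.E (fun ω => X n ω ^ 2)).toReal :=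
          Finset.sum_le_sum h1
      _ = (S.sq X (m i))⁻¹ * pLog (S.sq X (m i)) ^ (δ - 1) *
          ∑ n ∈ Finset.Ico (m i) (m (i + 1)), (S.E (fun ω => X n ω ^ 2)).toReal := by
          rw [Finset.mul_sum]
      _ ≤ (S.sq X (m i))⁻¹ * pLog (S.sq X (m i)) ^ (δ - 1) * (θ * S.sq X (m i)) :=
          mul_le_mul_of_nonneg_left h3 (mul_nonneg (inv_nonneg.2 hpos.le)
            (Real.rpow_nonneg (pLog_pos _).le _))
      _ = _ := by rw [h4]; field_simp
  rw [← summable_nat_add_iff (m 0)]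
  refine summable_of_sum_range_le (c := ∑' i, θ * Real.exp (-(1 - δ) * S.loglog X (m i)))
    (fun n => hf0 _) fun I => ?_
  have h1 : ∑ n ∈ Finset.range I, f (n + m 0) ≤ ∑ n ∈ Finset.Ico (m 0) (m I), f n := by
    have : ∑ n ∈ Finset.range I, f (n + m 0) = ∑ n ∈ Finset.Ico (m 0) (I + m 0), f n := by
      rw [Finset.sum_Ico_eq_sum_range, Nat.add_sub_cancel]
      exact Finset.sum_congr rfl fun n _ => by rw [add_comm]
    rw [this]
    exact Finset.sum_le_sum_of_subset_of_nonneg (Finset.Ico_subset_Ico_right (hge I))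
      fun n _ _ => hf0 n
  have h3 : ∑ n ∈ Finset.Ico (m 0) (m I), f n =
      ∑ i ∈ Finset.range I, ∑ n ∈ Finset.Ico (m i) (m (i + 1)), f n := by
    clear h1
    induction I with
    | zero => simp
    | succ I ih =>
      rw [Finset.sum_range_succ, ← ih, Finset.sum_Ico_consecutive _
        (hm.strictMono.monotone (Nat.zero_le I)) (hlt I).le]
  rw [h3] at h1
  refine h1.trans ((Finset.sum_le_sum fun i _ => hblock i).trans ?_)
  exact (hs.mul_left θ).sum_le_tsum _ fun i _ => mul_nonneg (by linarith) (Real.exp_pos _).le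

end SublinearExpectationSpace

/-! ### The upper exponential bound. -/

namespace SublinearExpectationSpace

variable {Ω : Type*} [MeasurableSpace Ω] {S : SublinearExpectationSpace Ω} {X : ℕ → Ω → ℝ}

/-- The bound for the means of the variables truncated at `c`. -/
noncomputable def meanBound (S : SublinearExpectationSpace Ω) (X : ℕ → Ω → ℝ) (c : ℝ)
    (N : ℕ) : ℝ :=
  ∑ j ∈ Finset.range (N + 1), S.meanAbs (X j) + 1 / (4 * c) * S.sq X N

theorem sum_mean_le (h2 : ∀ n, S.L1 (fun ω => X n ω ^ 2)) {c : ℝ} (hc : 0 < c) (m N : ℕ) :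
    ∑ j ∈ Finset.Ico m (N + 1), (S.meanAbs (X j) + 1 / (4 * c) * S.e (fun ω => X j ω ^ 2)) ≤
      S.meanBound X c N := by
  rw [meanBound, sq, Finset.mul_sum, ← Finset.sum_add_distrib, Finset.range_eq_Ico]
  refine Finset.sum_le_sum_of_subset_of_nonneg (Finset.Ico_subset_Ico_left (Nat.zero_le _))
    fun j _ _ => add_nonneg (meanAbs_nonneg _) (mul_nonneg (by positivity) (sqMoment_nonneg h2 j))

theorem sum_sq_le (h2 : ∀ n, S.L1 (fun ω => X n ω ^ 2)) (m N : ℕ) :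
    ∑ j ∈ Finset.Ico m (N + 1), S.e (fun ω => X j ω ^ 2) ≤ S.sq X N := by
  rw [sq, Finset.range_eq_Ico]
  exact Finset.sum_le_sum_of_subset_of_nonneg (Finset.Ico_subset_Ico_left (Nat.zero_le _))
    fun j _ _ => sqMoment_nonneg h2 j

/-- The logarithm of the bound of `e_exp_clip_le`. -/
noncomputable def expBound (S : SublinearExpectationSpace Ω) (Z : Ω → ℝ) (c lam b p : ℝ) : ℝ :=
  lam * (S.meanAbs Z + 1 / (4 * c) * S.e (fun ω => Z ω ^ 2)) +
    (lam ^ 2 / 2 * (1 + 2 * lam * b) * S.e (fun ω => Z ω ^ 2) +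
      Real.exp (lam * c) / b ^ p * (S.excess Z p b).toReal)

theorem expBound_nonneg {Z : Ω → ℝ} (hZ : S.L1 (fun ω => Z ω ^ 2)) {c lam b : ℝ} (p : ℝ)
    (hc : 0 < c) (hlam : 0 < lam) (hb : 0 < b) : 0 ≤ S.expBound Z c lam b p := by
  have h0 : 0 ≤ S.e (fun ω => Z ω ^ 2) := e_nonneg hZ fun _ => sq_nonneg _
  have h1 := meanAbs_nonneg (S := S) Z
  have h3 : 0 < b ^ p := Real.rpow_pos_of_pos hb p
  unfold expBound
  positivity

theorem sum_expBound_le (hX : ∀ n, X n ∈ S.H) (h2 : ∀ n, S.L1 (fun ω => X n ω ^ 2))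
    {c lam b b0 p : ℝ} (hc : 0 < c) (hlam : 0 < lam) (hb0 : 0 < b0) (hbb : b0 ≤ b) (hp : 1 ≤ p)
    {j0 m N : ℕ} (hm : j0 ≤ m) (hfin : ∀ j, j0 ≤ j → j ≤ N → S.excess (X j) p b0 ≠ ⊤) :
    ∑ j ∈ Finset.Ico m (N + 1), S.expBound (X j) c lam b p ≤
      lam * S.meanBound X c N + (lam ^ 2 / 2 * (1 + 2 * lam * b) * S.sq X N +
        Real.exp (lam * c) *
          ((∑ j ∈ Finset.Ico j0 (N + 1), (S.excess (X j) p b0).toReal) / b ^ p)) := by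
  rw [mul_div_left_comm, mul_comm _ (Real.exp (lam * c) / b ^ p)]
  have hb : 0 < b := hb0.trans_le hbb
  have hbp : 0 < b ^ p := Real.rpow_pos_of_pos hb p
  unfold expBound
  rw [Finset.sum_add_distrib, Finset.sum_add_distrib, ← Finset.mul_sum, ← Finset.mul_sum,
    ← Finset.mul_sum]
  refine add_le_add (mul_le_mul_of_nonneg_left (sum_mean_le h2 hc m N) hlam.le)
    (add_le_add (mul_le_mul_of_nonneg_left (sum_sq_le h2 m N) (by positivity))
      (mul_le_mul_of_nonneg_left ?_ (by positivity)))
  refine le_trans (Finset.sum_le_sum fun j hj => ?_) (Finset.sum_le_sum_of_subset_of_nonneg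
    (Finset.Ico_subset_Ico_left hm) fun j _ _ => ENNReal.toReal_nonneg)
  have hj := Finset.mem_Ico.1 hj
  exact ENNReal.toReal_mono (hfin j (by omega) (by omega)) (excess_anti (hX j) hp hb0.le hbb)

/-- The truncation bias is `sq / (4 δ a) = a / (4 δ t²)`, negligible against `a` because `t` tends
to infinity. -/
theorem tendsto_meanBound (h2 : ∀ n, S.L1 (fun ω => X n ω ^ 2))
    (hq : Tendsto (S.sq X) atTop atTop)
    (hmean : Tendsto (fun n => (∑ j ∈ Finset.range (n + 1), S.meanAbs (X j)) / S.a X n) atTop (𝓝 0))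
    {δ ε : ℝ} (hδ : 0 < δ) (hε : 0 < ε) :
    ∀ᶠ N in atTop, S.meanBound X (δ * S.a X N) N ≤ ε * S.a X N := by
  have h1 := hmean.eventually (gt_mem_nhds (half_pos hε))
  have h3 := ((tendsto_t hq).eventually_ge_atTop (1 / (2 * δ * ε)))
  filter_upwards [h1, h3, hq.eventually_gt_atTop 0] with N h1 h3 h4
  have ha := a_pos h4
  have ht := one_le_t (S := S) (X := X) N
  rw [div_lt_iff₀ ha] at h1
  have h5 : 1 / (4 * (δ * S.a X N)) * S.sq X N ≤ ε / 2 * S.a X N := by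
    rw [div_mul_eq_mul_div, one_mul, div_le_iff₀ (by positivity)]
    rw [div_le_iff₀ (by positivity)] at h3
    have h6 : ε / 2 * S.a X N * (4 * (δ * S.a X N)) =
        S.sq X N * (S.t X N * (S.t X N * (2 * δ * ε))) := by
      rw [← s_sq h2, a]; ring
    rw [h6]
    refine le_mul_of_one_le_right h4.le ?_
    nlinarith
  rw [meanBound]
  linarith

/-- The hypotheses on the sequence that are used throughout; `j0` is an index from which on the
variances are positive, and `p, α, d` are the parameters of the moment condition. -/
structure MomentData (S : SublinearExpectationSpace Ω) (X : ℕ → Ω → ℝ) (p α d : ℝ) (j0 : ℕ) :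
    Prop where
  mem : ∀ n, X n ∈ S.H
  indep : S.IndepSeq X
  sqL1 : ∀ n, S.L1 (fun ω => X n ω ^ 2)
  two_le_p : 2 ≤ p
  α_pos : 0 < α
  d_nonneg : 0 ≤ d
  pos : 0 < S.sq X j0
  moments : ∑' n : {n : ℕ // 0 < S.a X n},
        S.Gam X p α n / ENNReal.ofReal (S.a X n ^ p) *
          (S.Lam X p α n / ENNReal.ofReal (S.a X n ^ p)) ^ d < ⊤

namespace MomentData

variable {p α d : ℝ} {j0 : ℕ}

theorem sq_pos (h : S.MomentData X p α d j0) {N : ℕ} (hN : j0 ≤ N) : 0 < S.sq X N :=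
  h.pos.trans_le (sq_mono' h.sqL1 hN)

theorem threshold_pos (h : S.MomentData X p α d j0) {N : ℕ} (hN : j0 ≤ N) :
    0 < α * S.s X N / S.t X N :=
  div_pos (mul_pos h.α_pos (s_pos (h.sq_pos hN))) (t_pos N)

theorem excess_ne_top (h : S.MomentData X p α d j0) {j N : ℕ} (hj : j0 ≤ j) (hN : j ≤ N) :
    S.excess (X j) p (α * S.s X N / S.t X N) ≠ ⊤ :=
  SublinearExpectationSpace.excess_ne_top h.mem h.sqL1 (by linarith [h.two_le_p]) h.α_pos.le
    h.d_nonneg h.moments h.pos hj hN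

theorem excess_ne_top' (h : S.MomentData X p α d j0) {j N : ℕ} (hj : j0 ≤ j) (hN : j ≤ N) {b : ℝ}
    (hb : α * S.s X N / S.t X N ≤ b) : S.excess (X j) p b ≠ ⊤ :=
  ne_top_of_le_ne_top (h.excess_ne_top hj hN) (excess_anti (h.mem j) (by linarith [h.two_le_p])
    (h.threshold_pos (hj.trans hN)).le hb)

/-- The normalized form of the moment term of the exponential bounds. -/
theorem lamFrom_div (h : S.MomentData X p α d j0) {N : ℕ} (hN : j0 ≤ N) {b : ℝ} (hb : 0 < b) :
    S.lamFrom X p α j0 N / b ^ p = S.rho X p α j0 N * (S.a X N / b) ^ p := by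
  have ha := a_pos (h.sq_pos hN)
  have := (Real.rpow_pos_of_pos ha p).ne'
  rw [rho, Real.div_rpow ha.le hb.le]
  field_simp

/-- Of the margin `4ε`, one `ε` is spent on the width of the ramp and one on the means; `2ε` remains
in the exponent. -/
theorem upCap_max_clip_le_exp (h : S.MomentData X p α d j0) {N : ℕ} (hN : j0 ≤ N) {σ : ℝ}
    (hσ : σ = 1 ∨ σ = -1) {δ ε : ℝ} (hδ : 0 < δ) (hε : 0 < ε)
    (hmean : S.meanBound X (δ * S.a X N) N ≤ ε * S.a X N) {lam b : ℝ} (hlam : 0 < lam)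
    (hb : α * S.s X N / S.t X N ≤ b) (hlb : 2 * lam * b ≤ 1) :
    S.upCap {ω | ∃ k ∈ Finset.Ioc j0 (N + 1), (1 + 4 * ε) * S.a X N ≤
        ∑ j ∈ Finset.Ico j0 k, σ * clip (δ * S.a X N) (X j ω)} ≤
      ENNReal.ofReal (Real.exp (-(lam * ((1 + 2 * ε) * S.a X N)) +
        (lam ^ 2 / 2 * (1 + 2 * lam * b) * S.sq X N +
          Real.exp (lam * (δ * S.a X N)) * (S.rho X p α j0 N * (S.a X N / b) ^ p)))) := by
  have ha := a_pos (h.sq_pos hN)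
  have hc : 0 < δ * S.a X N := by positivity
  have hb0 := (h.threshold_pos hN).trans_le hb
  have hmax := upCap_max_le h.mem h.indep (m := j0) (n := N + 1) (by omega)
    (ψ := fun _ x => σ * clip (δ * S.a X N) x) (fun j _ => bl_sign_clip σ hc.le j)
    (lam := lam) (u := (1 + 4 * ε) * S.a X N) (w := ε * S.a X N) hlam.le (by positivity)
    (c := fun j => S.expBound (X j) (δ * S.a X N) lam b p)
    (fun j _ => expBound_nonneg (h.sqL1 j) p hc hlam hb0)
    (fun j hj => by
      have hj := Finset.mem_Ico.1 hj
      exact e_exp_clip_le (h.mem j) (h.sqL1 j) hc hσ hlam hb0 hlb h.two_le_p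
        (h.excess_ne_top' hj.1 (by omega) hb))
  refine hmax.trans (ENNReal.ofReal_le_ofReal (Real.exp_le_exp.2 ?_))
  have hsum := sum_expBound_le h.mem h.sqL1 hc hlam (h.threshold_pos hN) hb
    (by linarith [h.two_le_p]) (le_refl j0) (N := N) fun j hj hjN => h.excess_ne_top hj hjN
  rw [← lamFrom, h.lamFrom_div hN hb0] at hsum
  have h1 := mul_le_mul_of_nonneg_left hmean hlam.le
  linarith

/-- The Gaussian choice `lam = t / s` costs `exp (δ t²)` in front of `rho`, affordable only when
`rho ≤ exp (-2 δ t²)`. For larger `rho < 1` a smaller `lam`, of order `-log rho / a`, keeps that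
product bounded and still yields `rho ^ (d + 1)`; for `rho ≥ 1` there is nothing to prove. -/
theorem exists_upCap_max_clip_le (h : S.MomentData X p α d j0) {ε : ℝ} (hε : 0 < ε) (hαε : α ≤ ε)
    (hα : α ≤ 1 / 2) :
    ∃ δ > 0, ∃ C : ℝ, ∀ σ : ℝ, (σ = 1 ∨ σ = -1) → ∀ N, j0 ≤ N →
      S.meanBound X (δ * S.a X N) N ≤ ε * S.a X N →
      S.upCap {ω | ∃ k ∈ Finset.Ioc j0 (N + 1), (1 + 4 * ε) * S.a X N ≤
        ∑ j ∈ Finset.Ico j0 k, σ * clip (δ * S.a X N) (X j ω)} ≤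
      ENNReal.ofReal (C * (Real.exp (-(1 + 2 * ε) * S.loglog X N) +
        S.rho X p α j0 N ^ (d + 1))) := by
  have hd := h.d_nonneg
  have hαp := h.α_pos
  have hp0 : 0 < p := by linarith [h.two_le_p]
  -- With `lam * δ * a = -log ρ / 4` this gives `lam * a = -2 (d + 1) log ρ`. Half of it is lost to
  -- the quadratic term and the other half is exactly `ρ ^ (d + 1)`.
  set δ := 1 / (8 * (d + 1)) with hδ
  have hδ0 : 0 < δ := by positivity
  set C1 := p ^ p / (δ * (α / 2)) ^ p with hC1
  have hC10 : 0 ≤ C1 := by positivity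
  have hpow : ∀ D, 0 ≤ D → (D / (δ * (α / 2))) ^ p ≤ C1 * Real.exp D := by
    intro D hD
    rw [Real.div_rpow hD (by positivity), hC1]
    have hq : 0 ≤ (δ * (α / 2)) ^ p := by positivity
    exact (div_le_div_of_nonneg_right (rpow_le_mul_exp hp0 hD) hq).trans_eq
      (mul_div_right_comm _ _ _)
  refine ⟨δ, hδ0, Real.exp C1, fun σ hσ N hN hmean => ?_⟩
  have hsq := h.sq_pos hN
  have hs := s_pos hsq
  have ht := t_pos (S := S) (X := X) N
  have hst : S.a X N = S.s X N * S.t X N := rfl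
  have ha := a_pos hsq
  have hrho0 := rho_nonneg (S := S) (X := X) p α j0 N
  have hss := s_sq h.sqL1 N
  have htt := t_sq (S := S) (X := X) N
  set ρ := S.rho X p α j0 N
  have hE1 : 1 ≤ Real.exp C1 := Real.one_le_exp hC10
  rcases le_or_gt 1 ρ with hρ1 | hρ1
  · refine (upCap_le_one _).trans ?_
    rw [ENNReal.one_le_ofReal]
    have := Real.one_le_rpow hρ1 (by linarith : 0 ≤ d + 1)
    have := Real.exp_pos (-(1 + 2 * ε) * S.loglog X N)
    nlinarith
  rcases le_or_gt ρ (Real.exp (-(2 * δ * S.t X N ^ 2))) with hgood | hbad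
  · have hlb : 2 * (S.t X N / S.s X N) * (α * S.s X N / S.t X N) = 2 * α := by field_simp
    refine (h.upCap_max_clip_le_exp hN hσ hδ0 hε hmean (lam := S.t X N / S.s X N)
      (b := α * S.s X N / S.t X N) (by positivity) le_rfl (by rw [hlb]; linarith)).trans ?_
    refine ENNReal.ofReal_le_ofReal ?_
    refine le_trans ?_ (mul_le_mul_of_nonneg_left
      (le_add_of_nonneg_right (Real.rpow_nonneg hrho0 (d + 1))) (by positivity))
    rw [← Real.exp_add]
    refine Real.exp_le_exp.2 ?_
    rw [hlb]
    have e1 : S.t X N / S.s X N * ((1 + 2 * ε) * S.a X N) = (1 + 2 * ε) * S.t X N ^ 2 := by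
      rw [hst]; field_simp
    have e2 : (S.t X N / S.s X N) ^ 2 / 2 * (1 + 2 * α) * S.sq X N =
        (1 + 2 * α) / 2 * S.t X N ^ 2 := by
      rw [← hss]; field_simp
    have e3 : S.t X N / S.s X N * (δ * S.a X N) = δ * S.t X N ^ 2 := by rw [hst]; field_simp
    have e4 : S.a X N / (α * S.s X N / S.t X N) = S.t X N ^ 2 / α := by rw [hst]; field_simp
    rw [e1, e2, e3, e4]
    set D := δ * S.t X N ^ 2 with hD
    have hD0 : 0 ≤ D := by positivity
    have e5 : (S.t X N ^ 2 / α) ^ p ≤ C1 * Real.exp D := by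
      refine le_trans ?_ (hpow D hD0)
      refine Real.rpow_le_rpow (by positivity) ?_ hp0.le
      rw [hD]
      have : δ * S.t X N ^ 2 / (δ * (α / 2)) = 2 * (S.t X N ^ 2 / α) := by field_simp
      rw [this]
      have : 0 ≤ S.t X N ^ 2 / α := by positivity
      linarith
    -- Of the decay `exp (-2D)` of `ρ`, one factor cancels `exp (lam * c)` and the other absorbs the
    -- power of `t²`.
    have e6 : Real.exp D * (ρ * (S.t X N ^ 2 / α) ^ p) ≤ C1 := by
      calc _ ≤ Real.exp D * (Real.exp (-(2 * δ * S.t X N ^ 2)) * (C1 * Real.exp D)) := by gcongr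
        _ = C1 * Real.exp (D + (-(2 * δ * S.t X N ^ 2) + D)) := by
            rw [Real.exp_add, Real.exp_add]; ring
        _ = C1 := by
            rw [hD]; ring_nf; simp
    have e7 : 0 ≤ (ε - α) * S.t X N ^ 2 := mul_nonneg (by linarith) (by positivity)
    have e8 : 0 ≤ ε * S.t X N ^ 2 := by positivity
    have e9 : -(1 + 2 * ε) * S.loglog X N = -(1 + 2 * ε) * (S.t X N ^ 2 / 2) := by
      rw [htt]; ring
    rw [e9]
    linarith
  · have hρ0 : 0 < ρ := (Real.exp_pos _).trans hbad
    -- Now `ρ = exp (-4D)`, against `exp (lam * c) = exp D` and another `exp D` for the power; `D ≤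
    -- δ t² / 2` keeps the level `α / (2 lam)` above `α s / t`.
    set D := -Real.log ρ / 4 with hD
    have hlogneg : Real.log ρ < 0 := Real.log_neg hρ0 hρ1
    have hD0 : 0 < D := by rw [hD]; linarith
    have hDt : D ≤ δ * S.t X N ^ 2 / 2 := by
      have := (Real.lt_log_iff_exp_lt hρ0).2 hbad
      rw [hD]; linarith
    set lam := D / (δ * S.a X N) with hlam
    have hlam0 : 0 < lam := by positivity
    have hls : lam * S.s X N ≤ S.t X N / 2 := by
      have : lam * S.s X N = D / (δ * S.t X N) := by rw [hlam, hst]; field_simp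
      rw [this, div_le_iff₀ (by positivity)]
      linarith
    have hlb : 2 * lam * (α / 2 / lam) = α := by field_simp
    refine (h.upCap_max_clip_le_exp hN hσ hδ0 hε hmean (lam := lam)
      (b := α / 2 / lam) hlam0 ?_ (by rw [hlb]; linarith)).trans ?_
    · rw [div_le_div_iff₀ ht hlam0]
      nlinarith
    refine ENNReal.ofReal_le_ofReal ?_
    refine le_trans ?_ (mul_le_mul_of_nonneg_left
      (le_add_of_nonneg_left (Real.exp_pos (-(1 + 2 * ε) * S.loglog X N)).le) (by positivity))
    rw [Real.rpow_def_of_pos hρ0, ← Real.exp_add]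
    refine Real.exp_le_exp.2 ?_
    rw [hlb]
    have e3 : lam * (δ * S.a X N) = D := by rw [hlam]; field_simp
    have e4 : S.a X N / (α / 2 / lam) = D / (δ * (α / 2)) := by rw [hlam]; field_simp
    rw [e3, e4]
    have e5 := hpow D hD0.le
    have e6 : Real.exp D * (ρ * (D / (δ * (α / 2))) ^ p) ≤ C1 := by
      have hρe : ρ = Real.exp (-(4 * D)) := by
        rw [hD, show -(4 * (-Real.log ρ / 4)) = Real.log ρ by ring, Real.exp_log hρ0]
      calc _ ≤ Real.exp D * (ρ * (C1 * Real.exp D)) := by gcongr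
        _ = C1 * Real.exp (-(2 * D)) := by
            rw [hρe, show -(2 * D) = D + (-(4 * D) + D) by ring, Real.exp_add, Real.exp_add]; ring
        _ ≤ C1 * 1 := by
            gcongr; exact Real.exp_le_one_iff.2 (by linarith)
        _ = C1 := mul_one _
    have e7 : lam * S.a X N = -2 * (d + 1) * Real.log ρ := by
      rw [hlam, hD, hδ]; field_simp; ring
    have e8 : lam ^ 2 * S.sq X N ≤ lam * S.a X N / 2 := by
      rw [← hss, hst]
      have : lam ^ 2 * S.s X N ^ 2 = lam * S.s X N * (lam * S.s X N) := by ring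
      rw [this]
      have h0 : 0 ≤ lam * S.s X N := by positivity
      calc _ ≤ lam * S.s X N * (S.t X N / 2) := by gcongr
        _ = _ := by ring
    have e9 : 0 ≤ lam ^ 2 * S.sq X N := by positivity
    have e10 : lam ^ 2 / 2 * (1 + α) * S.sq X N ≤ lam * S.a X N / 2 := by nlinarith
    have e11 : 0 ≤ lam * S.a X N * ε := by positivity
    have e12 : lam * ((1 + 2 * ε) * S.a X N) = lam * S.a X N + 2 * (lam * S.a X N * ε) := by ring
    linarith

end MomentData

end SublinearExpectationSpace

theorem StrictMono.exists_block {m : ℕ → ℕ} (hm : StrictMono m) {I n : ℕ} (h : m I ≤ n) :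
    ∃ i, I ≤ i ∧ m i ≤ n ∧ n < m (i + 1) := by
  by_contra! hc
  have h1 : ∀ k, m (I + k) ≤ n := fun k => by
    induction k with
    | zero => exact h
    | succ k ih => exact hc (I + k) (by omega) ih
  have h2 := h1 (n + 1)
  have h3 := hm.id_le (I + (n + 1))
  simp only [id] at h3
  omega

/-! ### The upper half of the law. -/

namespace SublinearExpectationSpace

variable {Ω : Type*} [MeasurableSpace Ω] {S : SublinearExpectationSpace Ω} {X : ℕ → Ω → ℝ}

/-- The hypotheses of the law of the iterated logarithm other than the divergence condition. -/
structure LILData (S : SublinearExpectationSpace Ω) (X : ℕ → Ω → ℝ) : Prop where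
  mem : ∀ n, X n ∈ S.H
  indep : S.IndepSeq X
  sqL1 : ∀ n, S.L1 (fun ω => X n ω ^ 2)
  tail : ∀ δ : ℝ, 0 < δ → S.outerCap {ω | ∃ᶠ n in atTop, δ * S.a X n < |X n ω|} = 0
  moments : ∀ α : ℝ, 0 < α → ∃ p d : ℝ, 2 ≤ p ∧ 0 ≤ d ∧
      ∑' n : {n : ℕ // 0 < S.a X n},
        S.Gam X p α n / ENNReal.ofReal (S.a X n ^ p) *
          (S.Lam X p α n / ENNReal.ofReal (S.a X n ^ p)) ^ d < ⊤
  sqTop : Tendsto (S.sq X) atTop atTop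
  mean : Tendsto (fun n => (∑ j ∈ Finset.range (n + 1), S.meanAbs (X j)) / S.a X n) atTop (𝓝 0)

/-- A ramp between the levels `δ / 2` and `δ` lies between the two indicators, which moves the
summability from the given capacity to `upCap`. -/
theorem tail_null {V : Set Ω → ℝ} (hV : S.IsUpperCapacity V) (hX : ∀ n, X n ∈ S.H)
    (htail : ∀ ε : ℝ, 0 < ε → Summable (fun n => V {ω | ε * S.a X n ≤ |X n ω|}))
    (hq : Tendsto (S.sq X) atTop atTop) {δ : ℝ} (hδ : 0 < δ) :
    S.outerCap {ω | ∃ᶠ n in atTop, δ * S.a X n < |X n ω|} = 0 := by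
  have hmeas : ∀ n, Measurable fun ω => |X n ω| := fun n => (S.measurable_of_mem _ (hX n)).abs
  refine outerCap_frequently_null (B := fun n => {ω | δ * S.a X n < |X n ω|})
    (fun n => measurableSet_lt measurable_const (hmeas n)) (htail (δ / 2) (half_pos hδ)) ?_
  filter_upwards [hq.eventually_gt_atTop 0] with n hn
  have ha := a_pos hn
  set w := δ / 2 * S.a X n with hw
  have hw0 : 0 < w := by positivity
  have hξ : S.L1 (fun ω => ramp (δ * S.a X n) w (|X n ω|)) :=
    L1.of_bound (M := 1) (S.comp_mem_one (S.abs_mem (hX n))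
      (CLLip.of_lipschitz (ramp_lip hw0))) fun ω => by
        rw [abs_of_nonneg (ramp_nonneg _ _ _)]; exact ramp_le_one _ _ _
  have h1 : S.upCap {ω | δ * S.a X n < |X n ω|} ≤
      ENNReal.ofReal (S.e (fun ω => ramp (δ * S.a X n) w (|X n ω|))) := by
    refine upCap_le_e hξ fun ω => ?_
    by_cases hω : ω ∈ {ω | δ * S.a X n < |X n ω|}
    · rw [Set.indicator_of_mem hω, ramp_eq_one hw0 (le_of_lt hω)]; rfl
    · rw [Set.indicator_of_notMem hω]; exact ramp_nonneg _ _ _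
  refine h1.trans (ENNReal.ofReal_le_ofReal ?_)
  have h3 := hV.lower {ω | δ / 2 * S.a X n ≤ |X n ω|}
    (measurableSet_le measurable_const (hmeas n)) _ hξ.1 fun ω => by
      by_cases hω : ω ∈ {ω | δ / 2 * S.a X n ≤ |X n ω|}
      · rw [Set.indicator_of_mem hω]; exact ramp_le_one _ _ _
      · rw [Set.indicator_of_notMem hω]
        by_contra! hc
        have := lt_of_ramp_pos hw0 hc
        apply hω
        show δ / 2 * S.a X n ≤ |X n ω|
        rw [hw] at this
        linarith
  rw [← hξ.coe_e] at h3
  exact EReal.coe_le_coe_iff.1 h3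

namespace LILData

theorem eventually_forall_le (h : S.LILData X) {δ : ℝ} (hδ : 0 < δ) {ω : Ω}
    (hω : ∀ᶠ n in atTop, |X n ω| ≤ δ * S.a X n) :
    ∀ᶠ N in atTop, ∀ j ≤ N, |X j ω| ≤ δ * S.a X N := by
  obtain ⟨J, hJ⟩ := eventually_atTop.1 hω
  have h1 := ((tendsto_a h.sqTop).const_mul_atTop hδ).eventually_ge_atTop
    (∑ j ∈ Finset.range J, |X j ω|)
  filter_upwards [h1] with N hN j hj
  rcases lt_or_ge j J with hjJ | hjJ
  · refine le_trans ?_ hN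
    exact Finset.single_le_sum (f := fun j => |X j ω|) (fun _ _ => abs_nonneg _)
      (Finset.mem_range.2 hjJ)
  · exact (hJ j hjJ).trans (mul_le_mul_of_nonneg_left (a_mono h.sqL1 hj) hδ.le)

/-- Borel-Cantelli over blocks in which `sq` varies by the factor `1 + ε` at most. Off the null sets
the clipping is eventually inactive, and the finitely many terms before `j0` are absorbed by `ε * a
n`. -/
theorem exceed_null (h : S.LILData X) {σ : ℝ} (hσ : σ = 1 ∨ σ = -1) {η : ℝ} (hη : 0 < η) :
    S.outerCap {ω | ∃ᶠ n in atTop, (1 + η) * S.a X n < σ * partialSum X n ω} = 0 := by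
  -- The total loss is `(1 + 4ε)(1 + ε) + ε ≤ 1 + 10ε ≤ 1 + η`.
  set ε := min η 1 / 10 with hε
  have hε0 : 0 < ε := by positivity
  have hεη : 10 * ε ≤ η := by rw [hε]; linarith [min_le_left η 1]
  have hε1 : 10 * ε ≤ 1 := by rw [hε]; linarith [min_le_right η 1]
  obtain ⟨p, d, hp, hd, hsum⟩ := h.moments ε hε0
  obtain ⟨j0, hj0⟩ := (h.sqTop.eventually_ge_atTop 1).exists
  have hj0p : 0 < S.sq X j0 := by linarith
  have hM : S.MomentData X p ε d j0 := ⟨h.mem, h.indep, h.sqL1, hp, hε0, hd, hj0p, hsum⟩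
  obtain ⟨δ, hδ, C, hC⟩ := hM.exists_upCap_max_clip_le hε0 le_rfl (by linarith)
  obtain ⟨m, hm0, hm⟩ := exists_geomChain h.sqTop (θ := 1 + ε) (by linarith) hj0p
  have hlt : ∀ i, m i < m (i + 1) := fun i => hm.strictMono (Nat.lt_succ_self i)
  have hmj : ∀ i, j0 ≤ m i := fun i => hm0 ▸ hm.strictMono.monotone (Nat.zero_le i)
  -- The last index before the jump: `a (N i)` is still comparable with `a n` throughout the block,
  -- whereas `a (m (i + 1))` need not be.
  set N : ℕ → ℕ := fun i => m (i + 1) - 1 with hN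
  have hNm : ∀ i, m i ≤ N i := fun i => by have := hlt i; simp only [hN]; omega
  have hNtop : Tendsto N atTop atTop :=
    tendsto_atTop_mono hNm hm.strictMono.tendsto_atTop
  set B : ℕ → Set Ω := fun i => {ω | ∃ k ∈ Finset.Ioc j0 (N i + 1), (1 + 4 * ε) * S.a X (N i) ≤
        ∑ j ∈ Finset.Ico j0 k, σ * clip (δ * S.a X (N i)) (X j ω)} with hB
  have hBm : ∀ i, MeasurableSet (B i) := fun i => by
    have : B i = ⋃ k ∈ Finset.Ioc j0 (N i + 1), {ω | (1 + 4 * ε) * S.a X (N i) ≤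
        ∑ j ∈ Finset.Ico j0 k, σ * clip (δ * S.a X (N i)) (X j ω)} := by
      ext ω; simp [hB]
    rw [this]
    refine Finset.measurableSet_biUnion _ fun k _ => measurableSet_le measurable_const ?_
    refine Finset.measurable_fun_sum _ fun j _ => Measurable.const_mul ?_ σ
    exact measurable_const.max ((S.measurable_of_mem _ (h.mem j)).min measurable_const)
  have hBC : S.outerCap {ω | ∃ᶠ i in atTop, ω ∈ B i} = 0 := by
    refine outerCap_frequently_null hBm (f := fun i =>
      C * (Real.exp (-(1 + 2 * ε) * S.loglog X (N i)) + S.rho X p ε j0 (N i) ^ (d + 1))) ?_ ?_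
    · refine Summable.mul_left C (Summable.add ?_ ?_)
      · exact summable_exp_loglog h.sqL1 (by linarith) hm (by rw [hm0]; exact hj0) hNm (by linarith)
      · exact summable_rho_pred h.mem h.sqL1 (by linarith) hε0.le hd hsum hj0p (by linarith) hm
          hm0.ge
    · filter_upwards [hNtop.eventually (tendsto_meanBound h.sqL1 h.sqTop h.mean hδ hε0)] with i hi
      exact hC σ hσ (N i) ((hmj i).trans (hNm i)) hi
  refine le_antisymm ((outerCap_mono fun ω hω => ?_).trans
    (outerCap_union_null hBC (h.tail δ hδ)).le) zero_le
  by_contra hnot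
  simp only [Set.mem_union, not_or, Set.mem_ofPred_eq, not_frequently, not_lt] at hnot
  obtain ⟨hnB, hntail⟩ := hnot
  apply hω
  obtain ⟨I, hI⟩ := eventually_atTop.1 (hnB.and
    (hNtop.eventually (h.eventually_forall_le hδ hntail)))
  have hc0 := ((tendsto_a h.sqTop).const_mul_atTop hε0).eventually_ge_atTop
    |∑ j ∈ Finset.Ico 0 j0, X j ω|
  filter_upwards [hc0, eventually_ge_atTop (m I)] with n hn hnI
  rw [not_lt]
  obtain ⟨i, hiI, hin, hni⟩ := hm.strictMono.exists_block hnI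
  obtain ⟨h1, h3⟩ := hI i hiI
  have hnN : n ≤ N i := by simp only [hN]; omega
  have h4 : ∑ j ∈ Finset.Ico j0 (n + 1), σ * X j ω < (1 + 4 * ε) * S.a X (N i) := by
    by_contra! hc
    refine h1 ⟨n + 1, Finset.mem_Ioc.2 ⟨by have := hmj i; omega, by omega⟩, hc.trans_eq ?_⟩
    refine Finset.sum_congr rfl fun j hj => ?_
    have hj := Finset.mem_Ico.1 hj
    rw [clip_eq_self (h3 j (by omega))]
  have h5 : S.a X (N i) ≤ (1 + ε) * S.a X n := by
    refine a_le_mul h.sqL1 (by linarith) ((hm.block i (N i) (hNm i) ?_).trans ?_)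
    · have := hlt i; simp only [hN]; omega
    · exact mul_le_mul_of_nonneg_left (sq_mono' h.sqL1 hin) (by linarith)
  have h6 : σ * partialSum X n ω =
      σ * ∑ j ∈ Finset.Ico 0 j0, X j ω + ∑ j ∈ Finset.Ico j0 (n + 1), σ * X j ω := by
    rw [partialSum, Finset.range_eq_Ico, ← Finset.mul_sum, ← mul_add,
      Finset.sum_Ico_consecutive _ (Nat.zero_le _) (by have := hmj i; omega)]
  have h7 := le_abs_self (σ * ∑ j ∈ Finset.Ico 0 j0, X j ω)
  rw [abs_sign_mul hσ] at h7
  have ha := a_nonneg (S := S) (X := X) n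
  have h8 : (1 + 4 * ε) * S.a X (N i) ≤ (1 + 4 * ε) * ((1 + ε) * S.a X n) := by gcongr
  have h9 : (1 + 4 * ε) * ((1 + ε) * S.a X n) + ε * S.a X n ≤ (1 + η) * S.a X n := by
    have : (1 + 4 * ε) * (1 + ε) + ε ≤ 1 + η := by nlinarith
    calc _ = ((1 + 4 * ε) * (1 + ε) + ε) * S.a X n := by ring
      _ ≤ _ := by gcongr
  linarith

end LILData

end SublinearExpectationSpace

/-! ### The lower exponential bound. -/

namespace SublinearExpectationSpace

variable {Ω : Type*} [MeasurableSpace Ω] {S : SublinearExpectationSpace Ω} {X : ℕ → Ω → ℝ}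

theorem e_exp_sum_clip (hX : ∀ n, X n ∈ S.H) (hind : S.IndepSeq X) {c : ℝ} (hc : 0 ≤ c)
    (σ lam : ℝ) {m n : ℕ} (hmn : m ≤ n) :
    S.e (fun ω => Real.exp (lam * ∑ j ∈ Finset.Ico m n, σ * clip c (X j ω))) =
      ∏ j ∈ Finset.Ico m n, S.e (fun ω => Real.exp (lam * (σ * clip c (X j ω)))) := by
  rw [← e_prod_bl hX hind hmn (f := fun _ x => Real.exp (lam * (σ * clip c x)))
    (fun j _ => ((BL.const lam).mul (bl_sign_clip σ hc j)).exp) fun _ _ => (Real.exp_pos _).le]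
  congr 1
  ext ω
  rw [Finset.mul_sum, Real.exp_sum]

theorem bl_sum_clip {c : ℝ} (hc : 0 ≤ c) (σ : ℝ) (m n : ℕ) :
    BL m n (fun x => ∑ j ∈ Finset.Ico m n, σ * clip c (x j)) :=
  bl_partial_sum (n := n) le_rfl (ψ := fun _ x => σ * clip c x) fun j _ => bl_sign_clip σ hc j

theorem e_min_sq_le {Z : Ω → ℝ} (hZ : Z ∈ S.H) {b : ℝ} (hb : 0 ≤ b) :
    S.e (fun ω => (min |Z ω| b) ^ 2) ≤ b ^ 2 := by
  have h0 : ∀ ω, (min |Z ω| b) ^ 2 ≤ b ^ 2 := fun ω =>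
    pow_le_pow_left₀ (le_min (abs_nonneg _) hb) (min_le_right _ _) 2
  have hL : S.L1 (fun ω => (min |Z ω| b) ^ 2) := by
    refine L1.of_bound (M := b ^ 2) ?_ fun ω => by rw [abs_of_nonneg (sq_nonneg _)]; exact h0 ω
    refine S.comp_mem_one (S.comp_mem_one hZ (φ := fun x => min |x| b)
      (CLLip.of_lipschitz (K := 1) fun x y => ?_)) cLLip_sq
    rw [one_mul]
    refine (abs_min_sub_min_le_max _ _ _ _).trans (max_le (abs_abs_sub_abs_le_abs_sub x y) ?_)
    simp
  have := e_mono hL (L1.const (b ^ 2)) h0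
  rwa [e_const] at this

theorem sum_sq_Ico {m N : ℕ} (hmN : m ≤ N) :
    ∑ j ∈ Finset.Ico (m + 1) (N + 1), S.e (fun ω => X j ω ^ 2) = S.sq X N - S.sq X m := by
  rw [Finset.sum_Ico_eq_sub _ (by omega)]; rfl

/-- The three-way splitting behind the lower exponential bound. -/
theorem exp_le_three {lam β u v w s : ℝ} (hw : 0 < w) (hlam : 0 ≤ lam) (hβ : 0 ≤ β) {u' : ℝ}
    (hu' : u' ≤ u) :
    Real.exp (lam * s) ≤ Real.exp (β * lam * u) * Real.exp ((1 - β) * lam * s) +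
      (Real.exp (-(β * lam * v)) * Real.exp ((1 + β) * lam * s) +
        Real.exp (lam * v) * ramp u' w s) := by
  have h1 : 0 ≤ Real.exp (β * lam * u) * Real.exp ((1 - β) * lam * s) := by positivity
  have h2 : 0 ≤ Real.exp (-(β * lam * v)) * Real.exp ((1 + β) * lam * s) := by positivity
  have h3 : 0 ≤ Real.exp (lam * v) * ramp u' w s :=
    mul_nonneg (Real.exp_pos _).le (ramp_nonneg _ _ _)
  have hbl : 0 ≤ β * lam := mul_nonneg hβ hlam
  rcases lt_or_ge s u with h | h
  · have : Real.exp (lam * s) ≤ Real.exp (β * lam * u) * Real.exp ((1 - β) * lam * s) := by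
      rw [← Real.exp_add]
      refine Real.exp_le_exp.2 ?_
      have := mul_le_mul_of_nonneg_left h.le hbl
      linarith
    linarith
  · rcases lt_or_ge v s with h' | h'
    · have : Real.exp (lam * s) ≤ Real.exp (-(β * lam * v)) * Real.exp ((1 + β) * lam * s) := by
        rw [← Real.exp_add]
        refine Real.exp_le_exp.2 ?_
        have := mul_le_mul_of_nonneg_left h'.le hbl
        linarith
      linarith
    · have : Real.exp (lam * s) ≤ Real.exp (lam * v) * ramp u' w s := by
        rw [ramp_eq_one hw (hu'.trans h), mul_one]
        exact Real.exp_le_exp.2 (mul_le_mul_of_nonneg_left h' hlam)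
      linarith

namespace MomentData

variable {p α d : ℝ} {j0 : ℕ}

theorem e_exp_sum_le (h : S.MomentData X p α d j0) {m N : ℕ} (hm : j0 ≤ m) (hmN : m ≤ N)
    {c : ℝ} (hc : 0 < c) {σ : ℝ} (hσ : σ = 1 ∨ σ = -1) {lam : ℝ} (hlam : 0 < lam)
    (hlb : 2 * lam * (α * S.s X N / S.t X N) ≤ 1) :
    S.e (fun ω => Real.exp (lam * ∑ j ∈ Finset.Ico (m + 1) (N + 1), σ * clip c (X j ω))) ≤
      Real.exp (lam * S.meanBound X c N +
        (lam ^ 2 / 2 * (1 + 2 * lam * (α * S.s X N / S.t X N)) * S.sq X N +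
          Real.exp (lam * c) *
            (S.rho X p α j0 N * (S.a X N / (α * S.s X N / S.t X N)) ^ p))) := by
  have hb := h.threshold_pos (hm.trans hmN)
  rw [e_exp_sum_clip h.mem h.indep hc.le σ lam (by omega)]
  have hsum := sum_expBound_le h.mem h.sqL1 hc hlam hb le_rfl
    (by linarith [h.two_le_p]) (m := m + 1) (by omega : j0 ≤ m + 1) (N := N)
    fun j hj hjN => h.excess_ne_top hj hjN
  rw [← lamFrom, h.lamFrom_div (hm.trans hmN) hb] at hsum
  refine le_trans ?_ (Real.exp_le_exp.2 hsum)
  rw [Real.exp_sum]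
  refine Finset.prod_le_prod (fun j _ => e_nonneg (exp_clip_L1 (h.mem j) hc.le σ lam)
    fun _ => (Real.exp_pos _).le) fun j hj => ?_
  have hj := Finset.mem_Ico.1 hj
  exact e_exp_clip_le (h.mem j) (h.sqL1 j) hc hσ hlam hb hlb h.two_le_p
    (h.excess_ne_top (by omega) (by omega))

/-- The product of the one-variable lower bounds. The variance lost by truncating at `2b` is
measured by `rho`, and the bias enters twice because of `exp_le_of_two_bounds`. -/
theorem le_e_exp_sum (h : S.MomentData X p α d j0) {m N : ℕ} (hm : j0 ≤ m) (hmN : m ≤ N)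
    {c : ℝ} (hc : 0 < c) {σ : ℝ} (hσ : σ = 1 ∨ σ = -1) {lam b : ℝ} (hlam : 0 < lam)
    (hb : b = α * S.s X N / S.t X N) (hlb : lam * b ≤ α) (hα : 2 * α ≤ 1) (hbc : 2 * b ≤ c) :
    Real.exp ((1 - α) * (lam ^ 2 / 2 * (1 - 2 * α) * (S.sq X N - S.sq X m -
        4 * b ^ 2 * (S.rho X p α j0 N * (S.a X N / b) ^ p))) - 2 * (lam * S.meanBound X c N)) ≤
      S.e (fun ω => Real.exp (lam * ∑ j ∈ Finset.Ico (m + 1) (N + 1), σ * clip c (X j ω))) := by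
  have hb0 : 0 < b := hb ▸ h.threshold_pos (hm.trans hmN)
  have hαp := h.α_pos
  have hlb0 : 0 < lam * b := by positivity
  rw [e_exp_sum_clip h.mem h.indep hc.le σ lam (by omega)]
  set z : ℕ → ℝ := fun j => S.e (fun ω => (min |X j ω| (2 * b)) ^ 2) with hz
  set w : ℕ → ℝ := fun j => lam ^ 2 / 2 * (1 - 2 * lam * b) * z j with hw
  set μ : ℕ → ℝ := fun j => S.meanAbs (X j) + 1 / (4 * c) * S.e (fun ω => X j ω ^ 2) with hμ
  have hterm : ∀ j ∈ Finset.Ico (m + 1) (N + 1),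
      Real.exp (w j - w j ^ 2 - 2 * (lam * μ j)) ≤
        S.e (fun ω => Real.exp (lam * (σ * clip c (X j ω)))) := fun j _ =>
    le_e_exp_clip (h.mem j) (h.sqL1 j) hc hσ hlam hb0 (by linarith) hbc rfl
  refine le_trans ?_ (Finset.prod_le_prod (fun j _ => (Real.exp_pos _).le) hterm)
  rw [← Real.exp_sum]
  refine Real.exp_le_exp.2 ?_
  have hz0 : ∀ j, 0 ≤ z j := fun j => by
    refine e_nonneg (L1.of_le (h.sqL1 j) ?_ fun ω => ?_) fun _ => sq_nonneg _
    · refine S.comp_mem_one (S.comp_mem_one (h.mem j) (φ := fun x => min |x| (2 * b))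
        (CLLip.of_lipschitz (K := 1) fun x y => ?_)) cLLip_sq
      rw [one_mul]
      refine (abs_min_sub_min_le_max _ _ _ _).trans (max_le (abs_abs_sub_abs_le_abs_sub x y) ?_)
      simp
    · rw [abs_of_nonneg (sq_nonneg (min |X j ω| (2 * b))), abs_of_nonneg (sq_nonneg (X j ω)),
        ← sq_abs (X j ω)]
      exact pow_le_pow_left₀ (le_min (abs_nonneg _) (by linarith)) (min_le_left _ _) 2
  have hz4 : ∀ j, z j ≤ (2 * b) ^ 2 := fun j => e_min_sq_le (h.mem j) (by linarith)
  have hwlow : ∀ j, lam ^ 2 / 2 * (1 - 2 * α) * z j ≤ w j := fun j => by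
    simp only [hw]
    refine mul_le_mul_of_nonneg_right (mul_le_mul_of_nonneg_left (by linarith) (by positivity))
      (hz0 j)
  have hw0 : ∀ j, 0 ≤ w j := fun j =>
    (mul_nonneg (mul_nonneg (by positivity) (by linarith)) (hz0 j)).trans (hwlow j)
  -- `w j ≤ 2 (lam b) ^ 2 ≤ 2 α² ≤ α`, so that the second-order loss `w j ^ 2` is at most `α * w j`.
  have hwα : ∀ j, w j ≤ α := fun j => by
    have h1 : w j ≤ lam ^ 2 / 2 * z j := by
      simp only [hw]
      refine mul_le_mul_of_nonneg_right ?_ (hz0 j)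
      refine mul_le_of_le_one_right (by positivity) (by linarith)
    have h3 : lam ^ 2 / 2 * z j ≤ lam ^ 2 / 2 * (2 * b) ^ 2 :=
      mul_le_mul_of_nonneg_left (hz4 j) (by positivity)
    have h4 : lam ^ 2 / 2 * (2 * b) ^ 2 = 2 * (lam * b) * (lam * b) := by ring
    nlinarith
  have hzsum : S.sq X N - S.sq X m - 4 * b ^ 2 * (S.rho X p α j0 N * (S.a X N / b) ^ p) ≤
      ∑ j ∈ Finset.Ico (m + 1) (N + 1), z j := by
    rw [← sum_sq_Ico hmN, ← h.lamFrom_div (hm.trans hmN) hb0]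
    have h1 : ∀ j ∈ Finset.Ico (m + 1) (N + 1), S.e (fun ω => X j ω ^ 2) ≤
        z j + 4 * b ^ 2 / b ^ p * (S.excess (X j) p b).toReal := fun j hj => by
      have hj := Finset.mem_Ico.1 hj
      exact e_sq_le_truncation (h.mem j) (h.sqL1 j) hb0 h.two_le_p
        (h.excess_ne_top' (N := N) (by omega) (by omega) hb.ge)
    have h3 := Finset.sum_le_sum h1
    rw [Finset.sum_add_distrib, ← Finset.mul_sum] at h3
    have h4 : ∑ j ∈ Finset.Ico (m + 1) (N + 1), (S.excess (X j) p b).toReal ≤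
        S.lamFrom X p α j0 N := by
      rw [lamFrom, ← hb]
      exact Finset.sum_le_sum_of_subset_of_nonneg (Finset.Ico_subset_Ico_left (by omega))
        fun j _ _ => ENNReal.toReal_nonneg
    have hbp : 0 < b ^ p := Real.rpow_pos_of_pos hb0 p
    have h5 : 4 * b ^ 2 / b ^ p * ∑ j ∈ Finset.Ico (m + 1) (N + 1), (S.excess (X j) p b).toReal ≤
        4 * b ^ 2 / b ^ p * S.lamFrom X p α j0 N := by gcongr
    have h6 : 4 * b ^ 2 / b ^ p * S.lamFrom X p α j0 N =
        4 * b ^ 2 * (S.lamFrom X p α j0 N / b ^ p) := by ring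
    linarith
  have hA : 0 ≤ lam ^ 2 / 2 * (1 - 2 * α) := mul_nonneg (by positivity) (by linarith)
  have hμsum := mul_le_mul_of_nonneg_left (sum_mean_le h.sqL1 hc (m + 1) N) hlam.le
  calc _ ≤ (1 - α) * (lam ^ 2 / 2 * (1 - 2 * α) * ∑ j ∈ Finset.Ico (m + 1) (N + 1), z j) -
        2 * (lam * ∑ j ∈ Finset.Ico (m + 1) (N + 1), μ j) := by
        have h1 := mul_le_mul_of_nonneg_left (mul_le_mul_of_nonneg_left hzsum hA)
          (by linarith : 0 ≤ 1 - α)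
        linarith
    _ = ∑ j ∈ Finset.Ico (m + 1) (N + 1), ((1 - α) * (lam ^ 2 / 2 * (1 - 2 * α) * z j) -
        2 * (lam * μ j)) := by
        rw [Finset.sum_sub_distrib]; simp only [Finset.mul_sum]
    _ ≤ _ := by
        refine Finset.sum_le_sum fun j _ => ?_
        have h1 := mul_le_mul_of_nonneg_left (hwlow j) (by linarith : 0 ≤ 1 - α)
        have h3 := mul_nonneg (hw0 j) (sub_nonneg.2 (hwα j))
        nlinarith

end MomentData

end SublinearExpectationSpace

namespace SublinearExpectationSpace

variable {Ω : Type*} [MeasurableSpace Ω] {S : SublinearExpectationSpace Ω} {X : ℕ → Ω → ℝ}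

theorem bl_ramp_sum_clip {c : ℝ} (hc : 0 ≤ c) (σ : ℝ) (m n : ℕ) (u : ℝ) {w : ℝ} (hw : 0 < w) :
    BL m n (fun x => ramp u w (∑ j ∈ Finset.Ico m n, σ * clip c (x j))) :=
  (bl_sum_clip hc σ m n).comp_lip (ramp_lip hw)

/-- In `exp_le_three` the parts below `u` and above `v` each contribute at most `exp C ≤ exp B / 4`.
Half of the exponential mass therefore lies on the middle part, where it is at most `exp (lam * v)`
times the ramp. -/
theorem le_e_ramp_of_exp (hX : ∀ n, X n ∈ S.H) {c : ℝ} (hc : 0 ≤ c) {σ : ℝ} {m n : ℕ}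
    {lam β u u' v w B C : ℝ} (hw : 0 < w) (hlam : 0 ≤ lam) (hβ : 0 ≤ β) (hu' : u' ≤ u)
    (h0 : Real.exp B ≤ S.e (fun ω => Real.exp (lam * ∑ j ∈ Finset.Ico m n, σ * clip c (X j ω))))
    (h1 : S.e (fun ω => Real.exp (((1 - β) * lam) * ∑ j ∈ Finset.Ico m n, σ * clip c (X j ω))) ≤
      Real.exp (C - β * lam * u))
    (h2 : S.e (fun ω => Real.exp (((1 + β) * lam) * ∑ j ∈ Finset.Ico m n, σ * clip c (X j ω))) ≤
      Real.exp (C + β * lam * v)) (hBC : C + 3 ≤ B) :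
    1 / 2 * Real.exp (B - lam * v) ≤
      S.e (fun ω => ramp u' w (∑ j ∈ Finset.Ico m n, σ * clip c (X j ω))) := by
  have hE : ∀ l : ℝ, S.L1 (fun ω => Real.exp (l * ∑ j ∈ Finset.Ico m n, σ * clip c (X j ω))) :=
    fun l => bl_L1 hX ((BL.const l).mul (bl_sum_clip hc σ m n)).exp
  have hR : S.L1 (fun ω => ramp u' w (∑ j ∈ Finset.Ico m n, σ * clip c (X j ω))) :=
    bl_L1 hX (bl_ramp_sum_clip hc σ m n u' hw)
  set R := S.e (fun ω => ramp u' w (∑ j ∈ Finset.Ico m n, σ * clip c (X j ω)))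
  have hA1 := (hE ((1 - β) * lam)).smul (Real.exp (β * lam * u))
  have hA2 := (hE ((1 + β) * lam)).smul (Real.exp (-(β * lam * v)))
  have hA3 := hR.smul (Real.exp (lam * v))
  have h4 := e_mono (hE lam) (hA1.add (hA2.add hA3)) fun ω =>
    exp_le_three (v := v) (s := ∑ j ∈ Finset.Ico m n, σ * clip c (X j ω)) hw hlam hβ hu'
  have h5 := e_add_le hA1 (hA2.add hA3)
  have h6 := e_add_le hA2 hA3
  rw [e_smul (hE _) (Real.exp_pos _).le] at h5 h6
  rw [e_smul hR (Real.exp_pos _).le] at h6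
  have h7 := mul_le_mul_of_nonneg_left h1 (Real.exp_pos (β * lam * u)).le
  have h8 := mul_le_mul_of_nonneg_left h2 (Real.exp_pos (-(β * lam * v))).le
  rw [← Real.exp_add] at h7 h8
  rw [show β * lam * u + (C - β * lam * u) = C by ring] at h7
  rw [show -(β * lam * v) + (C + β * lam * v) = C by ring] at h8
  have h9 : 4 * Real.exp C ≤ Real.exp B := by
    have h3 : (4 : ℝ) ≤ Real.exp 3 := by linarith [Real.add_one_le_exp (3 : ℝ)]
    calc 4 * Real.exp C ≤ Real.exp 3 * Real.exp C := by gcongr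
      _ = Real.exp (C + 3) := by rw [← Real.exp_add, add_comm]
      _ ≤ _ := Real.exp_le_exp.2 hBC
  have h10 : 1 / 2 * Real.exp B ≤ Real.exp (lam * v) * R := by linarith
  have h11 : Real.exp B = Real.exp (lam * v) * Real.exp (B - lam * v) := by
    rw [← Real.exp_add]; ring_nf
  rw [h11] at h10
  refine le_of_mul_le_mul_left ?_ (Real.exp_pos (lam * v))
  linarith

namespace MomentData

variable {p α d : ℝ} {j0 : ℕ}

-- With `τ = t²`, the logarithmic exponential moment at `ς * lam` is at most `A τ (ς² + β²) + C1`,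
-- and at `lam` it is at least `A τ (1 - β²)`, where `A = κ² / 2`. Comparing `ς = 1 ± β` with `ς =
-- 1` concentrates the tilted mass near `κ a`. Dropping the indices up to `m` loses only a fraction
-- `β² / 8` of the variance.
set_option maxHeartbeats 400000 in
theorem eventually_le_e_ramp (h : S.MomentData X p α d j0) (hq : Tendsto (S.sq X) atTop atTop)
    {β : ℝ} (hβ : 0 < β) (hβ1 : β ≤ 1 / 20) (hα : α = β ^ 2 / 64) {δ : ℝ} (hδ : 0 < δ) :
    ∀ᶠ N in atTop, S.meanBound X (δ * S.a X N) N ≤ β ^ 2 / 16 * S.a X N →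
      ∀ m, j0 ≤ m → m ≤ N → 8 * S.sq X m ≤ β ^ 2 * S.sq X N →
      S.rho X p α j0 N ≤ Real.exp (-(4 * δ * S.t X N ^ 2)) →
      ∀ σ : ℝ, (σ = 1 ∨ σ = -1) →
      1 / 2 * Real.exp (-(1 - 2 * β) * S.loglog X N) ≤
        S.e (fun ω => ramp ((1 - 5 * β) * S.a X N) (β * S.a X N)
          (∑ j ∈ Finset.Ico (m + 1) (N + 1), σ * clip (δ * S.a X N) (X j ω))) := by
  have hp0 : 0 < p := by linarith [h.two_le_p]
  have hα0 := h.α_pos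
  have hβ2 : 0 < β ^ 2 := by positivity
  have hβ2' : β ^ 2 ≤ 1 / 400 := by nlinarith
  have n1 : 36 / 100 ≤ (1 - 3 * β) ^ 2 / 2 := by nlinarith
  have n2 : (1 - 3 * β) * α ≤ α := by nlinarith
  have n3 : (1 - β) * (1 - 3 * β) ≤ 1 := by nlinarith
  have n4 : (1 + β) * (1 - 3 * β) ≤ 1 := by nlinarith
  have n5 : 1 - 5 * β ≤ (1 - 2 * β) * (1 - 3 * β) := by nlinarith
  have n6 : 1 - 3 * α ≤ (1 - α) * (1 - 2 * α) := by nlinarith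
  set C1 := p ^ p / (δ * α) ^ p with hC1
  have hC10 : 0 ≤ C1 := by positivity
  have htq : Tendsto (fun N => S.t X N ^ 2) atTop atTop :=
    (tendsto_pow_atTop two_ne_zero).comp (tendsto_t hq)
  -- The three thresholds ensure in turn that the clipping level exceeds `2b`, that the truncated
  -- variance is at most `β² / 8` of the total, and that the concentration gap `A τ β²` exceeds `C1
  -- + 3`.
  filter_upwards [htq.eventually_ge_atTop (2 * α / δ),
    htq.eventually_ge_atTop (32 * α ^ 2 * C1 / β ^ 2),
    htq.eventually_ge_atTop (3 * (C1 + 3) / β ^ 2)] with N hN1 hN2 hN3 hmean m hm hmN hsqm hrho σ hσ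
  rw [div_le_iff₀ hδ] at hN1
  rw [div_le_iff₀ hβ2] at hN2 hN3
  have hsq := h.sq_pos (hm.trans hmN)
  have hs := s_pos hsq
  have ht := t_pos (S := S) (X := X) N
  have hst : S.a X N = S.s X N * S.t X N := rfl
  have ha := a_pos hsq
  have hrho0 := rho_nonneg (S := S) (X := X) p α j0 N
  have hss := s_sq h.sqL1 N
  have htt := t_sq (S := S) (X := X) N
  have hb := h.threshold_pos (hm.trans hmN)
  have hab : S.a X N / (α * S.s X N / S.t X N) = S.t X N ^ 2 / α := by rw [hst]; field_simp
  have hb2 : (α * S.s X N / S.t X N) ^ 2 * S.t X N ^ 2 = α ^ 2 * S.sq X N := by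
    rw [← hss]; field_simp
  have hbc : 2 * (α * S.s X N / S.t X N) ≤ δ * S.a X N := by
    rw [hst, mul_div_assoc', div_le_iff₀ ht]
    have := mul_le_mul_of_nonneg_right hN1 hs.le
    linarith
  have hup : ∀ {l : ℝ}, 0 < l → 2 * l * (α * S.s X N / S.t X N) ≤ 1 → _ := fun {l} h1 h2 =>
    h.e_exp_sum_le hm hmN (c := δ * S.a X N) (by positivity) hσ (lam := l) h1 h2
  have hlow : ∀ {l : ℝ}, 0 < l → l * (α * S.s X N / S.t X N) ≤ α → _ := fun {l} h1 h2 =>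
    h.le_e_exp_sum hm hmN (c := δ * S.a X N) (by positivity) hσ (lam := l) h1 rfl h2
      (by rw [hα]; linarith) hbc
  rw [hab] at hup hlow
  set ρ := S.rho X p α j0 N
  set τ := S.t X N ^ 2 with hτ
  have hτ0 : 0 < τ := by positivity
  set b := α * S.s X N / S.t X N with hbdef
  set mB := S.meanBound X (δ * S.a X N) N
  set κ := 1 - 3 * β with hκ
  have hκ0 : 0 < κ := by rw [hκ]; linarith
  set lam := κ * (S.t X N / S.s X N) with hlam
  have hlam0 : 0 < lam := by positivity
  have hlb : lam * b = κ * α := by rw [hlam, hbdef]; field_simp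
  have hla : lam * S.a X N = κ * τ := by rw [hlam, hst, hτ]; field_simp
  have hls : lam ^ 2 * S.sq X N = κ ^ 2 * τ := by rw [← hss, hlam, hτ]; field_simp
  have hA : 36 / 100 ≤ κ ^ 2 / 2 := n1
  set A := κ ^ 2 / 2 with hAdef
  have hpow : (τ / α) ^ p ≤ C1 * Real.exp (δ * τ) := by
    have h1 : τ / α = δ * τ / (δ * α) := by field_simp
    rw [h1, Real.div_rpow (by positivity) (by positivity), hC1]
    have h0 : 0 ≤ (δ * α) ^ p := by positivity
    exact (div_le_div_of_nonneg_right (rpow_le_mul_exp hp0 (by positivity)) h0).trans_eq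
      (mul_div_right_comm _ _ _)
  have hpow0 : 0 ≤ (τ / α) ^ p := by positivity
  have hrp2 : Real.exp (δ * τ) * (ρ * (τ / α) ^ p) ≤ C1 := by
    calc _ ≤ Real.exp (δ * τ) * (Real.exp (-(4 * δ * τ)) * (C1 * Real.exp (δ * τ))) := by gcongr
      _ = C1 * Real.exp (-(2 * (δ * τ))) := by
          rw [show -(2 * (δ * τ)) = δ * τ + (-(4 * δ * τ) + δ * τ) by ring, Real.exp_add,
            Real.exp_add]
          ring
      _ ≤ C1 * 1 := by
          gcongr; exact Real.exp_le_one_iff.2 (by linarith [mul_pos hδ hτ0])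
      _ = C1 := mul_one _
  have hrp : ρ * (τ / α) ^ p ≤ C1 := by
    refine le_trans ?_ hrp2
    exact le_mul_of_one_le_left (by positivity) (Real.one_le_exp (by positivity))
  have hrp0 : 0 ≤ ρ * (τ / α) ^ p := by positivity
  have hmB : lam * mB ≤ β ^ 2 / 16 * (κ * τ) := by
    rw [← hla]
    calc lam * mB ≤ lam * (β ^ 2 / 16 * S.a X N) := by gcongr
      _ = _ := by ring
  have hupper : ∀ ς : ℝ, 0 < ς → ς * κ ≤ 1 →
      S.e (fun ω => Real.exp ((ς * lam) * ∑ j ∈ Finset.Ico (m + 1) (N + 1),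
        σ * clip (δ * S.a X N) (X j ω))) ≤ Real.exp (A * τ * (ς ^ 2 + β ^ 2) + C1) := by
    intro ς hς0 hς
    have hk : ς * κ * α ≤ 1 * α := mul_le_mul_of_nonneg_right hς hα0.le
    have hk0 : 0 < ς * κ := by positivity
    refine (hup (l := ς * lam) (by positivity) ?_).trans (Real.exp_le_exp.2 ?_)
    · rw [show 2 * (ς * lam) * b = 2 * ς * (lam * b) by ring, hlb]
      have : α ≤ 1 / 2 := by rw [hα]; linarith
      linarith
    · have e1 : ς * lam * mB ≤ β ^ 2 / 16 * τ := by
        calc ς * lam * mB = ς * (lam * mB) := by ring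
          _ ≤ ς * (β ^ 2 / 16 * (κ * τ)) := by gcongr
          _ = ς * κ * (β ^ 2 / 16 * τ) := by ring
          _ ≤ 1 * (β ^ 2 / 16 * τ) := by gcongr
          _ = _ := one_mul _
      have e2 : (ς * lam) ^ 2 / 2 * (1 + 2 * (ς * lam) * b) * S.sq X N ≤
          A * τ * ς ^ 2 + α * τ := by
        have : (ς * lam) ^ 2 / 2 * (1 + 2 * (ς * lam) * b) * S.sq X N =
            ς ^ 2 / 2 * (1 + 2 * ς * (lam * b)) * (lam ^ 2 * S.sq X N) := by ring
        rw [this, hlb, hls]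
        have e3 : (ς * κ) ^ 2 * (ς * κ * α) ≤ 1 * α := by
          have : (ς * κ) ^ 2 ≤ 1 := pow_le_one₀ hk0.le hς
          exact mul_le_mul this (by linarith) (by positivity) zero_le_one
        have e4 := mul_le_mul_of_nonneg_right e3 hτ0.le
        rw [hAdef]
        linarith
      have e5 : Real.exp (ς * lam * (δ * S.a X N)) * (ρ * (τ / α) ^ p) ≤ C1 := by
        refine le_trans (mul_le_mul_of_nonneg_right (Real.exp_le_exp.2 ?_) hrp0) hrp2
        calc ς * lam * (δ * S.a X N) = ς * δ * (lam * S.a X N) := by ring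
          _ = ς * κ * (δ * τ) := by rw [hla]; ring
          _ ≤ 1 * (δ * τ) := by gcongr
          _ = _ := one_mul _
      have e6 : (36 / 100) * (τ * β ^ 2) ≤ A * (τ * β ^ 2) :=
        mul_le_mul_of_nonneg_right hA (by positivity)
      have e7 : 0 ≤ τ * β ^ 2 := by positivity
      rw [hα] at e2
      linarith
  have hlower : Real.exp (A * τ * (1 - β ^ 2)) ≤
      S.e (fun ω => Real.exp (lam * ∑ j ∈ Finset.Ico (m + 1) (N + 1),
        σ * clip (δ * S.a X N) (X j ω))) := by
    refine le_trans (Real.exp_le_exp.2 ?_) (hlow hlam0 (by rw [hlb]; exact n2))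
    have e1 : 4 * b ^ 2 * (ρ * (τ / α) ^ p) ≤ β ^ 2 / 8 * S.sq X N := by
      have e2 : 4 * b ^ 2 * (ρ * (τ / α) ^ p) ≤ 4 * b ^ 2 * C1 := by gcongr
      refine e2.trans ?_
      refine le_of_mul_le_mul_right ?_ hτ0
      calc 4 * b ^ 2 * C1 * τ = 4 * C1 * (b ^ 2 * τ) := by ring
        _ = 1 / 8 * S.sq X N * (32 * α ^ 2 * C1) := by rw [hb2]; ring
        _ ≤ 1 / 8 * S.sq X N * (τ * β ^ 2) := by gcongr
        _ = _ := by ring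
    have e3 : (1 - β ^ 2 / 4) * S.sq X N ≤
        S.sq X N - S.sq X m - 4 * b ^ 2 * (ρ * (τ / α) ^ p) := by linarith
    have hα1 : α ≤ 1 / 25600 := by rw [hα]; linarith
    have e4 : A * τ * (1 - β ^ 2 / 4) ≤ lam ^ 2 / 2 *
        (S.sq X N - S.sq X m - 4 * b ^ 2 * (ρ * (τ / α) ^ p)) := by
      calc A * τ * (1 - β ^ 2 / 4) = 1 / 2 * (κ ^ 2 * τ) * (1 - β ^ 2 / 4) := by rw [hAdef]; ring
        _ = lam ^ 2 / 2 * ((1 - β ^ 2 / 4) * S.sq X N) := by rw [← hls]; ring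
        _ ≤ _ := by gcongr
    have e5 : (1 - 5 / 16 * β ^ 2) * (A * τ) ≤
        (1 - α) * (1 - 2 * α) * (A * τ * (1 - β ^ 2 / 4)) := by
      have e8 : 1 - 5 / 16 * β ^ 2 ≤ (1 - α) * (1 - 2 * α) * (1 - β ^ 2 / 4) := by
        have e10 := mul_le_mul_of_nonneg_right n6 (by linarith : 0 ≤ 1 - β ^ 2 / 4)
        have e11 : 0 ≤ α * β ^ 2 := by positivity
        rw [hα] at e10 e11 ⊢
        linarith
      have e12 : 0 ≤ A * τ := by positivity
      have := mul_le_mul_of_nonneg_right e8 e12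
      linarith
    have e6 := mul_le_mul_of_nonneg_left e4
      (mul_nonneg (by linarith : 0 ≤ 1 - α) (by linarith : 0 ≤ 1 - 2 * α))
    have e7 : lam * mB ≤ β ^ 2 / 16 * τ := by
      refine hmB.trans ?_
      have : κ * τ ≤ 1 * τ := mul_le_mul_of_nonneg_right (by rw [hκ]; linarith) hτ0.le
      have := mul_le_mul_of_nonneg_left this (by positivity : 0 ≤ β ^ 2 / 16)
      linarith
    have e13 : (36 / 100) * (τ * β ^ 2) ≤ A * (τ * β ^ 2) :=
      mul_le_mul_of_nonneg_right hA (by positivity)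
    have e7' : 0 ≤ τ * β ^ 2 := by positivity
    linarith
  -- The edges `(1 ∓ 2β) κ a` are chosen so that the two side bounds have the same constant `C = A τ
  -- (1 - 2β²) + C1`, smaller than `B` by `A τ β² - C1`.
  have hfin := le_e_ramp_of_exp h.mem (c := δ * S.a X N) (by positivity) (σ := σ) (m := m + 1)
    (n := N + 1) (lam := lam) (β := β) (u := (1 - 2 * β) * κ * S.a X N)
    (u' := (1 - 5 * β) * S.a X N) (v := (1 + 2 * β) * κ * S.a X N) (w := β * S.a X N)
    (B := A * τ * (1 - β ^ 2)) (C := A * τ * (1 - 2 * β ^ 2) + C1) (by positivity) hlam0.le hβ.le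
    ?_ hlower ((hupper (1 - β) (by linarith) ?_).trans_eq ?_)
    ((hupper (1 + β) (by linarith) ?_).trans_eq ?_) ?_
  · refine le_trans ?_ hfin
    refine mul_le_mul_of_nonneg_left (Real.exp_le_exp.2 ?_) (by norm_num)
    have e1 : lam * ((1 + 2 * β) * κ * S.a X N) = (1 + 2 * β) * κ * (κ * τ) := by
      rw [← hla]; ring
    have e2 : S.loglog X N = τ / 2 := by rw [htt]; ring
    rw [e1, e2, hAdef]
    have e3 : κ ^ 2 * (1 + 4 * β + β ^ 2) ≤ 1 - 2 * β := by
      rw [hκ]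
      have : (1 - 3 * β) ^ 2 * (1 + 4 * β + β ^ 2) =
          1 - 2 * β - β ^ 2 * (14 - 30 * β - 9 * β ^ 2) := by ring
      rw [this]
      have := mul_nonneg hβ2.le (by linarith : 0 ≤ 14 - 30 * β - 9 * β ^ 2)
      linarith
    have := mul_le_mul_of_nonneg_right e3 hτ0.le
    linarith
  · exact mul_le_mul_of_nonneg_right n5 ha.le
  · exact n3
  · congr 1
    have : β * lam * ((1 - 2 * β) * κ * S.a X N) = β * (1 - 2 * β) * κ * (κ * τ) := by
      rw [← hla]; ring
    rw [this, hAdef]; ring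
  · exact n4
  · congr 1
    have : β * lam * ((1 + 2 * β) * κ * S.a X N) = β * (1 + 2 * β) * κ * (κ * τ) := by
      rw [← hla]; ring
    rw [this, hAdef]; ring
  · have e6 : (36 / 100) * (τ * β ^ 2) ≤ A * (τ * β ^ 2) :=
      mul_le_mul_of_nonneg_right hA (by positivity)
    have e7 : 0 ≤ τ * β ^ 2 := by positivity
    linarith

end MomentData

end SublinearExpectationSpace

/-! ### Finite ranges of indices that contain a large increment. -/

namespace SublinearExpectationSpace

variable {Ω : Type*} [MeasurableSpace Ω] {S : SublinearExpectationSpace Ω} {X : ℕ → Ω → ℝ}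

/-- The conjugate expectation of a product of independent factors `1 - g i`. -/
theorem conj_prod_one_sub_le (hX : ∀ n, X n ∈ S.H) (hind : S.IndepSeq X) {k : ℕ → ℕ}
    (hk : Monotone k) {g : ℕ → (ℕ → ℝ) → ℝ} (hg : ∀ i, BL (k i) (k (i + 1)) (g i))
    (hg1 : ∀ i x, g i x ≤ 1) (I : ℕ) :
    BL (k 0) (k I) (fun x => ∏ i ∈ Finset.range I, (1 - g i x)) ∧
      0 ≤ - S.e (fun ω => - ∏ i ∈ Finset.range I, (1 - g i (fun j => X j ω))) ∧
      - S.e (fun ω => - ∏ i ∈ Finset.range I, (1 - g i (fun j => X j ω))) ≤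
        Real.exp (- ∑ i ∈ Finset.range I, S.e (fun ω => g i (fun j => X j ω))) := by
  have hV0 : ∀ I x, 0 ≤ ∏ i ∈ Finset.range I, (1 - g i x) := fun I x =>
    Finset.prod_nonneg fun i _ => sub_nonneg.2 (hg1 i x)
  have hG : ∀ i, BL (k i) (k (i + 1)) (fun x => 1 - g i x) := fun i => by
    simpa [sub_eq_add_neg] using (BL.const 1).add (hg i).neg
  induction I with
  | zero => exact ⟨by simpa using BL.const 1, by simp [e_const], by simp [e_const]⟩
  | succ I ih =>
    obtain ⟨ih1, ih2, ih3⟩ := ih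
    have hc := conj_mul_bl hX hind (hk (Nat.le_succ I)) (ih1.mono (Nat.zero_le _) le_rfl)
      (hV0 I) (hG I) fun x => sub_nonneg.2 (hg1 I x)
    have hgL := bl_L1 hX (hg I)
    have h1 : S.e (fun ω => - (1 - g I (fun i => X i ω))) =
        -1 + S.e (fun ω => g I (fun i => X i ω)) := by
      rw [← e_const_add hgL]; congr 1; ext ω; ring
    have h2 : S.e (fun ω => g I (fun i => X i ω)) ≤ 1 := by
      have := e_mono hgL (L1.const 1) fun ω => hg1 I _
      rwa [e_const] at this
    rw [h1] at hc
    simp only [Finset.prod_range_succ, Finset.sum_range_succ]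
    rw [hc, neg_add (∑ i ∈ Finset.range I, S.e (fun ω => g i (fun j => X j ω))), Real.exp_add]
    refine ⟨(ih1.mono le_rfl (hk (Nat.le_succ I))).mul ((hG I).mono (hk (Nat.zero_le I)) le_rfl),
      mul_nonneg ih2 (by linarith), mul_le_mul ih3 ?_ (by linarith) (Real.exp_pos _).le⟩
    have := Real.add_one_le_exp (- S.e (fun ω => g I (fun i => X i ω)))
    linarith

/-- The divergence condition. -/
def DivergentVariances (S : SublinearExpectationSpace Ω) (X : ℕ → Ω → ℝ) : Prop :=
  ∀ δ : ℝ, 0 < δ → ¬ Summable (fun n => (S.sq X n)⁻¹ * pLog (S.sq X n) ^ (δ - 1) *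
    (S.E (fun ω => X n ω ^ 2)).toReal)

/-- `F` is a product of factors `1 - g i` over the blocks of a geometric chain, with lower
expectation at most `exp (-∑ e (g i))`, and the sum diverges. If `F x < 1`, some `g i` is positive
and its block shows a large increment. The level `δ` is fixed before `K0` and `ε`, so the same one
serves for all later ranges. -/
theorem LILData.exists_range (h : S.LILData X) (hdiv : S.DivergentVariances X) {σ : ℝ}
    (hσ : σ = 1 ∨ σ = -1) {β : ℝ} (hβ : 0 < β) (hβ1 : β ≤ 1 / 20) :
    ∃ δ > 0, ∀ K0 : ℕ, ∀ ε > 0, ∃ K1, K0 < K1 ∧ ∃ F : (ℕ → ℝ) → ℝ, BL K0 K1 F ∧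
      (∀ x, 0 ≤ F x) ∧ (∀ x, F x ≤ 1) ∧ - S.e (fun ω => - F (fun i => X i ω)) ≤ ε ∧
      ∀ x, F x < 1 → ∃ m N, K0 ≤ m ∧ m < N ∧ 8 * S.sq X m ≤ β ^ 2 * S.sq X N ∧
        (1 - 6 * β) * S.a X N <
          ∑ j ∈ Finset.Ico (m + 1) (N + 1), σ * clip (δ * S.a X N) (x j) := by
  classical
  have hβ2 : 0 < β ^ 2 := by positivity
  obtain ⟨p, d, hp, hd, hsum⟩ := h.moments (β ^ 2 / 64) (by positivity)
  obtain ⟨j0, hj0⟩ := (h.sqTop.eventually_ge_atTop 1).exists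
  have hj0p : 0 < S.sq X j0 := by linarith
  have hM : S.MomentData X p (β ^ 2 / 64) d j0 :=
    ⟨h.mem, h.indep, h.sqL1, hp, by positivity, hd, hj0p, hsum⟩
  set δ := 1 / (16 * (d + 1)) with hδ
  have hδ0 : 0 < δ := by positivity
  refine ⟨δ, hδ0, fun K0 ε hε => ?_⟩
  obtain ⟨K, hK⟩ := eventually_atTop.1
    ((hM.eventually_le_e_ramp h.sqTop hβ hβ1 rfl hδ0).and
      ((tendsto_meanBound h.sqL1 h.sqTop h.mean hδ0 (by positivity : 0 < β ^ 2 / 16)).and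
        ((eventually_ge_atTop K0).and ((eventually_ge_atTop j0).and
          (h.sqTop.eventually_ge_atTop (Real.exp (Real.exp 1)))))))
  -- A ratio this large makes everything before a block negligible against its end.
  have hθ : 1 < 8 / β ^ 2 := by rw [one_lt_div hβ2]; nlinarith
  obtain ⟨m, hm0, hm⟩ := exists_geomChain h.sqTop hθ
    ((Real.exp_pos _).trans_le (hK K le_rfl).2.2.2.2)
  have hlt : ∀ i, m i < m (i + 1) := fun i => hm.strictMono (Nat.lt_succ_self i)
  have hmK : ∀ i, K ≤ m i := fun i => hm0 ▸ hm.strictMono.monotone (Nat.zero_le i)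
  have hgrow : ∀ i, 8 * S.sq X (m i) ≤ β ^ 2 * S.sq X (m (i + 1)) := fun i => by
    have := mul_le_mul_of_nonneg_left (hm.growth i) hβ2.le
    rwa [← mul_assoc, mul_div_cancel₀ _ hβ2.ne'] at this
  set c : ℕ → ℝ := fun i => δ * S.a X (m (i + 1)) with hc
  have hapos : ∀ i, 0 < S.a X (m i) := fun i => a_pos (hm.pos i)
  have hc0 : ∀ i, 0 ≤ c i := fun i => (mul_pos hδ0 (hapos _)).le
  set f : ℕ → (ℕ → ℝ) → ℝ := fun i x =>
    ramp ((1 - 5 * β) * S.a X (m (i + 1))) (β * S.a X (m (i + 1)))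
      (∑ j ∈ Finset.Ico (m i + 1) (m (i + 1) + 1), σ * clip (c i) (x j)) with hf
  have hfBL : ∀ i, BL (m i + 1) (m (i + 1) + 1) (f i) := fun i =>
    bl_ramp_sum_clip (hc0 i) σ _ _ _ (mul_pos hβ (hapos _))
  -- The lower bound is available only where `rho` is small; the other blocks are switched off by `g
  -- i = 0`.
  set good : ℕ → Prop := fun i =>
    S.rho X p (β ^ 2 / 64) j0 (m (i + 1)) ≤ Real.exp (-(4 * δ * S.t X (m (i + 1)) ^ 2)) with hgood
  set g : ℕ → (ℕ → ℝ) → ℝ := fun i x => if good i then f i x else 0 with hg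
  have hgBL : ∀ i, BL (m i + 1) (m (i + 1) + 1) (g i) := fun i => by
    by_cases hi : good i
    · simpa [hg, hi] using hfBL i
    · simpa [hg, hi] using BL.const 0
  have hg0 : ∀ i x, 0 ≤ g i x := fun i x => by
    simp only [hg]; split_ifs
    exacts [ramp_nonneg _ _ _, le_rfl]
  have hg1 : ∀ i x, g i x ≤ 1 := fun i x => by
    simp only [hg]; split_ifs
    exacts [ramp_le_one _ _ _, zero_le_one]
  have hprod := conj_prod_one_sub_le h.mem h.indep (k := fun i => m i + 1)
    (fun i k hik => Nat.add_le_add_right (hm.strictMono.monotone hik) 1) hgBL hg1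
  have heg0 : ∀ i, 0 ≤ S.e (fun ω => g i (fun j => X j ω)) := fun i =>
    e_nonneg (bl_L1 h.mem (hgBL i)) fun ω => hg0 i _
  have hns : ¬ Summable fun i => S.e (fun ω => g i (fun j => X j ω)) := by
    intro hs
    refine not_summable_exp_loglog h.sqL1 (δ := 2 * β) (by linarith) (hdiv _ (by linarith)) hθ hm
      (hm0 ▸ (hK K le_rfl).2.2.2.2) ?_
    rw [← summable_nat_add_iff 1]
    have hrho := (summable_nat_add_iff 1).2 (summable_rho_chain h.mem h.sqL1 (by linarith)
      (by positivity) hd hsum hj0p hθ hm (hm0 ▸ (hK K le_rfl).2.2.2.1))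
    refine Summable.of_nonneg_of_le (fun i => (Real.exp_pos _).le) (fun i => ?_)
      ((hs.mul_left 2).add hrho)
    have hrho0 := rho_nonneg (S := S) (X := X) p (β ^ 2 / 64) j0 (m (i + 1))
    by_cases hi : good i
    · have hKi := hK (m (i + 1)) (hmK _)
      have h1 := hKi.1 hKi.2.1 (m i) (hK _ (hmK i)).2.2.2.1 (hlt i).le (hgrow i) hi σ hσ
      have h2 : S.e (fun ω => g i (fun j => X j ω)) = S.e (fun ω => f i (fun j => X j ω)) := by
        simp [hg, hi]
      rw [h2]
      have h3 := Real.rpow_nonneg hrho0 (d + 1)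
      linarith
    -- On a block switched off, `δ = 1 / (16 (d + 1))` gives `rho ^ (d + 1) ≥ exp (-loglog / 2)`,
    -- more than the term it would have to supply. Since the `rho ^ (d + 1)` are summable, the
    -- divergence is carried by the good blocks.
    · have h1 : Real.exp (-(4 * δ * S.t X (m (i + 1)) ^ 2)) <
        S.rho X p (β ^ 2 / 64) j0 (m (i + 1)) := not_le.1 hi
      have h2 := Real.rpow_le_rpow (Real.exp_pos _).le h1.le (by linarith : 0 ≤ d + 1)
      rw [← Real.exp_mul, t_sq] at h2
      have h3 : -(4 * δ * (2 * S.loglog X (m (i + 1)))) * (d + 1) =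
          -(1 / 2 * S.loglog X (m (i + 1))) := by
        rw [hδ]; field_simp; norm_num
      rw [h3] at h2
      have h4 : Real.exp (-(1 - 2 * β) * S.loglog X (m (i + 1))) ≤
          Real.exp (-(1 / 2 * S.loglog X (m (i + 1)))) := by
        refine Real.exp_le_exp.2 ?_
        have := one_le_loglog (S := S) (X := X) (m (i + 1))
        nlinarith
      have h5 := heg0 i
      linarith
  have htop := (not_summable_iff_tendsto_nat_atTop_of_nonneg heg0).1 hns
  obtain ⟨I, hI⟩ := (htop.eventually_ge_atTop (-Real.log ε)).exists
  obtain ⟨hBL, -, hle⟩ := hprod I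
  refine ⟨m I + 1, ?_, _, hBL.mono ?_ le_rfl, ?_, ?_, hle.trans ?_, fun x hx => ?_⟩
  · have := (hK _ (hmK I)).2.2.1
    omega
  · have := (hK _ (hmK 0)).2.2.1
    omega
  · exact fun x => Finset.prod_nonneg fun i _ => sub_nonneg.2 (hg1 i x)
  · exact fun x => Finset.prod_le_one (fun i _ => sub_nonneg.2 (hg1 i x))
      fun i _ => by linarith [hg0 i x]
  · rw [← Real.le_log_iff_exp_le hε]; linarith
  · have hex : ∃ i, 0 < g i x := by
      by_contra! hc
      rw [Finset.prod_eq_one fun i _ => by rw [le_antisymm (hc i) (hg0 i x), sub_zero]] at hx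
      exact lt_irrefl _ hx
    obtain ⟨i, hi⟩ := hex
    have hgi : good i := by
      by_contra hc
      simp [hg, hc] at hi
    simp only [hg, hgi, if_true] at hi
    refine ⟨m i, m (i + 1), (hK _ (hmK i)).2.2.1, hlt i, hgrow i, ?_⟩
    have := lt_of_ramp_pos (mul_pos hβ (hapos _)) hi
    linarith

end SublinearExpectationSpace

/-! ### From lower expectations to one probability measure. -/

theorem limsup_coe_le_one {x : ℕ → ℝ} (h : ∀ η > 0, ∀ᶠ n in atTop, x n ≤ 1 + η) :
    limsup (fun n => (x n : EReal)) atTop ≤ 1 := by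
  by_contra! hc
  obtain ⟨z, hz1, hz2⟩ := EReal.lt_iff_exists_real_btwn.1 hc
  have hz : (1 : ℝ) < z := by exact_mod_cast hz1
  refine hz2.not_ge (limsup_le_of_le (by isBoundedDefault) ?_)
  filter_upwards [h (z - 1) (by linarith)] with n hn
  exact_mod_cast (by linarith : x n ≤ z)

theorem one_le_limsup_coe {x : ℕ → ℝ} (h : ∀ η > 0, ∃ᶠ n in atTop, 1 - η ≤ x n) :
    1 ≤ limsup (fun n => (x n : EReal)) atTop := by
  by_contra! hc
  obtain ⟨z, hz1, hz2⟩ := EReal.lt_iff_exists_real_btwn.1 hc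
  have hz : z < (1 : ℝ) := by exact_mod_cast hz2
  refine hz1.not_ge (le_limsup_of_frequently_le ?_ (by isBoundedDefault))
  refine (h (1 - z) (by linarith)).mono fun n hn => ?_
  exact_mod_cast (by linarith : z ≤ x n)

theorem measure_eq_one_of_ae {Ω : Type*} {m0 : MeasurableSpace Ω} (P : Measure Ω)
    [IsProbabilityMeasure P] {G : Set Ω} (h : ∀ᵐ ω ∂P, ω ∈ G) : P G = 1 := by
  have h1 : P G = P Set.univ := measure_congr (eventuallyEq_univ.2 h)
  rw [h1, measure_univ]

theorem integrable_sum_of_mem_Icc {Ω : Type*} {m0 : MeasurableSpace Ω} (P : Measure Ω)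
    [IsProbabilityMeasure P] {h : ℕ → Ω → ℝ} (hm : ∀ q, Measurable (h q)) (h0 : ∀ q ω, 0 ≤ h q ω)
    (h1 : ∀ q ω, h q ω ≤ 1) (M : ℕ) :
    Integrable (fun ω => ∑ q ∈ Finset.range M, h q ω) P := by
  refine integrable_finsetSum _ fun q _ => ?_
  refine Integrable.of_bound (hm q).aestronglyMeasurable 1 (ae_of_all _ fun ω => ?_)
  rw [Real.norm_eq_abs, abs_of_nonneg (h0 q ω)]
  exact h1 q ω

/-- By monotone convergence the whole series is integrable, hence almost surely finite, and its
terms tend to zero. -/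
theorem ae_eventually_lt_one_of_integral_sum_le {Ω : Type*} {m0 : MeasurableSpace Ω}
    (P : Measure Ω) [IsProbabilityMeasure P] {h : ℕ → Ω → ℝ} (hm : ∀ q, Measurable (h q))
    (h0 : ∀ q ω, 0 ≤ h q ω) (h1 : ∀ q ω, h q ω ≤ 1) {C : ℝ}
    (hC : ∀ M, ∫ ω, ∑ q ∈ Finset.range M, h q ω ∂P ≤ C) :
    ∀ᵐ ω ∂P, ∀ᶠ q in atTop, h q ω < 1 := by
  have hmE : ∀ q, Measurable fun ω => ENNReal.ofReal (h q ω) := fun q => (hm q).ennreal_ofReal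
  have hle : ∫⁻ ω, ∑' q, ENNReal.ofReal (h q ω) ∂P ≤ ENNReal.ofReal C := by
    rw [lintegral_tsum fun q => (hmE q).aemeasurable, ENNReal.tsum_eq_iSup_nat]
    refine iSup_le fun M => ?_
    rw [← lintegral_finsetSum _ fun q _ => hmE q]
    refine le_trans (le_of_eq ?_) (ENNReal.ofReal_le_ofReal (hC M))
    rw [ofReal_integral_eq_lintegral_ofReal (integrable_sum_of_mem_Icc P hm h0 h1 M)
      (ae_of_all _ fun ω => Finset.sum_nonneg fun q _ => h0 q ω)]
    refine lintegral_congr fun ω => ?_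
    rw [ENNReal.ofReal_sum_of_nonneg fun q _ => h0 q ω]
  have hae := ae_lt_top (Measurable.tsum hmE) (hle.trans_lt ENNReal.ofReal_lt_top).ne
  filter_upwards [hae] with ω hω
  filter_upwards [(ENNReal.tendsto_atTop_zero_of_tsum_ne_top hω.ne).eventually
    (gt_mem_nhds zero_lt_one)] with q hq
  rwa [ENNReal.ofReal_lt_one] at hq

theorem cBLip_sum_ramp (M : ℕ) : CBLip (fun x : Fin M → ℝ => ∑ i, ramp 1 1 (x i)) := by
  refine ⟨⟨M, LipschitzWith.of_dist_le_mul fun x y => ?_⟩, M, fun x => ?_⟩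
  · rw [Real.dist_eq, ← Finset.sum_sub_distrib]
    refine (Finset.abs_sum_le_sum_abs _ _).trans ?_
    refine (Finset.sum_le_card_nsmul _ _ (dist x y) fun i _ => ?_).trans (by simp)
    refine (ramp_lip one_pos _ _).trans ?_
    rw [div_one, one_mul, ← Real.dist_eq]
    exact dist_le_pi_dist x y i
  · rw [abs_of_nonneg (Finset.sum_nonneg fun i _ => ramp_nonneg _ _ _)]
    refine (Finset.sum_le_card_nsmul _ _ 1 fun i _ => ramp_le_one _ _ _).trans (by simp)

theorem ramp_one_one_eq_self {x : ℝ} (h0 : 0 ≤ x) (h1 : x ≤ 1) : ramp 1 1 x = x := by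
  simp [ramp, h0, h1]

namespace SublinearExpectationSpace

variable {Ω : Type*} [MeasurableSpace Ω] {S : SublinearExpectationSpace Ω} {X : ℕ → Ω → ℝ}

/-- For each `M` the representation yields a measure within `1` of the lower expectation of the
`M`-th partial sum. As the terms are nonnegative, the later measures also bound each fixed earlier
partial sum, and this passes to a limit point. -/
theorem exists_integral_sum_le {Ps : Set (@Measure Ω S.sigmaH)} (hCC : S.ConditionCC Ps)
    {h : ℕ → Ω → ℝ} (hH : ∀ q, h q ∈ S.H) (h0 : ∀ q ω, 0 ≤ h q ω) (h1 : ∀ q ω, h q ω ≤ 1)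
    {C : ℝ} (hC : ∀ M, - S.e (fun ω => - ∑ q ∈ Finset.range M, h q ω) ≤ C) :
    ∃ P ∈ Ps, ∀ M, ∫ ω, ∑ q ∈ Finset.range M, h q ω ∂P ≤ C + 1 := by
  have hhb : ∀ q, h q ∈ S.Hb := fun q =>
    ⟨hH q, 1, fun ω => by rw [abs_of_nonneg (h0 q ω)]; exact h1 q ω⟩
  have hex : ∀ M, ∃ P ∈ Ps, ∫ ω, ∑ q ∈ Finset.range M, h q ω ∂P ≤ C + 1 := by
    intro M
    have hL : S.L1 (fun ω => ∑ q ∈ Finset.range M, h q ω) :=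
      L1.sum _ fun q _ => L1.of_bound (hH q) (hhb q).2.choose_spec
    have hb : (fun ω => - ∑ q ∈ Finset.range M, h q ω) ∈ S.Hb := by
      refine ⟨hL.neg.1, M, fun ω => ?_⟩
      rw [abs_neg, abs_of_nonneg (Finset.sum_nonneg fun q _ => h0 q ω)]
      exact (Finset.sum_le_card_nsmul _ _ 1 fun q _ => h1 q ω).trans (by simp)
    have h2 : ((-(C + 1) : ℝ) : EReal) < S.E (fun ω => - ∑ q ∈ Finset.range M, h q ω) := by
      rw [← hL.neg.coe_e, EReal.coe_lt_coe_iff]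
      linarith [hC M]
    rw [hCC.repr _ hb] at h2
    simp only [lt_iSup_iff, EReal.coe_lt_coe_iff] at h2
    obtain ⟨P, hP, h2⟩ := h2
    refine ⟨P, hP, ?_⟩
    rw [integral_neg] at h2
    linarith
  choose Q hQ hQint using hex
  obtain ⟨k, hk, P, hP, hlim⟩ := hCC.compact h hhb Q hQ
  refine ⟨P, hP, fun M => ?_⟩
  have hlim := hlim M _ (cBLip_sum_ramp M)
  -- The test functions in (CC) must be bounded on all of `ℝ^d`; `ramp 1 1` is the identity on `[0,
  -- 1]` and makes the sum such a function.
  have heq : (fun ω => ∑ i : Fin M, ramp 1 1 (h i ω)) = fun ω => ∑ q ∈ Finset.range M, h q ω := by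
    ext ω
    rw [Finset.sum_range]
    exact Finset.sum_congr rfl fun i _ => ramp_one_one_eq_self (h0 _ ω) (h1 _ ω)
  rw [heq] at hlim
  refine le_of_tendsto hlim ?_
  filter_upwards [hk.tendsto_atTop.eventually_ge_atTop M] with j hj
  refine le_trans ?_ (hQint (k j))
  have := hCC.prob _ (hQ (k j))
  have hm := fun q => measurable_sigmaH (hH q)
  refine integral_mono (integrable_sum_of_mem_Icc _ hm h0 h1 M)
    (integrable_sum_of_mem_Icc _ hm h0 h1 (k j)) fun ω => ?_
  exact Finset.sum_le_sum_of_subset_of_nonneg (Finset.range_subset_range.2 hj)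
    fun q _ _ => h0 q ω

theorem neg_e_neg_sum_bl (hX : ∀ n, X n ∈ S.H) (hind : S.IndepSeq X) {K : ℕ → ℕ}
    (hK : Monotone K) {F : ℕ → (ℕ → ℝ) → ℝ} (hF : ∀ q, BL (K q) (K (q + 1)) (F q)) (M : ℕ) :
    - S.e (fun ω => - ∑ q ∈ Finset.range M, F q (fun i => X i ω)) =
      ∑ q ∈ Finset.range M, - S.e (fun ω => - F q (fun i => X i ω)) := by
  induction M with
  | zero => simp [e_const]
  | succ M ih =>
    rw [Finset.sum_range_succ, ← ih]
    have hU : BL 0 (K M) (fun x => - ∑ q ∈ Finset.range M, F q x) :=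
      (BL.sum _ fun q hq => (hF q).mono (Nat.zero_le _)
        (hK (Nat.succ_le_of_lt (Finset.mem_range.1 hq)))).neg
    have := e_add_bl hX hind (hK (Nat.le_succ M)) hU (hF M).neg
    simp only [Finset.sum_range_succ, neg_add]
    rw [this]; ring

/-- The outcomes for which the terms are negligible and the partial sums satisfy the upper half of
the law of the iterated logarithm. -/
def regularSet (S : SublinearExpectationSpace Ω) (X : ℕ → Ω → ℝ) : Set Ω :=
  {ω | (∀ δ > 0, ∀ᶠ n in atTop, |X n ω| ≤ δ * S.a X n) ∧
    ∀ η > 0, ∀ᶠ n in atTop, |partialSum X n ω| ≤ (1 + η) * S.a X n}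

namespace LILData

theorem outerCap_regularSet_compl (h : S.LILData X) : S.outerCap (S.regularSet X)ᶜ = 0 := by
  have hk : ∀ k : ℕ, (0 : ℝ) < 1 / (k + 1) := fun k => by positivity
  refine le_antisymm ((outerCap_mono fun ω hω => ?_).trans (outerCap_iUnion_null fun k : ℕ =>
    outerCap_union_null (h.tail _ (hk k)) (outerCap_union_null (h.exceed_null (Or.inl rfl) (hk k))
      (h.exceed_null (Or.inr rfl) (hk k)))).le) zero_le
  by_contra hc
  simp only [Set.mem_iUnion, Set.mem_union, Set.mem_ofPred_eq, not_exists, not_or, not_frequently,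
    not_lt] at hc
  refine hω ⟨fun δ hδ => ?_, fun η hη => ?_⟩
  · obtain ⟨k, hkδ⟩ := exists_nat_one_div_lt hδ
    filter_upwards [(hc k).1] with n hn
    exact hn.trans (mul_le_mul_of_nonneg_right hkδ.le (a_nonneg n))
  · obtain ⟨k, hkδ⟩ := exists_nat_one_div_lt hη
    filter_upwards [(hc k).2.1, (hc k).2.2] with n hn hn'
    have : (1 + 1 / ((k : ℝ) + 1)) * S.a X n ≤ (1 + η) * S.a X n :=
      mul_le_mul_of_nonneg_right (by linarith) (a_nonneg n)
    rw [abs_le]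
    constructor <;> linarith

theorem limsup_abs_le (h : S.LILData X) {ω : Ω} (hω : ω ∈ S.regularSet X) :
    limsup (fun n => ((|partialSum X n ω| / S.a X n : ℝ) : EReal)) atTop ≤ 1 := by
  refine limsup_coe_le_one fun η hη => ?_
  filter_upwards [hω.2 η hη, h.sqTop.eventually_gt_atTop 0] with n hn hpos
  rwa [div_le_iff₀ (a_pos hpos)]

/-- Large increments of the truncated variables yield large partial sums. -/
theorem frequently_le_partialSum (h : S.LILData X) {ω : Ω} (hω : ω ∈ S.regularSet X) {σ β δ : ℝ}
    (hσ : σ = 1 ∨ σ = -1) (hβ : 0 < β) (hδ : 0 < δ)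
    (hev : ∀ L : ℕ, ∃ m N, L ≤ m ∧ m < N ∧ 8 * S.sq X m ≤ β ^ 2 * S.sq X N ∧
      (1 - 6 * β) * S.a X N <
        ∑ j ∈ Finset.Ico (m + 1) (N + 1), σ * clip (δ * S.a X N) (X j ω)) :
    ∃ᶠ N in atTop, (1 - 7 * β) * S.a X N ≤ σ * partialSum X N ω := by
  obtain ⟨J, hJ⟩ := eventually_atTop.1
    ((h.eventually_forall_le hδ (hω.1 δ hδ)).and (hω.2 1 one_pos))
  rw [frequently_atTop]
  intro L
  obtain ⟨m, N, hm, hmN, hsq, hsum⟩ := hev (max J L)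
  have hmJ : J ≤ m := (le_max_left _ _).trans hm
  refine ⟨N, ((le_max_right _ _).trans hm).trans hmN.le, ?_⟩
  have hS : ∑ j ∈ Finset.Ico (m + 1) (N + 1), σ * clip (δ * S.a X N) (X j ω) =
      σ * partialSum X N ω - σ * partialSum X m ω := by
    rw [← mul_sub, partialSum, partialSum, ← Finset.sum_Ico_eq_sub _ (by omega), Finset.mul_sum]
    refine Finset.sum_congr rfl fun j hj => ?_
    have := Finset.mem_Ico.1 hj
    rw [clip_eq_self ((hJ N (by omega)).1 j (by omega))]
  have h1 := (hJ m hmJ).2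
  have h2 : -(σ * partialSum X m ω) ≤ 2 * S.a X m := by
    have := neg_abs_le (σ * partialSum X m ω)
    rw [abs_sign_mul hσ] at this
    linarith
  -- The factor `8` in the growth condition makes the preceding sum, at most `2 * a m`, cost no more
  -- than one further `β`.
  have h3 : 2 * S.a X m ≤ β * S.a X N := by
    refine le_of_sq_le_sq ?_ (mul_nonneg hβ.le (a_nonneg N))
    rw [mul_pow, mul_pow, a_sq h.sqL1, a_sq h.sqL1]
    have h4 := loglog_mono h.sqL1 hmN.le
    have h5 := one_le_loglog (S := S) (X := X) m
    have h6 := sq_nonneg' h.sqL1 m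
    have h7 := sq_nonneg' h.sqL1 N
    have h8 : 8 * S.sq X m * S.loglog X m ≤ β ^ 2 * S.sq X N * S.loglog X N :=
      mul_le_mul hsq h4 (by linarith) (by positivity)
    have h9 : 0 ≤ β ^ 2 * S.sq X N * S.loglog X N := by
      have : 0 ≤ S.loglog X N := by linarith
      positivity
    linarith
  linarith

/-- All signs and precisions must be served by the same measure. The stages run through the pairs of
sign and precision, each infinitely often, on successive disjoint ranges, with lower expectations
summing to at most `2`. -/
theorem exists_prob_frequently {Ps : Set (@Measure Ω S.sigmaH)} (hCC : S.ConditionCC Ps)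
    (h : S.LILData X) (hdiv : S.DivergentVariances X) :
    ∃ P ∈ Ps, ∀ᵐ ω ∂P, ω ∈ S.regularSet X → ∀ σ : ℝ, (σ = 1 ∨ σ = -1) → ∀ η > 0,
      ∃ᶠ N in atTop, (1 - η) * S.a X N ≤ σ * partialSum X N ω := by
  -- The parity of the code `n` is the sign and `n / 2` the precision; `7 * β n` drops below any
  -- given `η`.
  set β : ℕ → ℝ := fun n => 1 / 20 / ((n / 2 : ℕ) + 1) with hβdef
  set sgn : ℕ → ℝ := fun n => if n % 2 = 0 then 1 else -1 with hsgn
  have hβ : ∀ n, 0 < β n := fun n => by positivity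
  have hβ1 : ∀ n, β n ≤ 1 / 20 := fun n => div_le_self (by norm_num) (by simp)
  have hσ : ∀ n, sgn n = 1 ∨ sgn n = -1 := fun n => by
    simp only [hsgn]; split_ifs <;> simp
  choose δ hδ hrange using fun n => h.exists_range hdiv (hσ n) (hβ n) (hβ1 n)
  choose next hnext F hFBL hF0 hF1 hFe hFev using hrange
  have hε : ∀ q : ℕ, ((1 : ℝ) / 2) ^ q > 0 := fun q => by positivity
  let K : ℕ → ℕ := fun q => Nat.rec 0 (fun q k => next (Nat.unpair q).1 k _ (hε q)) q
  have hKlt : ∀ q, K q < K (q + 1) := fun q => hnext (Nat.unpair q).1 (K q) _ (hε q)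
  have hKmono : StrictMono K := strictMono_nat_of_lt_succ hKlt
  set G : ℕ → (ℕ → ℝ) → ℝ := fun q => F (Nat.unpair q).1 (K q) _ (hε q) with hG
  have hGBL : ∀ q, BL (K q) (K (q + 1)) (G q) := fun q => hFBL (Nat.unpair q).1 (K q) _ (hε q)
  obtain ⟨P, hP, hint⟩ := exists_integral_sum_le hCC (h := fun q ω => G q (fun i => X i ω))
    (fun q => bl_mem h.mem (hGBL q)) (fun q ω => hF0 _ _ _ _ _) (fun q ω => hF1 _ _ _ _ _)
    (C := 2) fun M => by
      rw [neg_e_neg_sum_bl h.mem h.indep hKmono.monotone hGBL]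
      refine (Finset.sum_le_sum fun q _ => hFe (Nat.unpair q).1 (K q) _ (hε q)).trans ?_
      exact sum_geometric_two_le M
  have := hCC.prob P hP
  refine ⟨P, hP, ?_⟩
  have hae := ae_eventually_lt_one_of_integral_sum_le P
    (h := fun q ω => G q (fun i => X i ω))
    (fun q => measurable_sigmaH (bl_mem h.mem (hGBL q))) (fun q ω => hF0 _ _ _ _ _)
    (fun q ω => hF1 _ _ _ _ _) hint
  filter_upwards [hae] with ω hlt hω σ hσ' η hη
  obtain ⟨Q, hQ⟩ := eventually_atTop.1 hlt
  obtain ⟨k, hk⟩ := exists_nat_one_div_lt hη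
  obtain ⟨n, hn1, hn2⟩ : ∃ n, sgn n = σ ∧ n / 2 = k := by
    rcases hσ' with rfl | rfl
    · exact ⟨2 * k, by simp [hsgn], by omega⟩
    · exact ⟨2 * k + 1, by simp [hsgn], by omega⟩
  have hfr := h.frequently_le_partialSum hω (hσ n) (hβ n) (hδ n) fun L => by
    -- A stage that treats the code `n`, lies beyond `L`, and at which failure no longer occurs; `K
    -- q ≥ q` puts its range beyond `L`.
    set q := Nat.pair n (max L Q) with hq
    have hqL : max L Q ≤ q := Nat.right_le_pair _ _
    have hn : (Nat.unpair q).1 = n := by rw [hq, Nat.unpair_pair]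
    obtain ⟨m, N, h1, h2, h3, h4⟩ :=
      hFev (Nat.unpair q).1 (K q) _ (hε q) _ (hQ q ((le_max_right _ _).trans hqL))
    rw [hn] at h3 h4
    exact ⟨m, N, (((le_max_left _ _).trans hqL).trans (hKmono.id_le q)).trans h1, h2, h3, h4⟩
  rw [hn1] at hfr
  refine hfr.mono fun N hN => le_trans ?_ hN
  refine mul_le_mul_of_nonneg_right ?_ (a_nonneg N)
  have h5 : β n = 1 / 20 * (1 / ((k : ℝ) + 1)) := by
    simp only [hβdef]; rw [hn2]; ring
  have h6 : 0 < 1 / ((k : ℝ) + 1) := by positivity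
  rw [h5]
  linarith

theorem limsup_eq_one (h : S.LILData X) {ω : Ω} (hω : ω ∈ S.regularSet X) {σ : ℝ}
    (hσ : σ = 1 ∨ σ = -1)
    (hfr : ∀ η > 0, ∃ᶠ N in atTop, (1 - η) * S.a X N ≤ σ * partialSum X N ω) :
    limsup (fun n => ((σ * (partialSum X n ω / S.a X n) : ℝ) : EReal)) atTop = 1 := by
  have hpos := h.sqTop.eventually_gt_atTop 0
  refine le_antisymm (limsup_coe_le_one fun η hη => ?_) (one_le_limsup_coe fun η hη => ?_)
  · filter_upwards [hω.2 η hη, hpos] with n hn hpos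
    rw [← mul_div_assoc, div_le_iff₀ (a_pos hpos)]
    have := le_abs_self (σ * partialSum X n ω)
    rw [abs_sign_mul hσ] at this
    linarith
  · refine ((hfr η hη).and_eventually hpos).mono fun n hn => ?_
    rw [← mul_div_assoc, le_div_iff₀ (a_pos hn.2)]
    exact hn.1

theorem one_le_capOf {Ps : Set (@Measure Ω S.sigmaH)} (hCC : S.ConditionCC Ps)
    (h : S.LILData X) (hdiv : S.DivergentVariances X) :
    1 ≤ S.capOf Ps
      {ω | liminf (fun n => ((partialSum X n ω / S.a X n : ℝ) : EReal)) atTop = -1 ∧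
        limsup (fun n => ((partialSum X n ω / S.a X n : ℝ) : EReal)) atTop = 1} := by
  obtain ⟨P, hP, hae⟩ := exists_prob_frequently hCC h hdiv
  have := hCC.prob P hP
  -- Every measure of the family is dominated by `outerCap`, so the upper half holds almost surely
  -- under `P` too.
  have hnull : P (S.regularSet X)ᶜ = 0 := by
    refine le_antisymm ?_ zero_le
    rw [← h.outerCap_regularSet_compl]
    exact ((le_iSup₂ (f := fun P (_ : P ∈ Ps) => P (S.regularSet X)ᶜ) P hP).trans
      (capOf_le_cStar hCC _)).trans (cStar_le_outerCap _)
  have hreg : ∀ᵐ ω ∂P, ω ∈ S.regularSet X := hnull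
  rw [← measure_eq_one_of_ae P (G := {ω |
    liminf (fun n => ((partialSum X n ω / S.a X n : ℝ) : EReal)) atTop = -1 ∧
      limsup (fun n => ((partialSum X n ω / S.a X n : ℝ) : EReal)) atTop = 1}) ?_]
  · exact le_iSup₂ (f := fun P (_ : P ∈ Ps) => P _) P hP
  · filter_upwards [hae, hreg] with ω h1 hω
    constructor
    · have h2 := h.limsup_eq_one hω (Or.inr rfl) (h1 hω (-1) (Or.inr rfl))
      have h3 : (fun n => ((-1 * (partialSum X n ω / S.a X n) : ℝ) : EReal)) =
          -fun n => ((partialSum X n ω / S.a X n : ℝ) : EReal) := by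
        ext n; simp
      rw [h3, EReal.limsup_neg] at h2
      rw [← h2, neg_neg]
    · simpa using h.limsup_eq_one hω (Or.inl rfl) (h1 hω 1 (Or.inl rfl))

end LILData

end SublinearExpectationSpace

theorem mainTheorem6 {Ω : Type*} [MeasurableSpace Ω] (S : SublinearExpectationSpace Ω)
    (Ps : Set (@Measure Ω S.sigmaH)) (hCC : S.ConditionCC Ps)
    (V : Set Ω → ℝ) (hV : S.IsUpperCapacity V)
    (X : ℕ → Ω → ℝ) (hX : ∀ n, X n ∈ S.H) (hindep : S.IndepSeq X)
    (hsq : ∀ n, S.E (fun ω => X n ω ^ 2) < ⊤)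
    (htail : ∀ ε : ℝ, 0 < ε → Summable (fun n => V {ω | ε * S.a X n ≤ |X n ω|}))
    (hmom : ∀ α : ℝ, 0 < α → ∃ p d : ℝ, 2 ≤ p ∧ 0 ≤ d ∧
      ∑' n : {n : ℕ // 0 < S.a X n},
        S.Gam X p α n / ENNReal.ofReal (S.a X n ^ p) *
          (S.Lam X p α n / ENNReal.ofReal (S.a X n ^ p)) ^ d < ⊤)
    (hdiv : ∀ δ : ℝ, 0 < δ →
      ¬ Summable (fun n => (S.sq X n)⁻¹ * pLog (S.sq X n) ^ (δ - 1) *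
        (S.E (fun ω => X n ω ^ 2)).toReal))
    (hmean : Tendsto (fun n =>
      (∑ j ∈ Finset.range (n + 1), |(S.E (X j)).toReal| +
        ∑ j ∈ Finset.range (n + 1), |(S.conj (X j)).toReal|) / S.a X n) atTop (𝓝 0)) :
    ∀ W ∈ ({S.capOf Ps, S.cStar, S.outerCap} : Set (Set Ω → ℝ≥0∞)),
      W {ω | 1 < limsup (fun n => ((|partialSum X n ω| / S.a X n : ℝ) : EReal)) atTop} = 0 ∧
      W {ω | liminf (fun n => ((partialSum X n ω / S.a X n : ℝ) : EReal)) atTop = -1 ∧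
        limsup (fun n => ((partialSum X n ω / S.a X n : ℝ) : EReal)) atTop = 1} = 1 := by
  have h2 : ∀ n, S.L1 (fun ω => X n ω ^ 2) := fun n =>
    SublinearExpectationSpace.L1.of_nonneg (S.comp_mem_one (hX n) cLLip_sq)
      (fun _ => sq_nonneg _) (hsq n)
  have hq := SublinearExpectationSpace.tendsto_sq h2 hdiv
  have h : S.LILData X :=
    { mem := hX
      indep := hindep
      sqL1 := h2
      tail := fun δ hδ => SublinearExpectationSpace.tail_null hV hX htail hq hδ
      moments := hmom
      sqTop := hq
      mean := by
        refine hmean.congr fun n => ?_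
        rw [← Finset.sum_add_distrib]
        congr 1
        refine Finset.sum_congr rfl fun j _ => ?_
        simp [SublinearExpectationSpace.meanAbs, SublinearExpectationSpace.e,
          SublinearExpectationSpace.conj] }
  have hle1 := S.capOf_le_cStar hCC
  have hle2 := S.cStar_le_outerCap
  set A := {ω | 1 < limsup (fun n => ((|partialSum X n ω| / S.a X n : ℝ) : EReal)) atTop}
  -- The sandwich is used in both directions: nullity descends from `outerCap`, and the value one
  -- ascends from `capOf`, all three being at most one.
  have hA : S.outerCap A = 0 := by
    refine le_antisymm ?_ zero_le
    rw [← h.outerCap_regularSet_compl]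
    exact SublinearExpectationSpace.outerCap_mono fun ω hω hreg =>
      (h.limsup_abs_le hreg).not_gt hω
  have hB := h.one_le_capOf hCC hdiv
  rintro W (rfl | rfl | rfl)
  · exact ⟨le_antisymm ((hle1 A).trans ((hle2 A).trans hA.le)) zero_le,
      le_antisymm ((hle1 _).trans ((hle2 _).trans (SublinearExpectationSpace.outerCap_le_one _)))
        hB⟩
  · exact ⟨le_antisymm ((hle2 A).trans hA.le) zero_le,
      le_antisymm ((hle2 _).trans (SublinearExpectationSpace.outerCap_le_one _))
        (hB.trans (hle1 _))⟩
  · exact ⟨hA, le_antisymm (SublinearExpectationSpace.outerCap_le_one _)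
      ((hB.trans (hle1 _)).trans (hle2 _))⟩
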